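/- **Theorem (error representation for Lions domain decomposition).** *Domains and transformation.* Let $\Omega\subset\mathbb R^2$ be a polygonal domain with a conforming partition into nondegenerate open triangles $\Omega_1,\dots,\Omega_D$: their interiors are disjoint, $\Omega$ is the interior of $\overline\Omega=\bigcup_d\overline{\Omega_d}$, and two closed triangles meet in nothing, a common vertex or a common edge. Moving the nodes of the partition by a perturbation $\theta$ gives triangles $\Omega_d(\theta)$ which form a conforming partition of a perturbed polygonal domain $\Omega(\theta)\subseteq\Omega^*$. Let $\varphi_d:\Omega_d(\theta)\to\Omega_d$ be the affine map that takes vertices to corresponding vertices, with Jacobian matrix $\mathbf J_d$. Let $a$ be a continuous, symmetric, uniformly positive definite $2\times2$ matrix function on $\overline{\Omega^*}$, let $f$ be continuous on $\overline{\Omega^*}$ and let $\psi\in L^2(\Omega^*)$. For $y\in\overline{\Omega_d}$ put $$\mathbf A_d(y)=|\det \mathbf J_d|^{-1}\,\mathbf J_d\,a(\varphi_d^{-1}(y))\,\mathbf J_d^{\top},\qquad F_d(y)=|\det \mathbf J_d|^{-1}f(\varphi_d^{-1}(y)),\qquad \tilde\psi(y)=|\det \mathbf J_d|^{-1}\psi(\varphi_d^{-1}(y)),$$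 and let $\mathbf A=\mathbf A_d$, $F=F_d$ on $\Omega_d$. The quantity of interest is $Q(w)=\int_\Omega w\,\tilde\psi\,dy$. *Notation.* Let $(f,g)_d=\int_{\Omega_d}f g\,dy$ (with $f\cdot g$ for vector fields) and $\langle f,g\rangle_{d\cap\tilde d}=\int_{\partial\Omega_d\cap\partial\Omega_{\tilde d}}f g$ (arc length). Let $\mathbf n_d$ be the outward unit normal of $\Omega_d$, and $d'$ the set of $\tilde d\ne d$ such that $\partial\Omega_d\cap\partial\Omega_{\tilde d}$ contains more than one point. Boundary values of functions and fluxes with index $d$ are taken from inside $\Omega_d$. *Primal and adjoint solutions.* Let $u,\eta\in H^1_0(\Omega)$ be the weak solutions of $$-\nabla\cdot(\mathbf A\nabla u)=F,\qquad -\nabla\cdot(\mathbf A\nabla\eta)=\tilde\psi\quad\text{in }\Omega,\qquad u=\eta=0\quad\text{on }\partial\Omega .$$ Assume that on each interface $\partial\Omega_d\cap\partial\Omega_{\tilde d}$ with $\tilde d\in d'$ the normal flux $\mathbf n_d\cdot\mathbf A_d\nabla\eta$ has an integrable trace from inside $\Omega_d$, that is, with $c_d$ the centroid of $\Omega_d$,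 there is an integrable function $\gamma$ on the interface with $$\frac1\varepsilon\int_0^\varepsilon\int_{\partial\Omega_d\cap\partial\Omega_{\tilde d}}\bigl|\mathbf n_d(y)\cdot(\mathbf A_d\nabla\eta)(y+t(c_d-y))-\gamma(y)\bigr|\,dy\,dt\to0\qquad(\varepsilon\to0^+);$$ $\mathbf n_d\cdot\mathbf A_d\nabla\eta$ on the interface then denotes $\gamma$. (This holds for instance if $\eta|_{\Omega_d}\in H^2(\Omega_d)$ for every $d$.) *Discrete Lions iteration.* For each $d$ let $\mathcal T_h^d$ be a conforming triangulation of $\Omega_d$ and let $V_h(\Omega_d)$ be the space of continuous functions on $\overline{\Omega_d}$ that are affine on each element of $\mathcal T_h^d$ and vanish on $\partial\Omega_d\cap\partial\Omega$. Fix $\lambda\ge0$ and $I\in\mathbb N$. Given $U_d^{(0)}\in V_h(\Omega_d)$, let $U_d^{(i)}\in V_h(\Omega_d)$, $i=1,\dots,I$, satisfy, for all $d$ and all $v\in V_h(\Omega_d)$, $$(\mathbf A_d\nabla U_d^{(i)},\nabla v)_d+\sum_{\tilde d\in d'}\lambda\langle U_d^{(i)},v\rangle_{d\cap\tilde d}=(F_d,v)_d+\sum_{\tilde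 d\in d'}\Bigl(\lambda\langle U_{\tilde d}^{(i-1)},v\rangle_{d\cap\tilde d}-\langle\mathbf n_{\tilde d}\cdot\mathbf A_{\tilde d}\nabla U_{\tilde d}^{(i-1)},v\rangle_{d\cap\tilde d}\Bigr),$$ and let $U^{(i)}=U^{(i)}_d$ on $\Omega_d$. *Conclusion.* For every $1\le i\le I$, $$Q(u-U^{(i)})=DE^{(i)}+IE^{(i)}+CE^{(i)},$$ where $$DE^{(i)}=\sum_{d=1}^D\Bigl[(F_d,\eta)_d-(\mathbf A_d\nabla U_d^{(i)},\nabla\eta)_d+\sum_{\tilde d\in d'}\bigl\langle-\lambda U_d^{(i)}+\lambda U_{\tilde d}^{(i-1)}-\mathbf n_{\tilde d}\cdot\mathbf A_{\tilde d}\nabla U_{\tilde d}^{(i-1)},\eta\bigr\rangle_{d\cap\tilde d}\Bigr],$$ $$IE^{(i)}=\sum_{d=1}^D\sum_{\tilde d\in d'}\Bigl(\bigl\langle\lambda U_d^{(i)}-\lambda U_d^{(i-1)},\eta\bigr\rangle_{d\cap\tilde d}+\bigl\langle\mathbf n_d\cdot\mathbf A_d\nabla U_d^{(i-1)}-\mathbf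 n_d\cdot\mathbf A_d\nabla U_d^{(i)},\eta\bigr\rangle_{d\cap\tilde d}\Bigr),$$ $$CE^{(i)}=\frac12\sum_{d=1}^D\sum_{\tilde d\in d'}\Bigl(\bigl\langle\mathbf n_d\cdot\mathbf A_d\nabla U_d^{(i)}-\mathbf n_d\cdot\mathbf A_{\tilde d}\nabla U_{\tilde d}^{(i)},\eta\bigr\rangle_{d\cap\tilde d}+\bigl\langle\mathbf n_d\cdot\mathbf A_d\nabla\eta,\,U_d^{(i)}-U_{\tilde d}^{(i)}\bigr\rangle_{d\cap\tilde d}\Bigr).$$ -/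

import Mathlib

open MeasureTheory Set Filter Topology
open scoped ENNReal ContDiff

noncomputable section

namespace LionsDD

/-- The Euclidean plane. -/
abbrev Plane : Type := EuclideanSpace ℝ (Fin 2)

/-- Real `2 × 2` matrices. -/
abbrev Mat : Type := Matrix (Fin 2) (Fin 2) ℝ

/-- The matrix-vector product `M v` in the Euclidean plane. -/
def mulV (M : Mat) (v : Plane) : Plane := Matrix.toEuclideanLin M v

/-! ### Triangles and partitions into triangles -/

/-- The closed triangle with vertices `p 0`, `p 1`, `p 2`. -/
def closedTri (p : Fin 3 → Plane) : Set Plane := convexHull ℝ (range p)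

/-- The open triangle with vertices `p 0`, `p 1`, `p 2`. -/
def openTri (p : Fin 3 → Plane) : Set Plane := interior (closedTri p)

/-- The centre of gravity of a triangle. -/
def center (p : Fin 3 → Plane) : Plane := (3 : ℝ)⁻¹ • ∑ k, p k

/-- A finite family of nondegenerate triangles with disjoint interiors that meet face to face: two
closed triangles intersect exactly in the convex hull of their common vertices (nothing, a vertex
or a whole edge). -/
def IsConforming {n : ℕ} (t : Fin n → Fin 3 → Plane) : Prop :=
  (∀ m, AffineIndependent ℝ (t m)) ∧
  ∀ m m', m ≠ m' →
    Disjoint (openTri (t m)) (openTri (t m')) ∧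
    closedTri (t m) ∩ closedTri (t m') = convexHull ℝ (range (t m) ∩ range (t m'))

/-- The polygonal domain (open set) that is partitioned by the triangles `t m`. -/
def domain {n : ℕ} (t : Fin n → Fin 3 → Plane) : Set Plane := interior (⋃ m, closedTri (t m))

/-- The interface `∂Ω_d ∩ ∂Ω_e`. -/
def interface {D : ℕ} (s : Fin D → Fin 3 → Plane) (d e : Fin D) : Set Plane :=
  frontier (closedTri (s d)) ∩ frontier (closedTri (s e))

open Classical in
/-- The set `d'` of the indices `e ≠ d` such that `Ω_d` and `Ω_e` share a piece of boundary that is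
more than one point. -/
def neighbors {D : ℕ} (s : Fin D → Fin 3 → Plane) (d : Fin D) : Finset (Fin D) :=
  Finset.univ.filter fun e => e ≠ d ∧ (interface s d e).Nontrivial

/-- `ν` is an outward unit normal of the closed triangle with vertices `p` at its boundary
point `y`. -/
def IsOutwardUnitNormal (p : Fin 3 → Plane) (y ν : Plane) : Prop :=
  ‖ν‖ = 1 ∧ ∀ z ∈ closedTri p, inner ℝ ν (z - y) ≤ 0

/-- The outward unit normal field `n_d` on the boundary of a triangle (it is determined by the
preceding condition at every boundary point that is not a vertex). -/
def outwardNormal (p : Fin 3 → Plane) (y : Plane) : Plane :=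
  Classical.epsilon (IsOutwardUnitNormal p y)

/-! ### The piecewise affine transformation and the transformed data -/

/-- The matrix with columns `p 1 - p 0` and `-(p 2 - p 0)`. -/
def edgeMatrix (p : Fin 3 → Plane) : Mat :=
  Matrix.of fun i j => ![(p 1 - p 0) i, -((p 2 - p 0) i)] j

/-- The Jacobian matrix `J_d = S_d R_d⁻¹` of the affine map `φ_d` that takes the triangle with
vertices `r 0, r 1, r 2` to the triangle with vertices `s 0, s 1, s 2`. -/
def jac (s r : Fin 3 → Plane) : Mat := edgeMatrix s * (edgeMatrix r)⁻¹

/-- The inverse `φ_d⁻¹(y) = J_d⁻¹ (y - s 0) + r 0` of the map `φ_d(x) = J_d (x - r 0) + s 0`. -/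
def affInv (s r : Fin 3 → Plane) (y : Plane) : Plane := mulV (jac s r)⁻¹ (y - s 0) + r 0

/-- The transformed coefficient `A_d(y) = |det J_d|⁻¹ J_d a(φ_d⁻¹(y)) J_dᵀ`. -/
def transCoeff {D : ℕ} (s r : Fin D → Fin 3 → Plane) (a : Plane → Mat) (d : Fin D) (y : Plane) :
    Mat :=
  |(jac (s d) (r d)).det|⁻¹ •
    (jac (s d) (r d) * a (affInv (s d) (r d) y) * (jac (s d) (r d)).transpose)

/-- The transformed scalar data `|det J_d|⁻¹ f(φ_d⁻¹(y))`, used for the right-hand side `f` and for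
the weight `ψ` of the quantity of interest. -/
def transData {D : ℕ} (s r : Fin D → Fin 3 → Plane) (f : Plane → ℝ) (d : Fin D) (y : Plane) : ℝ :=
  |(jac (s d) (r d)).det|⁻¹ * f (affInv (s d) (r d) y)

/-! ### The space `H¹₀` and weak solutions -/

/-- `u` belongs to `H¹₀(Ω)` and has the (weak) gradient `G`: the pair `(u, G)` is the limit in
`L²(Ω)` of pairs `(φ_n, ∇φ_n)` with smooth `φ_n` compactly supported in `Ω`. -/
def MemH10 (Ω : Set Plane) (u : Plane → ℝ) (G : Plane → Plane) : Prop :=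
  MemLp u 2 (volume.restrict Ω) ∧ MemLp G 2 (volume.restrict Ω) ∧
  ∃ φ : ℕ → Plane → ℝ,
    (∀ n, ContDiff ℝ ∞ (φ n) ∧ HasCompactSupport (φ n) ∧ tsupport (φ n) ⊆ Ω) ∧
    Tendsto (fun n => eLpNorm (φ n - u) 2 (volume.restrict Ω)) atTop (𝓝 0) ∧
    Tendsto (fun n => eLpNorm (gradient (φ n) - G) 2 (volume.restrict Ω)) atTop (𝓝 0)

section Forms

variable {D : ℕ} (s : Fin D → Fin 3 → Plane)

/-- `(f, g)_d`, the integral of `f g` over `Ω_d`. -/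
def ip (d : Fin D) (f g : Plane → ℝ) : ℝ := ∫ y in openTri (s d), f y * g y

/-- `(A_d σ, τ)_d`, the integral of `A_d σ · τ` over `Ω_d`, for vector fields `σ`, `τ`. -/
def energy (A : Fin D → Plane → Mat) (d : Fin D) (σ τ : Plane → Plane) : ℝ :=
  ∫ y in openTri (s d), inner ℝ (mulV (A d y) (σ y)) (τ y)

/-- `⟨f, g⟩_{d ∩ e}`, the integral of `f g` over `∂Ω_d ∩ ∂Ω_e` with respect to arc length. -/
def bip (d e : Fin D) (f g : Plane → ℝ) : ℝ :=
  ∫ y in interface s d e, f y * g y ∂(Measure.hausdorffMeasure 1)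

/-- `u ∈ H¹₀(Ω)`, with gradient `G`, is the weak solution of `-∇ · (A ∇u) = F` in `Ω`, `u = 0` on
`∂Ω`, where `Ω = domain s`, and `A = A_d`, `F = F_d` on `Ω_d`. -/
def IsWeakSolution (A : Fin D → Plane → Mat) (F : Fin D → Plane → ℝ)
    (u : Plane → ℝ) (G : Plane → Plane) : Prop :=
  MemH10 (domain s) u G ∧
  ∀ (v : Plane → ℝ) (Gv : Plane → Plane), MemH10 (domain s) v Gv →
    ∑ d, energy s A d G Gv = ∑ d, ip s d (F d) v

/-- The quantity of interest `Q(w) = ∑_d (w_d, ψ_d)_d` of a function given by its restrictions `w_d`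
to the subdomains. -/
def qoi (ψ : Fin D → Plane → ℝ) (w : Fin D → Plane → ℝ) : ℝ := ∑ d, ip s d (w d) (ψ d)

/-! ### Traces on the interfaces -/

/-- `g` is the trace of `f` on the curve `Γ`: it is integrable along `Γ`, and the mean
oscillation of `f` about `g(y)` on the disc of radius `ε` around `y` tends to `0` in `L¹(Γ)` as
`ε → 0`. -/
def IsTrace (Γ : Set Plane) (f g : Plane → ℝ) : Prop :=
  IntegrableOn g Γ (Measure.hausdorffMeasure 1) ∧
  Tendsto (fun ε : ℝ => ∫⁻ y in Γ,
      ((volume (Metric.ball y ε))⁻¹ * ∫⁻ z in Metric.ball y ε, ‖f z - g y‖ₑ ∂volume)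
        ∂(Measure.hausdorffMeasure 1))
    (𝓝[>] 0) (𝓝 0)

open Classical in
/-- The trace of `f` on `Γ` (unique up to null sets; it exists for every `f` in `H¹(ℝ²)`). -/
def trace (Γ : Set Plane) (f : Plane → ℝ) : Plane → ℝ :=
  if h : ∃ g, IsTrace Γ f g then h.choose else 0

/-- The trace on `∂Ω_d ∩ ∂Ω_e` of a function `η` in `H¹₀(Ω)`, extended by zero outside `Ω`. -/
def ifaceTrace (η : Plane → ℝ) (d e : Fin D) : Plane → ℝ :=
  trace (interface s d e) ((domain s).indicator η)

/-- `γ` is the trace on `∂Ω_d ∩ ∂Ω_e` of the normal component `n_d · σ`, taken from inside `Ω_d`: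
it is integrable, and `n_d(y) · σ` at the points `y + t (c - y)` of the segment from `y` to the
centre `c` of `Ω_d`, averaged over `0 < t < ε`, tends to `γ(y)` in `L¹` as `ε → 0`. -/
def IsNormalTrace (d e : Fin D) (σ : Plane → Plane) (γ : Plane → ℝ) : Prop :=
  IntegrableOn γ (interface s d e) (Measure.hausdorffMeasure 1) ∧
  Tendsto (fun ε : ℝ => (ENNReal.ofReal ε)⁻¹ * ∫⁻ t in Ioo (0 : ℝ) ε,
      ∫⁻ y in interface s d e,
        ‖inner ℝ (outwardNormal (s d) y) (σ (y + t • (center (s d) - y))) - γ y‖ₑ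
          ∂(Measure.hausdorffMeasure 1))
    (𝓝[>] 0) (𝓝 0)

open Classical in
/-- The trace of `n_d · σ` on `∂Ω_d ∩ ∂Ω_e` from inside `Ω_d` (unique up to null sets). -/
def normalTrace (d e : Fin D) (σ : Plane → Plane) : Plane → ℝ :=
  if h : ∃ γ, IsNormalTrace s d e σ γ then h.choose else 0

/-! ### The discrete Lions iteration -/

/-- `v ∈ V_h(Ω_d)`: `v` is continuous on the closed triangle, affine on each closed element of the
mesh, and zero on `∂Ω_d ∩ ∂Ω`. -/
def MemVh {n : ℕ} (mesh : Fin n → Fin 3 → Plane) (d : Fin D) (v : Plane → ℝ) : Prop :=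
  ContinuousOn v (closedTri (s d)) ∧
  (∀ m, ∃ L : Plane →ᵃ[ℝ] ℝ, EqOn v L (closedTri (mesh m))) ∧
  ∀ y ∈ frontier (closedTri (s d)) ∩ frontier (domain s), v y = 0

/-- The boundary value at `y ∈ ∂Ω_d`, from inside `Ω_d`, of the gradient of `v`. -/
def bdryGrad (d : Fin D) (v : Plane → ℝ) (y : Plane) : Plane :=
  limUnder (𝓝[openTri (s d)] y) (gradient v)

/-- `n_d · A_e ∇v` on `∂Ω_d ∩ ∂Ω_e`, with the gradient of `v` taken from inside `Ω_e`. For `e = d`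
it is the outward conormal derivative `n_d · A_d ∇v`. -/
def flux (A : Fin D → Plane → Mat) (d e : Fin D) (v : Plane → ℝ) (y : Plane) : ℝ :=
  inner ℝ (outwardNormal (s d) y) (mulV (A e y) (bdryGrad s e v y))

/-- One step of the discrete Lions iteration, from the subdomain functions `U` to the subdomain
functions `U'`. -/
def IsLionsStep {M : Fin D → ℕ} (mesh : ∀ d, Fin (M d) → Fin 3 → Plane)
    (A : Fin D → Plane → Mat) (F : Fin D → Plane → ℝ) (lam : ℝ)
    (U U' : Fin D → Plane → ℝ) : Prop :=
  ∀ (d : Fin D) (v : Plane → ℝ), MemVh s (mesh d) d v →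
    energy s A d (gradient (U' d)) (gradient v) + ∑ e ∈ neighbors s d, lam * bip s d e (U' d) v
      = ip s d (F d) v
        + ∑ e ∈ neighbors s d, (lam * bip s d e (U e) v - bip s d e (flux s A e e (U e)) v)

/-! ### The three error contributions

In each of them `U` and `U'` are the subdomain functions at iterations `i - 1` and `i`, and `η` is
the adjoint solution, with gradient `Gη`. -/

/-- The discretization contribution. -/
def discretizationError (A : Fin D → Plane → Mat) (F : Fin D → Plane → ℝ) (lam : ℝ)
    (η : Plane → ℝ) (Gη : Plane → Plane) (U U' : Fin D → Plane → ℝ) : ℝ :=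
  ∑ d, (ip s d (F d) η - energy s A d (gradient (U' d)) Gη
    + ∑ e ∈ neighbors s d,
        bip s d e (fun y => -(lam * U' d y) + lam * U e y - flux s A e e (U e) y)
          (ifaceTrace s η d e))

/-- The iteration contribution. -/
def iterationError (A : Fin D → Plane → Mat) (lam : ℝ)
    (η : Plane → ℝ) (U U' : Fin D → Plane → ℝ) : ℝ :=
  ∑ d, ∑ e ∈ neighbors s d,
    (bip s d e (fun y => lam * U' d y - lam * U d y) (ifaceTrace s η d e)
      + bip s d e (fun y => flux s A d d (U d) y - flux s A d d (U' d) y) (ifaceTrace s η d e))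

/-- The transformation contribution: half the sum of the jumps of the normal flux and of the values
of the computed solution, weighted by the adjoint solution and by its normal flux. -/
def transformationError (A : Fin D → Plane → Mat)
    (η : Plane → ℝ) (Gη : Plane → Plane) (U' : Fin D → Plane → ℝ) : ℝ :=
  (1 / 2 : ℝ) * ∑ d, ∑ e ∈ neighbors s d,
    (bip s d e (fun y => flux s A d d (U' d) y - flux s A d e (U' e) y) (ifaceTrace s η d e)
      + bip s d e (normalTrace s d e fun y => mulV (A d y) (Gη y)) (fun y => U' d y - U' e y))

end Forms

end LionsDD

end

noncomputable section

namespace LionsDD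

/-! ### Triangles as affine bases of the plane -/

/-! Write `U` for iterate `i`, `P` for iterate `i - 1`, and `γ_de` for the normal flux of `η` on the
interface, taken from `Ω_d`. Testing each weak problem with the solution of the other and using the
symmetry of `A` gives `Q(u) = ∑ (F_d, η)_d`. Green's formula on each triangle, with the flux of `η`
and the discrete function `U_d`, gives `Q(U) = ∑ (A_d ∇U_d, ∇η)_d - ∑∑ ⟨γ_de, U_d⟩`. So `Q(u - U)`
is the volume part of the discretization contribution plus `∑∑ ⟨γ_de, U_d⟩`.

The rest is bookkeeping over ordered pairs of neighbors (`error_representation`). In the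
discretization plus the iteration contribution the `λ`-terms and the fluxes of `P` cancel after
exchanging `d` and `e`, which leaves minus the sum of the fluxes of `U` against `η`. In the last
contribution `n_d = -n_e` and `γ_de + γ_ed = 0` turn both jumps into sums that are symmetric in `(d,
e)`; half of the symmetric sums is the sum of the fluxes of `U` against `η` plus `∑∑ ⟨γ_de, U_d⟩`.
The first cancels, the second is what is wanted.

The analytic core is Green's formula for `σ = A ∇η` (`green_triangle`), where `σ` is only square
integrable, its divergence is known only weakly, and its normal trace exists only as a limit of
averages along segments to the centroid. The weak equation is tested with `cutoff * v`. The triangle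
splits into three cones with the centroid as apex and the edges as bases; in the coordinates `(t, y)
↦ y + t (c - y)` the gradient of the cutoff lives in the strip `ε < t < 2ε`, so its contribution is
an average of the flux, which converges to the edge integral (`tendsto_strip_of_trace`). On edges in
`∂Ω` no trace is available, but there `v = 0` and the strip term disappears
(`tendsto_strip_of_vanishing`). These test functions are admissible because Lipschitz functions with
compact support belong to `H¹₀` (`memH10_of_lipschitz`), and discrete functions are Lipschitz
(`exists_lipschitzOnWith_of_piecewise_affine`).

Flux continuity `γ_de + γ_ed = 0` follows by adding the Green formulas for a bump function near one
interface and subtracting the global weak equation (`normalTrace_add_eq_zero`). The geometry rests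
on `FaceToFace.exists_edge`: across a shared edge, the barycentric coordinates that vanish on it are
negative multiples of each other. -/

/-- Nondegenerate triangles, as affine bases. -/
abbrev Tri : Type := AffineBasis (Fin 3) ℝ Plane

theorem exists_tri {p : Fin 3 → Plane} (h : AffineIndependent ℝ p) : ∃ b : Tri, ⇑b = p :=
  ⟨⟨p, h, by
    exact h.affineSpan_eq_top_iff_card_eq_finrank_add_one.2 (by simp)⟩, rfl⟩

theorem closedTri_eq (b : Tri) : closedTri b = {x | ∀ i, 0 ≤ b.coord i x} :=
  b.convexHull_eq_nonneg_coord

theorem openTri_eq (b : Tri) : openTri b = {x | ∀ i, 0 < b.coord i x} :=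
  b.interior_convexHull

theorem mem_closedTri {b : Tri} {x : Plane} : x ∈ closedTri b ↔ ∀ i, 0 ≤ b.coord i x := by
  rw [closedTri_eq]; rfl

theorem mem_openTri {b : Tri} {x : Plane} : x ∈ openTri b ↔ ∀ i, 0 < b.coord i x := by
  rw [openTri_eq]; rfl

theorem isOpen_openTri (p : Fin 3 → Plane) : IsOpen (openTri p) := isOpen_interior

theorem isCompact_closedTri (p : Fin 3 → Plane) : IsCompact (closedTri p) :=
  (finite_range p).isCompact_convexHull ℝ

theorem isClosed_closedTri (p : Fin 3 → Plane) : IsClosed (closedTri p) :=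
  (isCompact_closedTri p).isClosed

theorem convex_closedTri (p : Fin 3 → Plane) : Convex ℝ (closedTri p) := convex_convexHull ℝ _

theorem openTri_subset_closedTri (p : Fin 3 → Plane) : openTri p ⊆ closedTri p := interior_subset

theorem continuous_coord (b : Tri) (i : Fin 3) : Continuous (b.coord i) :=
  continuous_barycentric_coord b i

/-- An affine function is the interpolation of its values at the vertices. -/
theorem affine_eq_sum (b : Tri) (f : Plane →ᵃ[ℝ] ℝ) (x : Plane) :
    f x = ∑ i, b.coord i x * f (b i) := by
  have h := b.sum_coord_apply_eq_one x
  conv_lhs => rw [← b.affineCombination_coord_eq_self x]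
  rw [Finset.map_affineCombination _ _ _ h, Finset.affineCombination_eq_linear_combination _ _ _ h]
  simp

theorem coord_center (b : Tri) (i : Fin 3) : b.coord i (center b) = 1 / 3 := by
  have : center b = Finset.univ.centroid ℝ b := by
    rw [center, Finset.centroid_def, Finset.affineCombination_eq_linear_combination]
    · simp [Finset.smul_sum, Finset.centroidWeights]
    · exact Finset.sum_centroidWeights_eq_one_of_nonempty ℝ _ Finset.univ_nonempty
  rw [this, b.coord_apply_centroid (Finset.mem_univ i)]
  simp

theorem center_mem_openTri (b : Tri) : center b ∈ openTri b :=
  mem_openTri.2 fun i => by rw [coord_center]; norm_num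

theorem coord_add_smul_sub (b : Tri) (i : Fin 3) (y z : Plane) (t : ℝ) :
    b.coord i (y + t • (z - y)) = (1 - t) * b.coord i y + t * b.coord i z := by
  have : y + t • (z - y) = AffineMap.lineMap y z t := by
    rw [AffineMap.lineMap_apply]; simp [add_comm]
  rw [this, AffineMap.apply_lineMap, AffineMap.lineMap_apply]
  simp only [vsub_eq_sub, smul_eq_mul, vadd_eq_add]; ring

theorem closure_openTri (b : Tri) : closure (openTri b) = closedTri b := by
  rw [openTri, (convex_closedTri b).closure_interior_eq_closure_of_nonempty_interior
    ⟨_, center_mem_openTri b⟩, (isClosed_closedTri b).closure_eq]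

theorem mem_frontier_closedTri {b : Tri} {x : Plane} (hx : x ∈ closedTri b) {i : Fin 3}
    (hi : b.coord i x = 0) : x ∈ frontier (closedTri b) := by
  rw [(isClosed_closedTri b).frontier_eq]
  exact ⟨hx, fun h => (mem_openTri.1 h i).ne' hi⟩

/-- The open edge opposite to the vertex `k`. -/
def openEdge (b : Tri) (k : Fin 3) : Set Plane := {x | b.coord k x = 0 ∧ ∀ i ≠ k, 0 < b.coord i x}

/-- The closed edge opposite to the vertex `k`. -/
def closedEdge (b : Tri) (k : Fin 3) : Set Plane :=
  {x | b.coord k x = 0 ∧ ∀ i ≠ k, 0 ≤ b.coord i x}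

theorem openEdge_subset_closedEdge (b : Tri) (k : Fin 3) : openEdge b k ⊆ closedEdge b k :=
  fun _ hx => ⟨hx.1, fun i hi => (hx.2 i hi).le⟩

theorem closedEdge_subset_closedTri (b : Tri) (k : Fin 3) : closedEdge b k ⊆ closedTri b := by
  intro x hx
  refine mem_closedTri.2 fun i => ?_
  by_cases h : i = k
  · rw [h, hx.1]
  · exact hx.2 i h

theorem openEdge_subset_closedTri (b : Tri) (k : Fin 3) : openEdge b k ⊆ closedTri b :=
  (openEdge_subset_closedEdge b k).trans (closedEdge_subset_closedTri b k)

theorem openEdge_notMem_openTri {b : Tri} {k : Fin 3} {x : Plane} (hx : x ∈ openEdge b k) :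
    x ∉ interior (closedTri b) := fun h => (mem_openTri.1 h k).ne' hx.1

theorem openEdge_subset_frontier (b : Tri) (k : Fin 3) : openEdge b k ⊆ frontier (closedTri b) :=
  fun _ hx => mem_frontier_closedTri (openEdge_subset_closedTri b k hx) hx.1

theorem closedEdge_eq_convexHull (b : Tri) (k : Fin 3) :
    closedEdge b k ⊆ convexHull ℝ (b '' {k}ᶜ) := by
  intro x hx
  rw [← b.linear_combination_coord_eq_self x,
    ← Finset.add_sum_erase _ _ (Finset.mem_univ k), hx.1, zero_smul, zero_add]
  refine (convex_convexHull ℝ _).sum_mem (fun i hi => hx.2 i (Finset.ne_of_mem_erase hi)) ?_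
    fun i hi => subset_convexHull ℝ _ ⟨i, Finset.ne_of_mem_erase hi, rfl⟩
  have := b.sum_coord_apply_eq_one x
  rwa [← Finset.add_sum_erase _ _ (Finset.mem_univ k), hx.1, zero_add] at this

theorem mem_openEdge_add_center {b : Tri} {y : Plane} {k : Fin 3} (hy : y ∈ openEdge b k) {t : ℝ}
    (h0 : 0 < t) (h1 : t < 1) : y + t • (center b - y) ∈ openTri b := by
  refine mem_openTri.2 fun i => ?_
  rw [coord_add_smul_sub, coord_center]
  have : 0 ≤ b.coord i y := mem_closedTri.1 (openEdge_subset_closedTri b k hy) i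
  have : 0 ≤ (1 - t) * b.coord i y := mul_nonneg (by linarith) this
  linarith

/-- Two triangles that lie on the same side of a common line of edges overlap. -/
theorem openTri_inter_nonempty {p q : Tri} {y : Plane} {k j : Fin 3} (hp : y ∈ openEdge p k)
    (hq : y ∈ openEdge q j) {c : ℝ} (hc : 0 < c) (h : ∀ x, q.coord j x = c * p.coord k x) :
    (openTri p ∩ openTri q).Nonempty := by
  have hcont : Continuous fun t : ℝ => y + t • (center p - y) := by fun_prop
  -- Move a little from `y` towards the centre of `p`: the coordinates of `q` that are positive at
  -- `y` stay positive, and the remaining one becomes positive together with `p.coord k`.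
  have h1 : ∀ᶠ t : ℝ in 𝓝 0, ∀ i, i ≠ j → 0 < q.coord i (y + t • (center p - y)) := by
    rw [eventually_all]
    intro i
    by_cases hi : i = j
    · simp [hi]
    · have := ((continuous_coord q i).comp hcont).continuousAt (x := 0)
      have h2 := this.eventually (lt_mem_nhds (a := 0) (by simpa using hq.2 i hi))
      filter_upwards [h2] with t ht _ using ht
  have h2 : ∀ᶠ t : ℝ in 𝓝[>] 0, 0 < t ∧ t < 1 :=
    Ioo_mem_nhdsGT one_pos
  obtain ⟨t, ht, ht0, ht1⟩ := ((h1.filter_mono nhdsWithin_le_nhds).and h2).exists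
  have hm := mem_openEdge_add_center hp ht0 ht1
  refine ⟨_, hm, mem_openTri.2 fun i => ?_⟩
  by_cases hi : i = j
  · rw [hi, h]; exact mul_pos hc (mem_openTri.1 hm k)
  · exact ht i hi

/-- Two triangles on the two sides of a common edge surround its interior points. -/
theorem mem_interior_union {p q : Tri} {y : Plane} {k j : Fin 3} (hp : y ∈ openEdge p k)
    (hq : y ∈ openEdge q j) {c : ℝ} (hc : c < 0) (h : ∀ x, q.coord j x = c * p.coord k x) :
    y ∈ interior (closedTri p ∪ closedTri q) := by
  rw [mem_interior_iff_mem_nhds]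
  have aux : ∀ (b : Tri) (l : Fin 3), y ∈ openEdge b l →
      ∀ᶠ z in 𝓝 y, ∀ i, i ≠ l → 0 < b.coord i z := by
    intro b l hb
    rw [eventually_all]
    intro i
    by_cases hi : i = l
    · simp [hi]
    · filter_upwards [(continuous_coord b i).continuousAt.eventually (lt_mem_nhds (hb.2 i hi))]
        with t ht _ using ht
  filter_upwards [aux p k hp, aux q j hq] with z h1 h2
  rcases le_total 0 (p.coord k z) with h3 | h3
  · left
    refine mem_closedTri.2 fun i => ?_
    by_cases hi : i = k
    · rwa [hi]
    · exact (h1 i hi).le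
  · right
    refine mem_closedTri.2 fun i => ?_
    by_cases hi : i = j
    · rw [hi, h]; exact mul_nonneg_of_nonpos_of_nonpos hc.le h3
    · exact (h2 i hi).le

/-- `p` and `q` meet face to face. -/
def FaceToFace (p q : Tri) : Prop :=
  Disjoint (openTri p) (openTri q) ∧
    closedTri p ∩ closedTri q = convexHull ℝ (range p ∩ range q)

theorem FaceToFace.symm {p q : Tri} (h : FaceToFace p q) : FaceToFace q p :=
  ⟨h.1.symm, by rw [inter_comm, h.2, inter_comm]⟩

theorem FaceToFace.not_range_subset {p q : Tri} (h : FaceToFace p q) : ¬ range p ⊆ range q := by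
  intro hs
  have : openTri p ⊆ openTri q := interior_mono (convexHull_mono hs)
  exact (h.1.mono_right this).ne_of_mem (center_mem_openTri p) (center_mem_openTri p) rfl

theorem convexHull_subset_coord_eq_zero (p : Tri) {S : Set Plane} {i : Fin 3}
    (hS : ∀ x ∈ S, p.coord i x = 0) {y : Plane} (hy : y ∈ convexHull ℝ S) : p.coord i y = 0 := by
  have : convexHull ℝ S ⊆ p.coord i ⁻¹' {0} :=
    convexHull_min hS ((convex_singleton 0).affine_preimage (p.coord i))
  exact this hy

/-- Both end points of the edge must be vertices of `q`, so `q` has exactly one further vertex `j`.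
The coordinates `q.coord j` and `p.coord k` vanish on the same line and are therefore proportional;
a positive factor would make the triangles overlap. -/
theorem FaceToFace.exists_edge {p q : Tri} (h : FaceToFace p q) {y : Plane} {k : Fin 3}
    (hp : y ∈ openEdge p k) (hq : y ∈ closedTri q) :
    ∃ (j : Fin 3) (c : ℝ), c < 0 ∧ y ∈ openEdge q j ∧ (∀ x, q.coord j x = c * p.coord k x) ∧
      closedTri p ∩ closedTri q = closedEdge p k := by
  -- If `p i` were not a vertex of `q`, then `p.coord i` would vanish at all common vertices, hence
  -- on their convex hull, which contains `y`.
  have hmem : ∀ i, i ≠ k → p i ∈ range q := by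
    intro i hi
    by_contra hn
    refine (hp.2 i hi).ne' (convexHull_subset_coord_eq_zero p (S := range p ∩ range q) ?_
      (h.2 ▸ ⟨openEdge_subset_closedTri p k hp, hq⟩))
    rintro _ ⟨⟨m, rfl⟩, hm⟩
    refine p.coord_apply_ne ?_
    rintro rfl
    exact hn hm
  obtain ⟨x, ⟨j, rfl⟩, hj⟩ := not_subset.1 h.symm.not_range_subset
  choose! g hg using hmem
  have hgj : ∀ i, i ≠ k → g i ≠ j := fun i hi hij => hj ⟨i, by rw [← hg i hi, hij]⟩
  have hform : ∀ x, q.coord j x = q.coord j (p k) * p.coord k x := by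
    intro x
    rw [affine_eq_sum p (q.coord j) x, Finset.sum_eq_single k]
    · ring
    · intro i _ hi
      rw [← hg i hi, q.coord_apply_ne (hgj i hi).symm, mul_zero]
    · simp
  have hsurj : ∀ m, m ≠ j → ∃ i, i ≠ k ∧ g i = m := by
    let G : {i : Fin 3 // i ≠ k} → {m : Fin 3 // m ≠ j} := fun i => ⟨g i, hgj i i.2⟩
    have hG : Function.Bijective G := by
      rw [Fintype.bijective_iff_injective_and_card]
      refine ⟨fun a b hab => ?_, by simp⟩
      have : g a = g b := congrArg Subtype.val hab
      have h2 : p a = p b := by rw [← hg a a.2, ← hg b b.2, this]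
      exact Subtype.ext (p.ind.injective h2)
    intro m hm
    obtain ⟨i, hi⟩ := hG.2 ⟨m, hm⟩
    exact ⟨i, i.2, congrArg Subtype.val hi⟩
  have hyq : y ∈ openEdge q j := by
    refine ⟨by rw [hform, hp.1, mul_zero], fun m hm => ?_⟩
    obtain ⟨i, hi, rfl⟩ := hsurj m hm
    rw [affine_eq_sum p (q.coord (g i)) y]
    refine Finset.sum_pos' (fun l _ => ?_) ⟨i, Finset.mem_univ i, ?_⟩
    · by_cases hl : l = k
      · rw [hl, hp.1, zero_mul]
      · refine mul_nonneg (hp.2 l hl).le ?_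
        rw [← hg l hl, q.coord_apply]; split_ifs <;> norm_num
    · rw [← hg i hi, q.coord_apply_eq, mul_one]; exact hp.2 i hi
  have hc : q.coord j (p k) < 0 := by
    by_contra! hc
    rcases hc.eq_or_lt with hc | hc
    · have := hform (q j)
      rw [← hc, q.coord_apply_eq, zero_mul] at this
      norm_num at this
    · exact (openTri_inter_nonempty hp hyq hc hform).ne_empty h.1.inter_eq
  refine ⟨j, _, hc, hyq, hform, Subset.antisymm ?_ ?_⟩
  · rintro x ⟨hx, hx'⟩
    rw [mem_closedTri] at hx hx'
    have h1 := hx' j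
    rw [hform] at h1
    have h2 := hx k
    exact ⟨by nlinarith, fun i _ => hx i⟩
  · intro x hx
    refine ⟨closedEdge_subset_closedTri p k hx, ?_⟩
    refine convexHull_mono ?_ (closedEdge_eq_convexHull p k hx)
    rintro _ ⟨i, hi, rfl⟩
    exact ⟨g i, hg i hi⟩

/-- Two triangles that meet in more than one point share an edge. -/
theorem FaceToFace.exists_closedEdge {p q : Tri} (h : FaceToFace p q)
    (hn : (closedTri p ∩ closedTri q).Nontrivial) : ∃ k, closedTri p ∩ closedTri q = closedEdge p k
      ∧ openEdge p k ⊆ closedTri q := by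
  have h2 : (range p ∩ range q).Nontrivial := by
    by_contra h3
    rw [not_nontrivial_iff] at h3
    rw [h.2] at hn
    rcases h3.eq_empty_or_singleton with h4 | ⟨x, h4⟩ <;> rw [h4] at hn <;> simp at hn
  obtain ⟨_, ⟨⟨i, rfl⟩, hi⟩, _, ⟨⟨j, rfl⟩, hj⟩, hij⟩ := h2
  have hne : i ≠ j := fun h => hij (by rw [h])
  obtain ⟨k, hki, hkj⟩ : ∃ k : Fin 3, k ≠ i ∧ k ≠ j := by
    clear hi hj hij; revert i j; decide
  have hcov : ∀ l, l ≠ k → l = i ∨ l = j := by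
    intro l hl; clear hi hj hij; revert i j k l; decide
  have hsub : convexHull ℝ (p '' {k}ᶜ) ⊆ closedTri q := by
    refine convexHull_min ?_ (convex_closedTri q)
    rintro _ ⟨l, hl, rfl⟩
    rcases hcov l hl with rfl | rfl
    · exact subset_convexHull ℝ _ hi
    · exact subset_convexHull ℝ _ hj
  have hall : closedEdge p k ⊆ closedTri q := (closedEdge_eq_convexHull p k).trans hsub
  have hall' : openEdge p k ⊆ closedTri q := (openEdge_subset_closedEdge p k).trans hall
  refine ⟨k, ?_, hall'⟩
  -- The midpoint of the two common vertices serves as the interior edge point to which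
  -- `exists_edge` applies.
  have hy : (2 : ℝ)⁻¹ • p i + (2 : ℝ)⁻¹ • p j ∈ openEdge p k := by
    have : ∀ l, p.coord l ((2 : ℝ)⁻¹ • p i + (2 : ℝ)⁻¹ • p j)
        = 2⁻¹ * p.coord l (p i) + 2⁻¹ * p.coord l (p j) := by
      intro l
      have h5 : (2 : ℝ)⁻¹ • p i + (2 : ℝ)⁻¹ • p j = p i + (2 : ℝ)⁻¹ • (p j - p i) := by
        rw [smul_sub, add_sub, add_sub_right_comm]
        congr 1
        rw [eq_sub_iff_add_eq, ← add_smul]; norm_num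
      rw [h5, coord_add_smul_sub]; ring
    refine ⟨by rw [this, p.coord_apply_ne hki, p.coord_apply_ne hkj]; simp, fun l hl => ?_⟩
    rw [this]
    rcases hcov l hl with rfl | rfl
    · rw [p.coord_apply_eq, p.coord_apply_ne hne]; norm_num
    · rw [p.coord_apply_eq, p.coord_apply_ne hne.symm]; norm_num
  obtain ⟨_, _, _, _, _, h6⟩ := h.exists_edge hy (hall' hy)
  exact h6

/-! ### Conforming partitions -/

theorem faceToFace {n : ℕ} {t : Fin n → Tri} (ht : IsConforming fun m => ⇑(t m))
    {m m' : Fin n} (h : m ≠ m') : FaceToFace (t m) (t m') := ht.2 m m' h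

/-- Two triangles across the same edge would have edge coordinates that are both negative multiples
of that of `t d`, hence positive multiples of each other, and would overlap. -/
theorem edge_unique {n : ℕ} {t : Fin n → Tri} (ht : IsConforming fun m => ⇑(t m))
    {d e e' : Fin n} {k : Fin 3} {y : Plane} (hy : y ∈ openEdge (t d) k)
    (he : y ∈ closedTri (t e)) (he' : y ∈ closedTri (t e')) (hd : e ≠ d) (hd' : e' ≠ d) :
    e = e' := by
  by_contra hne
  obtain ⟨j, c, hc, h1, h2, -⟩ := (faceToFace ht hd.symm).exists_edge hy he
  obtain ⟨j', c', hc', h1', h2', -⟩ := (faceToFace ht hd'.symm).exists_edge hy he'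
  refine (openTri_inter_nonempty h1 h1' (c := c' / c) (div_pos_of_neg_of_neg hc' hc) ?_).ne_empty
    (faceToFace ht hne).1.inter_eq
  intro x
  rw [h2, h2']
  field_simp [hc.ne]

/-- A point of one closed triangle in the interior of the other is a limit of interior points of the
first, which contradicts disjointness. So common points are always boundary points. -/
theorem frontier_inter_frontier {n : ℕ} {t : Fin n → Tri} (ht : IsConforming fun m => ⇑(t m))
    {d e : Fin n} (h : d ≠ e) :
    interface (fun m => ⇑(t m)) d e = closedTri (t d) ∩ closedTri (t e) := by
  refine Subset.antisymm (inter_subset_inter (isClosed_closedTri _).frontier_subset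
    (isClosed_closedTri _).frontier_subset) ?_
  have key : ∀ d e : Fin n, d ≠ e → ∀ x, x ∈ closedTri (t d) → x ∈ closedTri (t e) →
      x ∈ frontier (closedTri (t d)) := by
    intro d e h x hd he
    rw [(isClosed_closedTri _).frontier_eq]
    refine ⟨hd, fun hi => ?_⟩
    rw [← closure_openTri, mem_closure_iff] at he
    obtain ⟨z, h1, h2⟩ := he _ isOpen_interior hi
    exact (faceToFace ht h).1.ne_of_mem h1 h2 rfl
  exact fun x hx => ⟨key d e h x hx.1 hx.2, key e d h.symm x hx.2 hx.1⟩

theorem mem_neighbors_iff {n : ℕ} {t : Fin n → Tri}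
    {d e : Fin n} :
    e ∈ neighbors (fun m => ⇑(t m)) d ↔
      e ≠ d ∧ (interface (fun m => ⇑(t m)) d e).Nontrivial := by
  simp [neighbors]

theorem interface_comm {n : ℕ} (t : Fin n → Tri) (d e : Fin n) :
    interface (fun m => ⇑(t m)) d e = interface (fun m => ⇑(t m)) e d := inter_comm _ _

theorem mem_neighbors_comm {n : ℕ} {t : Fin n → Tri}
    {d e : Fin n} :
    e ∈ neighbors (fun m => ⇑(t m)) d ↔ d ∈ neighbors (fun m => ⇑(t m)) e := by
  rw [mem_neighbors_iff, mem_neighbors_iff, interface_comm t, ne_comm]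

/-- The interface with a neighbor is an edge. -/
theorem exists_interface_eq {n : ℕ} {t : Fin n → Tri} (ht : IsConforming fun m => ⇑(t m))
    {d e : Fin n} (he : e ∈ neighbors (fun m => ⇑(t m)) d) :
    ∃ k, interface (fun m => ⇑(t m)) d e = closedEdge (t d) k := by
  obtain ⟨h1, h2⟩ := (mem_neighbors_iff).1 he
  rw [frontier_inter_frontier ht h1.symm] at h2 ⊢
  obtain ⟨k, hk, -⟩ := (faceToFace ht h1.symm).exists_closedEdge h2
  exact ⟨k, hk⟩

theorem openEdge_nontrivial (b : Tri) (k : Fin 3) : (openEdge b k).Nontrivial := by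
  obtain ⟨i, j, hik, hjk, hij, hall⟩ : ∃ i j : Fin 3, i ≠ k ∧ j ≠ k ∧ i ≠ j ∧
      ∀ l, l ≠ k → l = i ∨ l = j := by revert k; decide
  have hmem : ∀ s ∈ Ioo (0 : ℝ) 1, b i + s • (b j - b i) ∈ openEdge b k := by
    intro s hs
    refine ⟨by rw [coord_add_smul_sub, b.coord_apply_ne hik.symm, b.coord_apply_ne hjk.symm]; simp,
      fun l hl => ?_⟩
    rw [coord_add_smul_sub]
    rcases hall l hl with rfl | rfl
    · rw [b.coord_apply_eq, b.coord_apply_ne hij]; linarith [hs.2]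
    · rw [b.coord_apply_eq, b.coord_apply_ne hij.symm]; linarith [hs.1]
  refine ⟨_, hmem (1 / 2) (by norm_num), _, hmem (1 / 3) (by norm_num), fun h => ?_⟩
  have := congrArg (b.coord j) h
  rw [coord_add_smul_sub, coord_add_smul_sub, b.coord_apply_eq, b.coord_apply_ne hij.symm] at this
  norm_num at this

theorem openEdge_disjoint (b : Tri) {k k' : Fin 3} {y : Plane} (h : y ∈ openEdge b k)
    (h' : y ∈ closedEdge b k') : k = k' := by
  by_contra hne
  exact (h.2 k' (Ne.symm hne)).ne' h'.1

/-- A triangle that contains a point of an open edge is the neighbor across this edge. -/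
theorem mem_neighbors_of_mem {n : ℕ} {t : Fin n → Tri} (ht : IsConforming fun m => ⇑(t m))
    {d e : Fin n} {k : Fin 3} {y : Plane} (hy : y ∈ openEdge (t d) k)
    (he : y ∈ closedTri (t e)) (hd : e ≠ d) : e ∈ neighbors (fun m => ⇑(t m)) d ∧
      interface (fun m => ⇑(t m)) d e = closedEdge (t d) k := by
  obtain ⟨j, c, hc, h1, h2, h3⟩ := (faceToFace ht hd.symm).exists_edge hy he
  rw [mem_neighbors_iff, frontier_inter_frontier ht hd.symm, h3]
  exact ⟨⟨hd, (openEdge_nontrivial _ k).mono (openEdge_subset_closedEdge _ k)⟩, rfl⟩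

theorem openTri_subset_domain {n : ℕ} (t : Fin n → Tri) (d : Fin n) :
    openTri (t d) ⊆ domain fun m => ⇑(t m) :=
  interior_mono (subset_iUnion (fun m => closedTri (t m)) d)

theorem isOpen_domain {n : ℕ} {s : Fin n → Fin 3 → Plane} : IsOpen (domain s) := isOpen_interior

/-- An open edge that is not shared with another triangle is part of the boundary. -/
theorem openEdge_subset_frontier_domain {n : ℕ} {t : Fin n → Tri}
    {d : Fin n} {k : Fin 3} {y : Plane}
    (hy : y ∈ openEdge (t d) k) (hn : ∀ e, e ≠ d → y ∉ closedTri (t e)) :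
    y ∈ frontier (domain fun m => ⇑(t m)) := by
  rw [isOpen_domain.frontier_eq]
  refine ⟨closure_mono (openTri_subset_domain t d)
    (by rw [closure_openTri]; exact openEdge_subset_closedTri _ k hy), fun hi => ?_⟩
  refine openEdge_notMem_openTri hy (mem_interior_iff_mem_nhds.2 ?_)
  -- Near `y` only the triangle `d` is present, so a point interior to the union would be interior
  -- to this triangle.
  have h1 : ∀ᶠ z in 𝓝 y, ∀ e, e ≠ d → z ∉ closedTri (t e) := by
    rw [eventually_all]
    intro e
    by_cases he : e = d
    · simp [he]
    · filter_upwards [(isClosed_closedTri (t e)).isOpen_compl.mem_nhds (hn e he)] with z hz _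
        using hz
  filter_upwards [h1, mem_interior_iff_mem_nhds.1 hi] with z h2 h3
  obtain ⟨e, he⟩ := mem_iUnion.1 h3
  by_cases hed : e = d
  · exact hed ▸ he
  · exact absurd he (h2 e hed)

/-- The inner points of a shared edge belong to the domain. -/
theorem openEdge_subset_domain {n : ℕ} {t : Fin n → Tri} (ht : IsConforming fun m => ⇑(t m))
    {d e : Fin n} {k : Fin 3} {y : Plane}
    (hy : y ∈ openEdge (t d) k) (he : y ∈ closedTri (t e)) (hd : e ≠ d) :
    y ∈ domain fun m => ⇑(t m) := by
  obtain ⟨j, c, hc, h1, h2, h3⟩ := (faceToFace ht hd.symm).exists_edge hy he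
  exact interior_mono (union_subset (subset_iUnion (fun m => closedTri (t m)) d)
    (subset_iUnion (fun m => closedTri (t m)) e)) (mem_interior_union hy h1 hc h2)

/-! ### Gradients of affine functions and outward normals -/

/-- The gradient of an affine function. -/
def affGrad (L : Plane →ᵃ[ℝ] ℝ) : Plane :=
  (InnerProductSpace.toDual ℝ Plane).symm L.linear.toContinuousLinearMap

theorem inner_affGrad (L : Plane →ᵃ[ℝ] ℝ) (v : Plane) : inner ℝ (affGrad L) v = L.linear v := by
  rw [affGrad, InnerProductSpace.toDual_symm_apply]; rfl

theorem inner_affGrad_sub (L : Plane →ᵃ[ℝ] ℝ) (x y : Plane) :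
    inner ℝ (affGrad L) (x - y) = L x - L y := by
  rw [inner_affGrad, ← vsub_eq_sub, AffineMap.linearMap_vsub, vsub_eq_sub]

theorem hasGradientAt_affine (L : Plane →ᵃ[ℝ] ℝ) (x : Plane) : HasGradientAt L (affGrad L) x := by
  rw [hasGradientAt_iff_hasFDerivAt, affGrad, LinearIsometryEquiv.apply_symm_apply]
  have h : (L : Plane → ℝ) = fun z => L.linear.toContinuousLinearMap z + L 0 := by
    ext z
    have := AffineMap.linearMap_vsub L z 0
    simp only [vsub_eq_sub, sub_zero] at this
    simp [this]
  rw [h]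
  exact L.linear.toContinuousLinearMap.hasFDerivAt.add_const _

theorem coordGrad_ne_zero (b : Tri) (k : Fin 3) : affGrad (b.coord k) ≠ 0 := by
  intro h
  obtain ⟨i, hi⟩ : ∃ i : Fin 3, k ≠ i := by clear h; revert k; decide
  have := inner_affGrad_sub (b.coord k) (b k) (b i)
  rw [h, inner_zero_left, b.coord_apply_eq, b.coord_apply_ne hi] at this
  norm_num at this

/-- The outward unit normal on the edge opposite to the vertex `k`. -/
def edgeNormal (b : Tri) (k : Fin 3) : Plane :=
  (-‖affGrad (b.coord k)‖⁻¹) • affGrad (b.coord k)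

theorem isOutwardUnitNormal_edgeNormal (b : Tri) {k : Fin 3} {y : Plane}
    (hy : y ∈ openEdge b k) : IsOutwardUnitNormal b y (edgeNormal b k) := by
  have h0 := norm_pos_iff.2 (coordGrad_ne_zero b k)
  refine ⟨?_, fun z hz => ?_⟩
  · rw [edgeNormal, norm_smul, norm_neg, norm_inv, norm_norm, inv_mul_cancel₀ h0.ne']
  · rw [edgeNormal, real_inner_smul_left, inner_affGrad_sub, hy.1, sub_zero]
    have := mem_closedTri.1 hz k
    have h1 : 0 ≤ ‖affGrad (b.coord k)‖⁻¹ := by positivity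
    nlinarith

/-- The affine function `z ↦ ⟨ν, z - y⟩` is nonpositive at the vertices and zero at `y`, a strict
convex combination of the end points of the edge. Hence it vanishes at both end points and is a
multiple `β` of `b.coord k`; the norm and the sign of `β` determine `ν`. -/
theorem IsOutwardUnitNormal.eq_edgeNormal {b : Tri} {k : Fin 3} {y ν : Plane}
    (hy : y ∈ openEdge b k) (h : IsOutwardUnitNormal b y ν) : ν = edgeNormal b k := by
  have hsum : ∀ z, inner ℝ ν (z - y) = ∑ l, b.coord l z * inner ℝ ν (b l - y) := by
    intro z
    have h1 := affine_eq_sum b (innerSL ℝ ν).toLinearMap.toAffineMap z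
    simp only [LinearMap.coe_toAffineMap, ContinuousLinearMap.coe_coe, innerSL_apply_apply] at h1
    simp only [inner_sub_right, mul_sub, Finset.sum_sub_distrib, ← Finset.sum_mul,
      b.sum_coord_apply_eq_one, one_mul, h1]
  have hle : ∀ l, inner ℝ ν (b l - y) ≤ 0 := fun l =>
    h.2 _ (subset_convexHull ℝ _ (mem_range_self l))
  have hzero : ∀ l, l ≠ k → inner ℝ ν (b l - y) = 0 := by
    intro l hl
    have h1 := hsum y
    rw [sub_self, inner_zero_right] at h1
    have h2 := (Finset.sum_eq_zero_iff_of_nonpos (fun l _ => mul_nonpos_of_nonneg_of_nonpos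
      (mem_closedTri.1 (openEdge_subset_closedTri b k hy) l) (hle l))).1 h1.symm l
      (Finset.mem_univ l)
    exact (mul_eq_zero.1 h2).resolve_left (hy.2 l hl).ne'
  set β := inner ℝ ν (b k - y) with hβ
  have hlin : ∀ z, inner ℝ ν (z - y) = b.coord k z * β := by
    intro z
    rw [hsum, Finset.sum_eq_single k (fun l _ hl => by rw [hzero l hl, mul_zero]) (by simp)]
  have hν : ν = β • affGrad (b.coord k) := by
    refine ext_inner_right ℝ fun v => ?_
    have h1 := hlin (y + v)
    have h2 := inner_affGrad_sub (b.coord k) (y + v) y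
    rw [add_sub_cancel_left] at h1 h2
    rw [real_inner_smul_left, h1, h2, hy.1]; ring
  have hn := h.1
  have h0 := norm_pos_iff.2 (coordGrad_ne_zero b k)
  have hβ0 : β ≤ 0 := hle k
  rw [hν, norm_smul, Real.norm_eq_abs, abs_of_nonpos hβ0] at hn
  have : β = -‖affGrad (b.coord k)‖⁻¹ := by
    field_simp
    linarith
  rw [hν, edgeNormal, this]

theorem outwardNormal_eq (b : Tri) {k : Fin 3} {y : Plane} (hy : y ∈ openEdge b k) :
    outwardNormal b y = edgeNormal b k :=
  (Classical.epsilon_spec (p := IsOutwardUnitNormal b y)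
    ⟨_, isOutwardUnitNormal_edgeNormal b hy⟩).eq_edgeNormal hy

/-! ### Integration in skew coordinates -/

theorem lintegral_mul_left_eq {a : ℝ} (ha : a ≠ 0) {h : ℝ → ℝ≥0∞} (hh : Measurable h) :
    ∫⁻ x, h x = ENNReal.ofReal |a| * ∫⁻ x, h (a * x) := by
  conv_lhs => rw [← Real.smul_map_volume_mul_left ha]
  rw [lintegral_smul_measure, lintegral_map hh (measurable_const_mul a), smul_eq_mul]

/-- The integral along `e` is the inner one, so that it can be rescaled for each fixed `t`. -/
theorem lintegral_skew {e w : Plane} (hD : e 0 * w 1 - e 1 * w 0 ≠ 0) (p : Plane)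
    {f : Plane → ℝ≥0∞} (hf : Measurable f) :
    ∫⁻ z, f z = ENNReal.ofReal |e 0 * w 1 - e 1 * w 0|
      * ∫⁻ t : ℝ, ∫⁻ X : ℝ, f (p + X • e + t • w) := by
  let N : Matrix (Fin 2) (Fin 2) ℝ := !![e 0, w 0; e 1, w 1]
  have hdet : N.det = e 0 * w 1 - e 1 * w 0 := by
    rw [Matrix.det_fin_two_of]; ring
  have hN : N.det ≠ 0 := by rwa [hdet]
  have hmap := Real.map_matrix_volume_pi_eq_smul_volume_pi hN
  have h1 : ∫⁻ z, f z = ∫⁻ v : Fin 2 → ℝ, f (p + WithLp.toLp 2 v) := by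
    rw [← lintegral_add_left_eq_self f p]
    exact ((PiLp.volume_preserving_toLp (Fin 2)).lintegral_comp
      (hf.comp (measurable_const_add p))).symm
  have hm : Measurable fun v : Fin 2 → ℝ => f (p + WithLp.toLp 2 v) :=
    hf.comp ((measurable_const_add p).comp (PiLp.volume_preserving_toLp (Fin 2)).measurable)
  have hm' : Measurable fun v : Fin 2 → ℝ => Matrix.toLin' N v :=
    (LinearMap.continuous_of_finiteDimensional _).measurable
  have h2 : ∫⁻ v : Fin 2 → ℝ, f (p + WithLp.toLp 2 v) = ENNReal.ofReal |N.det|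
      * ∫⁻ v : Fin 2 → ℝ, f (p + WithLp.toLp 2 (Matrix.toLin' N v)) := by
    rw [← lintegral_map (μ := volume) hm hm', hmap, lintegral_smul_measure, smul_eq_mul, ← mul_assoc,
      ← ENNReal.ofReal_mul (abs_nonneg _), ← abs_mul, mul_inv_cancel₀ hN]
    simp
  have h3 : ∫⁻ v : Fin 2 → ℝ, f (p + WithLp.toLp 2 (Matrix.toLin' N v))
      = ∫⁻ x : ℝ × ℝ, f (p + x.1 • e + x.2 • w) := by
    rw [← (volume_preserving_finTwoArrow ℝ).lintegral_comp (by fun_prop)]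
    refine lintegral_congr fun v => ?_
    congr 1
    rw [add_assoc]
    congr 1
    ext i
    fin_cases i <;> simp [N, Matrix.mulVec, dotProduct, Fin.sum_univ_two] <;> ring
  rw [h1, h2, h3, hdet, Measure.volume_eq_prod,
    lintegral_prod_symm' (fun x : ℝ × ℝ => f (p + x.1 • e + x.2 • w)) (by fun_prop)]

/-! ### Edges and cones of a triangle -/

/-- The arc length measure on an open edge. -/
def edgeMeasure (b : Tri) (k : Fin 3) : Measure Plane :=
  (Measure.hausdorffMeasure 1).restrict (openEdge b k)

/-- The part of the open triangle where the coordinate `k` is the smallest one. -/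
def cone (b : Tri) (k : Fin 3) : Set Plane :=
  {x | 0 < b.coord k x ∧ ∀ i ≠ k, b.coord k x < b.coord i x}

/-- The point `y + t (c - y)`, where `c` is the centre of the triangle. -/
def coneParam (b : Tri) (x : ℝ × Plane) : Plane := x.2 + x.1 • (center b - x.2)

/-- The weighted product measure that corresponds to the area on a cone. -/
def coneMeasure (b : Tri) (k : Fin 3) : Measure (ℝ × Plane) :=
  ((volume.restrict (Ioo (0 : ℝ) 1)).withDensity fun t => ENNReal.ofReal (1 - t)).prod
    (edgeMeasure b k)

theorem measurable_coneParam (b : Tri) : Measurable (coneParam b) := by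
  unfold coneParam; fun_prop

theorem measurableSet_openEdge (b : Tri) (k : Fin 3) : MeasurableSet (openEdge b k) := by
  have h1 : MeasurableSet {x | b.coord k x = 0} :=
    (continuous_coord b k).measurable (measurableSet_singleton 0)
  have h2 : MeasurableSet {x | ∀ i ≠ k, 0 < b.coord i x} := by
    simp only [ofPred_forall]
    exact MeasurableSet.iInter fun i => MeasurableSet.iInter fun _ =>
      (isOpen_lt continuous_const (continuous_coord b i)).measurableSet
  exact h1.inter h2

theorem isOpen_cone (b : Tri) (k : Fin 3) : IsOpen (cone b k) := by
  have h2 : IsOpen {x | ∀ i ≠ k, b.coord k x < b.coord i x} := by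
    simp only [ofPred_forall]
    exact isOpen_iInter_of_finite fun i => isOpen_iInter_of_finite fun _ =>
      isOpen_lt (continuous_coord b k) (continuous_coord b i)
  exact (isOpen_lt continuous_const (continuous_coord b k)).inter h2

theorem cone_subset_openTri (b : Tri) (k : Fin 3) : cone b k ⊆ openTri b := by
  intro x hx
  refine mem_openTri.2 fun i => ?_
  by_cases hi : i = k
  · exact hi ▸ hx.1
  · exact hx.1.trans (hx.2 i hi)

theorem fin3_others (k : Fin 3) : ∃ i j : Fin 3, i ≠ k ∧ j ≠ k ∧ i ≠ j ∧
    ∀ l, l ≠ k → l = i ∨ l = j := by revert k; decide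

/-- Parametrization of an edge by arc length. -/
theorem exists_edge_param (b : Tri) (k : Fin 3) : ∃ (p e : Plane) (ℓ : ℝ) (i j : Fin 3),
    i ≠ k ∧ j ≠ k ∧ (∀ l, l ≠ k → l = i ∨ l = j) ∧ 0 < ℓ ∧ ‖e‖ = 1 ∧
    (∀ x : ℝ, b.coord k (p + x • e) = 0 ∧ b.coord i (p + x • e) = 1 - x / ℓ ∧
      b.coord j (p + x • e) = x / ℓ) ∧
    edgeMeasure b k = Measure.map (fun x : ℝ => p + x • e) (volume.restrict (Ioo 0 ℓ)) := by
  obtain ⟨i, j, hik, hjk, hij, hall⟩ := fin3_others k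
  have hne : b j - b i ≠ 0 := fun h => hij (b.ind.injective (sub_eq_zero.1 h)).symm
  set ℓ := ‖b j - b i‖ with hℓ
  have hℓ0 : 0 < ℓ := norm_pos_iff.2 hne
  set e := ℓ⁻¹ • (b j - b i) with he
  have hen : ‖e‖ = 1 := by
    rw [he, norm_smul, norm_inv, Real.norm_of_nonneg hℓ0.le, ← hℓ, inv_mul_cancel₀ hℓ0.ne']
  have hc : ∀ (x : ℝ) l, b.coord l (b i + x • e)
      = (1 - x / ℓ) * b.coord l (b i) + x / ℓ * b.coord l (b j) := by
    intro x l
    rw [he, smul_smul, ← div_eq_mul_inv, coord_add_smul_sub]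
  have hc3 : ∀ x : ℝ, b.coord k (b i + x • e) = 0 ∧ b.coord i (b i + x • e) = 1 - x / ℓ ∧
      b.coord j (b i + x • e) = x / ℓ := by
    intro x
    refine ⟨?_, ?_, ?_⟩ <;> rw [hc]
    · rw [b.coord_apply_ne hik.symm, b.coord_apply_ne hjk.symm]; ring
    · rw [b.coord_apply_eq, b.coord_apply_ne hij]; ring
    · rw [b.coord_apply_eq, b.coord_apply_ne hij.symm]; ring
  refine ⟨b i, e, ℓ, i, j, hik, hjk, hall, hℓ0, hen, hc3, ?_⟩
  -- The parametrization has unit speed, so it carries Lebesgue measure, which is the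
  -- one-dimensional Hausdorff measure of the line, to the Hausdorff measure on its image.
  have hiso : Isometry fun x : ℝ => b i + x • e := by
    refine Isometry.of_dist_eq fun x y => ?_
    rw [dist_add_left, dist_eq_norm, ← sub_smul, norm_smul, hen, mul_one, Real.dist_eq,
      Real.norm_eq_abs]
  have hemb : MeasurableEmbedding fun x : ℝ => b i + x • e :=
    hiso.isClosedEmbedding.measurableEmbedding
  have hpre : (fun x : ℝ => b i + x • e) ⁻¹' openEdge b k = Ioo 0 ℓ := by
    ext x
    have hx := hc3 x
    constructor
    · intro h
      have h1 := h.2 i hik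
      have h2 := h.2 j hjk
      rw [hx.2.1] at h1
      rw [hx.2.2] at h2
      refine ⟨(div_pos_iff_of_pos_right hℓ0).1 h2, ?_⟩
      rw [sub_pos, div_lt_one hℓ0] at h1
      exact h1
    · intro h
      refine ⟨hx.1, fun l hl => ?_⟩
      rcases hall l hl with rfl | rfl
      · rw [hx.2.1, sub_pos, div_lt_one hℓ0]; exact h.2
      · rw [hx.2.2]; exact div_pos h.1 hℓ0
  have hsub : openEdge b k ⊆ range fun x : ℝ => b i + x • e := by
    intro y hy
    refine ⟨ℓ * b.coord j y, b.ext_elem fun l => ?_⟩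
    have hx := hc3 (ℓ * b.coord j y)
    rw [mul_div_cancel_left₀ _ hℓ0.ne'] at hx
    by_cases hl : l = k
    · rw [hl, hx.1, hy.1]
    · have hs : b.coord i y + b.coord j y = 1 := by
        have h1 := b.sum_coord_apply_eq_one y
        have h2 : (Finset.univ : Finset (Fin 3)) = {k, i, j} := by
          ext m; by_cases hm : m = k
          · simp [hm]
          · simpa [hm] using hall m hm
        rw [h2, Finset.sum_insert (by simp [hik.symm, hjk.symm]), Finset.sum_pair hij, hy.1] at h1
        linarith
      rcases hall l hl with rfl | rfl
      · rw [hx.2.1]; linarith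
      · exact hx.2.2
  rw [← hpre, ← hemb.restrict_map, ← hausdorffMeasure_real, hiso.map_hausdorffMeasure (by simp),
    Measure.restrict_restrict (measurableSet_openEdge b k), inter_eq_left.2 hsub, edgeMeasure]

instance (b : Tri) (k : Fin 3) : IsFiniteMeasure (edgeMeasure b k) := by
  obtain ⟨p, e, ℓ, i, j, -, -, -, -, -, -, h⟩ := exists_edge_param b k
  rw [h]; infer_instance

/-- For fixed `t` the edge is mapped to a parallel segment shortened by the factor `1 - t`. Since
`b.coord k` equals `t / 3` there, the distance to the edge grows with `t` at the rate `1 / (3 ‖∇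
b.coord k‖)`. -/
theorem lintegral_cone (b : Tri) (k : Fin 3) {f : Plane → ℝ≥0∞} (hf : Measurable f) :
    ∫⁻ z in cone b k, f z = ENNReal.ofReal (3 * ‖affGrad (b.coord k)‖)⁻¹ *
      ∫⁻ t in Ioo (0 : ℝ) 1, ENNReal.ofReal (1 - t)
        * ∫⁻ y, f (y + t • (center b - y)) ∂(edgeMeasure b k) := by
  obtain ⟨p, e, ℓ, i, j, hik, hjk, hall, hℓ, hen, hc, hμ⟩ := exists_edge_param b k
  set g := affGrad (b.coord k) with hg
  set w := center b - p with hw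
  have hge : g 0 * e 0 + g 1 * e 1 = 0 := by
    have h1 := inner_affGrad_sub (b.coord k) (p + (1 : ℝ) • e) (p + (0 : ℝ) • e)
    rw [(hc 1).1, (hc 0).1] at h1
    simp only [one_smul, zero_smul, add_zero, add_sub_cancel_left, sub_zero] at h1
    simpa [PiLp.inner_apply, Fin.sum_univ_two, mul_comm] using h1
  have hgw : g 0 * w 0 + g 1 * w 1 = 1 / 3 := by
    have h1 := inner_affGrad_sub (b.coord k) (center b) (p + (0 : ℝ) • e)
    rw [(hc 0).1, coord_center, zero_smul, add_zero, sub_zero, ← hw, ← hg] at h1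
    rw [← h1]
    simp [PiLp.inner_apply, Fin.sum_univ_two, mul_comm]
  have hee : e 0 ^ 2 + e 1 ^ 2 = 1 := by
    have := EuclideanSpace.real_norm_sq_eq e
    rw [hen, Fin.sum_univ_two] at this
    linarith
  have hgg : ‖g‖ ^ 2 = g 0 ^ 2 + g 1 ^ 2 := by
    rw [EuclideanSpace.real_norm_sq_eq, Fin.sum_univ_two]
  -- As `g` is orthogonal to the unit vector `e` and `g · w = 1/3`, the determinant of `(e, w)` is,
  -- up to sign, `1 / (3 ‖g‖)`.
  have hα : (e 0 * w 1 - e 1 * w 0) * (3 * (g 1 * e 0 - g 0 * e 1)) = 1 := by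
    linear_combination 3 * (g 0 * w 0 + g 1 * w 1) * hee - 3 * (w 0 * e 0 + w 1 * e 1) * hge
      + 3 * hgw
  have hα2 : ‖g‖ = |g 1 * e 0 - g 0 * e 1| := by
    rw [← abs_of_nonneg (norm_nonneg g), ← sq_eq_sq_iff_abs_eq_abs, hgg]
    linear_combination (-(g 0 ^ 2 + g 1 ^ 2)) * hee + (g 0 * e 0 + g 1 * e 1) * hge
  have hD : |e 0 * w 1 - e 1 * w 0| = (3 * ‖g‖)⁻¹ := by
    refine eq_inv_of_mul_eq_one_left ?_
    have := congrArg abs hα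
    rw [abs_mul, abs_mul, ← hα2] at this
    simpa using this
  have hD0 : e 0 * w 1 - e 1 * w 0 ≠ 0 := left_ne_zero_of_mul_eq_one hα
  have hmeas : Measurable ((cone b k).indicator f) := hf.indicator (isOpen_cone b k).measurableSet
  rw [← lintegral_indicator (isOpen_cone b k).measurableSet, lintegral_skew hD0 p hmeas, hD,
    ← lintegral_indicator measurableSet_Ioo]
  congr 1
  refine lintegral_congr fun t => ?_
  -- The substitution `X = (1 - t) x` turns the skew coordinates into the segments from edge points
  -- to the centre.
  have hpt : ∀ x : ℝ, p + ((1 - t) * x) • e + t • w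
      = (p + x • e) + t • (center b - (p + x • e)) := by
    intro x; rw [hw]; module
  have hcoord : ∀ (x : ℝ) l, b.coord l ((p + x • e) + t • (center b - (p + x • e)))
      = (1 - t) * b.coord l (p + x • e) + t / 3 := by
    intro x l; rw [coord_add_smul_sub, coord_center]; ring
  have hmem : ∀ x : ℝ, (p + x • e) + t • (center b - (p + x • e)) ∈ cone b k ↔
      0 < t ∧ 0 < (1 - t) * (x / ℓ) ∧ 0 < (1 - t) * (1 - x / ℓ) := by
    intro x
    constructor
    · rintro ⟨h1, h2⟩
      have h3 := h2 i hik
      have h4 := h2 j hjk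
      rw [hcoord, (hc x).1] at h1
      rw [hcoord, hcoord, (hc x).1, (hc x).2.1] at h3
      rw [hcoord, hcoord, (hc x).1, (hc x).2.2] at h4
      refine ⟨?_, ?_, ?_⟩ <;> linarith
    · rintro ⟨h1, h2, h3⟩
      refine ⟨by rw [hcoord, (hc x).1]; linarith, fun l hl => ?_⟩
      rw [hcoord, hcoord, (hc x).1]
      rcases hall l hl with rfl | rfl
      · rw [(hc x).2.1]; linarith
      · rw [(hc x).2.2]; linarith
  by_cases ht : t ∈ Ioo (0 : ℝ) 1
  · rw [indicator_of_mem ht, lintegral_mul_left_eq (a := 1 - t) (by linarith [ht.2]) (by fun_prop),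
      abs_of_pos (by linarith [ht.2]), hμ, lintegral_map (by fun_prop) (by fun_prop),
      ← lintegral_indicator measurableSet_Ioo]
    congr 1
    refine lintegral_congr fun x => ?_
    rw [hpt]
    have h1 : 0 < 1 - t := by linarith [ht.2]
    have h2 : (p + x • e) + t • (center b - (p + x • e)) ∈ cone b k ↔ x ∈ Ioo 0 ℓ := by
      rw [hmem, mul_pos_iff_of_pos_left h1, mul_pos_iff_of_pos_left h1, sub_pos, div_lt_one hℓ,
        div_pos_iff_of_pos_right hℓ]
      exact ⟨fun h => h.2, fun h => ⟨ht.1, h⟩⟩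
    by_cases hx : x ∈ Ioo 0 ℓ
    · rw [indicator_of_mem hx, indicator_of_mem (h2.2 hx)]
    · rw [indicator_of_notMem hx, indicator_of_notMem fun h => hx (h2.1 h)]
  -- Outside `0 < t < 1` the line misses the cone: there the smallest coordinate `t / 3` must be
  -- positive and below the mean `1 / 3` of the three.
  · rw [indicator_of_notMem ht, lintegral_eq_zero_iff (by fun_prop)]
    refine Eventually.of_forall fun X => indicator_of_notMem (fun h => ht ?_) _
    have hXt : b.coord k (p + X • e + t • w) = t / 3 := by
      have h1 := inner_affGrad_sub (b.coord k) (p + X • e + t • w) (p + X • e)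
      rw [add_sub_cancel_left, inner_smul_right, (hc X).1, sub_zero] at h1
      rw [← h1, ← hg]
      have : inner ℝ g w = g 0 * w 0 + g 1 * w 1 := by
        simp [PiLp.inner_apply, Fin.sum_univ_two, mul_comm]
      rw [this, hgw]; ring
    obtain ⟨h1, h2⟩ := h
    refine ⟨by rw [hXt] at h1; linarith, ?_⟩
    have h3 := b.sum_coord_apply_eq_one (p + X • e + t • w)
    have h4 : ∑ l : Fin 3, b.coord k (p + X • e + t • w)
        < ∑ l, b.coord l (p + X • e + t • w) := by
      refine Finset.sum_lt_sum (fun l _ => ?_) ⟨i, Finset.mem_univ i, h2 i hik⟩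
      by_cases hl : l = k
      · rw [hl]
      · exact (h2 l hl).le
    rw [h3, hXt] at h4
    simp at h4
    linarith

/-- Polar coordinates in a cone. -/
theorem restrict_cone (b : Tri) (k : Fin 3) : volume.restrict (cone b k)
    = ENNReal.ofReal (3 * ‖affGrad (b.coord k)‖)⁻¹ • Measure.map (coneParam b) (coneMeasure b k) := by
  refine Measure.ext_of_lintegral _ fun f hf => ?_
  have hf' : Measurable fun x => f (coneParam b x) := hf.comp (measurable_coneParam b)
  rw [lintegral_cone b k hf, lintegral_smul_measure, smul_eq_mul,
    lintegral_map hf (measurable_coneParam b), coneMeasure,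
    lintegral_prod _ hf'.aemeasurable,
    lintegral_withDensity_eq_lintegral_mul _ (by fun_prop)
      hf'.lintegral_prod_right']
  rfl

/-! ### Lipschitz functions with compact support belong to `H¹₀` -/

open scoped Convolution in
-- Differentiate under the integral, with the derivative falling on `w`: it exists for almost every
-- `t` by Rademacher's theorem, and the difference quotients are dominated by `C |ρ|`. Thus the
-- gradient of a mollification is the mollification of the almost everywhere defined gradient.
theorem hasFDerivAt_convolution_of_lipschitz {ρ w : Plane → ℝ} (hρ : Continuous ρ)
    (hρc : HasCompactSupport ρ) {C : NNReal} (hw : LipschitzWith C w) (x : Plane) :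
    HasFDerivAt (ρ ⋆[ContinuousLinearMap.lsmul ℝ ℝ, volume] w)
      ((ρ ⋆[ContinuousLinearMap.lsmul ℝ ℝ, volume] (fderiv ℝ w)) x) x := by
  have hρi : Integrable ρ := hρ.integrable_of_hasCompactSupport hρc
  refine (hasFDerivAt_integral_of_dominated_loc_of_lip (μ := volume) (s := univ)
    (F := fun x t => ρ t • w (x - t)) (F' := fun t => ρ t • fderiv ℝ w (x - t))
    (bound := fun t => C * |ρ t|) univ_mem ?_ ?_ ?_ ?_ ?_ ?_).2
  · refine Eventually.of_forall fun z => ?_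
    exact (hρ.smul (hw.continuous.comp (continuous_const.sub continuous_id))).aestronglyMeasurable
  · exact (hρ.smul (hw.continuous.comp
      (continuous_const.sub continuous_id))).integrable_of_hasCompactSupport hρc.smul_right
  · refine hρ.aestronglyMeasurable.smul ?_
    exact ((measurable_fderiv ℝ w).comp (measurable_const.sub measurable_id)).aestronglyMeasurable
  · refine Eventually.of_forall fun t => LipschitzWith.lipschitzOnWith ?_
    refine LipschitzWith.of_dist_le_mul fun a b => ?_
    rw [Real.coe_nnabs, abs_mul, abs_abs, abs_of_nonneg C.coe_nonneg, dist_eq_norm, ← smul_sub,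
      norm_smul, Real.norm_eq_abs, mul_comm (C : ℝ), mul_assoc]
    gcongr
    have := hw.dist_le_mul (a - t) (b - t)
    rwa [dist_sub_right, dist_eq_norm] at this
  · exact hρi.abs.const_mul _
  · have h1 : ∀ᵐ t : Plane, DifferentiableAt ℝ w (x - t) :=
      (Measure.measurePreserving_sub_left volume x).quasiMeasurePreserving.ae
        hw.ae_differentiableAt
    filter_upwards [h1] with t ht
    have h2 : HasFDerivAt (fun y => w (y - t)) (fderiv ℝ w (x - t)) x := by
      have := ht.hasFDerivAt.comp x ((hasFDerivAt_id x).sub_const t)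
      simpa [Function.comp_def] using this
    exact h2.const_smul (ρ t)

theorem tendsto_eLpNorm_two_of_dominated {E : Type*} [NormedAddCommGroup E] {μ : Measure Plane}
    {f : ℕ → Plane → E} {g : Plane → E} {K : Set Plane} {B : ℝ} (hKm : MeasurableSet K)
    (hK : μ K ≠ ⊤)
    (hf : ∀ n, AEStronglyMeasurable (f n) μ) (hg : AEStronglyMeasurable g μ)
    (hfK : ∀ n, ∀ x ∉ K, f n x = 0) (hgK : ∀ x ∉ K, g x = 0) (hfB : ∀ n x, ‖f n x‖ ≤ B)
    (hgB : ∀ x, ‖g x‖ ≤ B) (h : ∀ᵐ x ∂μ, Tendsto (fun n => f n x) atTop (𝓝 (g x))) :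
    Tendsto (fun n => eLpNorm (f n - g) 2 μ) atTop (𝓝 0) := by
  have key : Tendsto (fun n => ∫⁻ x, ‖(f n - g) x‖ₑ ^ (2 : ℝ) ∂μ) atTop (𝓝 (∫⁻ _, 0 ∂μ)) := by
    refine tendsto_lintegral_of_dominated_convergence'
      (K.indicator fun _ => ENNReal.ofReal (B + B) ^ (2 : ℝ)) ?_ ?_ ?_ ?_
    · intro n
      exact ((hf n).sub hg).enorm.pow_const _
    · intro n
      refine Eventually.of_forall fun x => ?_
      by_cases hx : x ∈ K
      · rw [indicator_of_mem hx]
        refine ENNReal.rpow_le_rpow ?_ (by norm_num)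
        rw [← ofReal_norm]
        exact ENNReal.ofReal_le_ofReal ((norm_sub_le _ _).trans (add_le_add (hfB n x) (hgB x)))
      · simp [hfK n x hx, hgK x hx]
    · rw [lintegral_indicator hKm, lintegral_const]
      simp only [MeasurableSet.univ, Measure.restrict_apply, univ_inter]
      exact ENNReal.mul_ne_top (by simp) hK
    · filter_upwards [h] with x hx
      have h1 : Tendsto (fun n => ‖(f n - g) x‖ₑ) atTop (𝓝 0) := by
        have := (hx.sub_const (g x)).enorm
        simpa using this
      have := (ENNReal.continuous_rpow_const (y := 2)).tendsto 0 |>.comp h1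
      simpa [Function.comp_def] using this
  rw [lintegral_zero] at key
  have h2 : ∀ n, eLpNorm (f n - g) 2 μ = (∫⁻ x, ‖(f n - g) x‖ₑ ^ (2 : ℝ) ∂μ) ^ (1 / 2 : ℝ) := by
    intro n
    rw [eLpNorm_eq_lintegral_rpow_enorm_toReal (by norm_num) (by norm_num)]
    norm_num
  simp only [h2]
  have := (ENNReal.continuous_rpow_const (y := (1 / 2 : ℝ))).tendsto 0 |>.comp key
  simpa [Function.comp_def] using this

theorem norm_gradient_eq (w : Plane → ℝ) (x : Plane) : ‖gradient w x‖ = ‖fderiv ℝ w x‖ :=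
  LinearIsometryEquiv.norm_map _ _

theorem norm_gradient_le {C : NNReal} {w : Plane → ℝ} (hw : LipschitzWith C w) (x : Plane) :
    ‖gradient w x‖ ≤ C := by
  rw [norm_gradient_eq]; exact norm_fderiv_le_of_lipschitz ℝ hw

theorem measurable_gradient (w : Plane → ℝ) : Measurable (gradient w) :=
  (InnerProductSpace.toDual ℝ Plane).symm.continuous.measurable.comp (measurable_fderiv ℝ w)

open scoped Convolution in
-- Mollify at the scale `δ / (n + 1)`. The supports stay in one compact subset of `Ω`, the gradients
-- stay bounded by `C` and converge almost everywhere, so dominated convergence gives convergence in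
-- `L²`.
theorem memH10_of_lipschitz {Ω : Set Plane} (hΩ : IsOpen Ω) {w : Plane → ℝ} {C : NNReal}
    (hw : LipschitzWith C w) (hc : HasCompactSupport w) (hs : tsupport w ⊆ Ω) :
    MemH10 Ω w (gradient w) := by
  have hgz : ∀ x ∉ tsupport w, fderiv ℝ w x = 0 := fun x hx =>
    image_eq_zero_of_notMem_tsupport fun h => hx (tsupport_fderiv_subset ℝ h)
  refine ⟨(hw.continuous.memLp_of_hasCompactSupport hc).restrict _, ?_, ?_⟩
  · have h1 : gradient w = (tsupport w).indicator (gradient w) := by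
      refine (indicator_eq_self.2 fun x hx => ?_).symm
      by_contra h
      exact hx (by rw [gradient, hgz x h, map_zero])
    rw [h1]
    refine MemLp.restrict _ ?_
    rw [memLp_indicator_iff_restrict (isClosed_tsupport w).measurableSet]
    have : IsFiniteMeasure (volume.restrict (tsupport w)) :=
      ⟨by rw [Measure.restrict_apply_univ]; exact hc.isCompact.measure_lt_top⟩
    exact MemLp.of_bound (measurable_gradient w).aestronglyMeasurable C
      (Eventually.of_forall (norm_gradient_le hw))
  obtain ⟨δ, hδ, hδΩ⟩ := hc.isCompact.exists_cthickening_subset_open hΩ hs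
  set K := Metric.cthickening δ (tsupport w) with hKdef
  have hKc : IsCompact K := hc.isCompact.cthickening
  have hr : ∀ n : ℕ, 0 < δ / (n + 1) := fun n => by positivity
  -- The fixed ratio 2 of the radii is what the almost everywhere convergence of mollified, merely
  -- locally integrable functions asks for.
  let ρ : ℕ → ContDiffBump (0 : Plane) := fun n =>
    ⟨δ / (n + 1) / 2, δ / (n + 1), half_pos (hr n), half_lt_self (hr n)⟩
  have hρ0 : Tendsto (fun n => (ρ n).rOut) atTop (𝓝 0) :=
    tendsto_const_div_atTop_nhds_zero_nat δ |>.comp (tendsto_add_atTop_nat 1) |>.congr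
      fun n => by simp [ρ]
  let φ : ℕ → Plane → ℝ := fun n => ((ρ n).normed volume) ⋆[ContinuousLinearMap.lsmul ℝ ℝ, volume] w
  have hsupp : ∀ n, Function.support (φ n) ⊆ K := by
    intro n
    refine (support_convolution_subset_swap _).trans ?_
    rintro _ ⟨x, hx, y, hy, rfl⟩
    rw [(ρ n).support_normed_eq] at hy
    refine Metric.mem_cthickening_of_dist_le _ x _ _ (subset_tsupport w hx) ?_
    rw [dist_eq_norm, add_sub_cancel_left]
    have h1 : ‖y‖ < δ / (n + 1) := by simpa using hy
    refine h1.le.trans (div_le_self hδ.le ?_)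
    linarith [n.cast_nonneg (α := ℝ)]
  have htsupp : ∀ n, tsupport (φ n) ⊆ K := fun n =>
    closure_minimal (hsupp n) hKc.isClosed
  have hφs : ∀ n, ContDiff ℝ ∞ (φ n) := fun n =>
    HasCompactSupport.contDiff_convolution_left _ (ρ n).hasCompactSupport_normed
      (ρ n).contDiff_normed hw.continuous.locallyIntegrable
  have hder : ∀ n x, fderiv ℝ (φ n) x =
      (((ρ n).normed volume) ⋆[ContinuousLinearMap.lsmul ℝ ℝ, volume] (fderiv ℝ w)) x := fun n x =>
    (hasFDerivAt_convolution_of_lipschitz (ρ n).continuous_normed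
      (ρ n).hasCompactSupport_normed hw x).fderiv
  have hbound : ∀ {E : Type} [NormedAddCommGroup E] [NormedSpace ℝ E] (g : Plane → E) (B : ℝ),
      (∀ x, ‖g x‖ ≤ B) → ∀ n x,
      ‖(((ρ n).normed volume) ⋆[ContinuousLinearMap.lsmul ℝ ℝ, volume] g) x‖ ≤ B := by
    intro E _ _ g B hB n x
    have hi : Integrable fun t => (ρ n).normed volume t * B := (ρ n).integrable_normed.mul_const B
    refine (norm_integral_le_of_norm_le hi (Eventually.of_forall fun t => ?_)).trans_eq ?_
    · rw [ContinuousLinearMap.lsmul_apply, norm_smul, Real.norm_of_nonneg ((ρ n).nonneg_normed t)]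
      exact mul_le_mul_of_nonneg_left (hB _) ((ρ n).nonneg_normed t)
    · rw [integral_mul_const, (ρ n).integral_normed, one_mul]
  have hconvw : ∀ᵐ x : Plane, Tendsto (fun n => φ n x) atTop (𝓝 (w x)) :=
    Eventually.of_forall fun x =>
      ContDiffBump.convolution_tendsto_right_of_continuous hρ0 hw.continuous x
  have hlg : LocallyIntegrable (fderiv ℝ w) volume := by
    intro x
    refine ⟨Metric.ball x 1, Metric.ball_mem_nhds x one_pos, ?_⟩
    exact Measure.integrableOn_of_bounded (M := C) measure_ball_lt_top.ne
      (measurable_fderiv ℝ w).aestronglyMeasurable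
      (Eventually.of_forall fun x => norm_fderiv_le_of_lipschitz ℝ hw)
  have hconvg : ∀ᵐ x : Plane, Tendsto (fun n => fderiv ℝ (φ n) x) atTop (𝓝 (fderiv ℝ w x)) := by
    simp only [hder]
    exact ContDiffBump.ae_convolution_tendsto_right_of_locallyIntegrable (K := 2) hρ0
      (Eventually.of_forall fun n => by simp only [ρ]; linarith) hlg
  obtain ⟨B, hB⟩ : ∃ B, ∀ x, ‖w x‖ ≤ B := hw.continuous.bounded_above_of_compact_support hc
  have hwK : ∀ x ∉ K, x ∉ tsupport w := fun x hx h =>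
    hx (Metric.self_subset_cthickening _ h)
  refine ⟨φ, fun n => ⟨hφs n, HasCompactSupport.of_support_subset_isCompact hKc (hsupp n),
    (htsupp n).trans hδΩ⟩, ?_, ?_⟩
  · have h1 := tendsto_eLpNorm_two_of_dominated (μ := volume) (f := φ) (g := w) (K := K) (B := B)
      hKc.measurableSet hKc.measure_lt_top.ne (fun n => (hφs n).continuous.aestronglyMeasurable)
      hw.continuous.aestronglyMeasurable (fun n x hx => Function.notMem_support.1
        fun h => hx (hsupp n h))
      (fun x hx => image_eq_zero_of_notMem_tsupport (hwK x hx)) (fun n x => hbound w B hB n x) hB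
      hconvw
    exact tendsto_of_tendsto_of_tendsto_of_le_of_le tendsto_const_nhds h1 (fun _ => zero_le)
      fun n => eLpNorm_mono_measure _ Measure.restrict_le_self
  · have h1 := tendsto_eLpNorm_two_of_dominated (μ := volume) (f := fun n => fderiv ℝ (φ n))
      (g := fderiv ℝ w) (K := K) (B := C) hKc.measurableSet hKc.measure_lt_top.ne
      (fun n => (measurable_fderiv ℝ (φ n)).aestronglyMeasurable)
      (measurable_fderiv ℝ w).aestronglyMeasurable (fun n x hx => image_eq_zero_of_notMem_tsupport
        fun h => hx (htsupp n (tsupport_fderiv_subset ℝ h)))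
      (fun x hx => hgz x (hwK x hx)) (fun n x => by
        rw [hder]
        exact hbound (fderiv ℝ w) C (fun x => norm_fderiv_le_of_lipschitz ℝ hw) n x)
      (fun x => norm_fderiv_le_of_lipschitz ℝ hw) hconvg
    have h2 : ∀ n, eLpNorm (gradient (φ n) - gradient w) 2 (volume.restrict Ω)
        ≤ eLpNorm (fderiv ℝ (φ n) - fderiv ℝ w) 2 volume := by
      intro n
      refine (eLpNorm_mono_measure _ Measure.restrict_le_self).trans_eq
        (eLpNorm_congr_norm_ae (Eventually.of_forall fun x => ?_))
      rw [Pi.sub_apply, Pi.sub_apply, gradient, gradient, ← map_sub, LinearIsometryEquiv.norm_map]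
    exact tendsto_of_tendsto_of_tendsto_of_le_of_le tendsto_const_nhds h1 (fun _ => zero_le) h2

/-! ### Cutoff functions of a triangle -/

/-- The function that is zero where a coordinate is less than `ε / 3`, one where all coordinates are
greater than `2 ε / 3`, and interpolates in between. -/
def cutoff (b : Tri) (ε : ℝ) (x : Plane) : ℝ :=
  max 0 (min 1 (min (3 * b.coord 0 x / ε - 1)
    (min (3 * b.coord 1 x / ε - 1) (3 * b.coord 2 x / ε - 1))))

theorem cutoff_nonneg (b : Tri) (ε : ℝ) (x : Plane) : 0 ≤ cutoff b ε x := le_max_left _ _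

theorem cutoff_le_one (b : Tri) (ε : ℝ) (x : Plane) : cutoff b ε x ≤ 1 :=
  max_le zero_le_one (min_le_left _ _)

theorem exists_lipschitzWith_cutoff (b : Tri) (ε : ℝ) : ∃ C, LipschitzWith C (cutoff b ε) := by
  have h : ∀ i, ∃ C, LipschitzWith C fun x => 3 * b.coord i x / ε - 1 := by
    intro i
    refine ⟨NNReal.mk (|3 / ε| * ‖affGrad (b.coord i)‖) (by positivity),
      LipschitzWith.of_dist_le_mul fun x y => ?_⟩
    have h1 : 3 * b.coord i x / ε - 1 - (3 * b.coord i y / ε - 1)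
        = 3 / ε * inner ℝ (affGrad (b.coord i)) (x - y) := by
      rw [inner_affGrad_sub]; ring
    rw [dist_eq_norm, h1, norm_mul, Real.norm_eq_abs, NNReal.coe_mk, mul_assoc, dist_eq_norm]
    gcongr
    exact norm_inner_le_norm _ _
  obtain ⟨C0, h0⟩ := h 0
  obtain ⟨C1, h1⟩ := h 1
  obtain ⟨C2, h2⟩ := h 2
  exact ⟨_, ((h0.min (h1.min h2)).const_min 1).const_max 0⟩

theorem continuous_cutoff (b : Tri) (ε : ℝ) : Continuous (cutoff b ε) :=
  (exists_lipschitzWith_cutoff b ε).choose_spec.continuous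

theorem cutoff_eq {b : Tri} {ε : ℝ} (hε : 0 < ε) {k : Fin 3} {x : Plane}
    (hx : ∀ i, b.coord k x ≤ b.coord i x) :
    cutoff b ε x = max 0 (min 1 (3 * b.coord k x / ε - 1)) := by
  have h : ∀ i, 3 * b.coord k x / ε - 1 ≤ 3 * b.coord i x / ε - 1 := fun i => by
    have := hx i
    gcongr
  have h2 : min (3 * b.coord 0 x / ε - 1)
      (min (3 * b.coord 1 x / ε - 1) (3 * b.coord 2 x / ε - 1)) = 3 * b.coord k x / ε - 1 := by
    refine le_antisymm ?_ (le_min (h 0) (le_min (h 1) (h 2)))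
    fin_cases k
    · exact min_le_left _ _
    · exact (min_le_right _ _).trans (min_le_left _ _)
    · exact (min_le_right _ _).trans (min_le_right _ _)
  rw [cutoff, h2]

theorem support_cutoff_subset (b : Tri) {ε : ℝ} (hε : 0 < ε) :
    Function.support (cutoff b ε) ⊆ {x | ∀ i, ε / 3 ≤ b.coord i x} := by
  intro x hx i
  by_contra! h
  refine hx (max_eq_left ((min_le_right _ _).trans ?_))
  have h1 : 3 * b.coord i x / ε - 1 ≤ 0 := by
    rw [sub_nonpos, div_le_one hε]; linarith
  fin_cases i
  · exact (min_le_left _ _).trans h1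
  · exact ((min_le_right _ _).trans (min_le_left _ _)).trans h1
  · exact ((min_le_right _ _).trans (min_le_right _ _)).trans h1

theorem tsupport_cutoff_mul_subset (b : Tri) {ε : ℝ} (hε : 0 < ε) (v : Plane → ℝ) :
    tsupport (fun x => cutoff b ε x * v x) ⊆ openTri b := by
  have hcl : IsClosed {x | ∀ i, ε / 3 ≤ b.coord i x} := by
    rw [ofPred_forall]
    exact isClosed_iInter fun i => isClosed_le continuous_const (continuous_coord b i)
  refine (closure_minimal ((Function.support_mul_subset_left _ _).trans
    (support_cutoff_subset b hε)) hcl).trans fun x hx => mem_openTri.2 fun i => ?_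
  exact (by positivity : 0 < ε / 3).trans_le (hx i)

theorem hasCompactSupport_cutoff_mul (b : Tri) {ε : ℝ} (hε : 0 < ε) (v : Plane → ℝ) :
    HasCompactSupport (fun x => cutoff b ε x * v x) :=
  (isCompact_closedTri b).of_isClosed_subset (isClosed_tsupport _)
    ((tsupport_cutoff_mul_subset b hε v).trans (openTri_subset_closedTri b))

theorem exists_lipschitzWith_cutoff_mul (b : Tri) (ε : ℝ) {v : Plane → ℝ} {C : NNReal} {B : ℝ}
    (hv : LipschitzWith C v) (hB : ∀ x, |v x| ≤ B) :
    ∃ C', LipschitzWith C' fun x => cutoff b ε x * v x := by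
  obtain ⟨K, hK⟩ := exists_lipschitzWith_cutoff b ε
  have hB0 : 0 ≤ B := (abs_nonneg _).trans (hB 0)
  refine ⟨NNReal.mk (C + B * K) (by positivity), LipschitzWith.of_dist_le_mul fun x y => ?_⟩
  have h1 := hv.dist_le_mul x y
  have h2 := hK.dist_le_mul x y
  rw [Real.dist_eq] at h1 h2 ⊢
  have h3 : cutoff b ε x * v x - cutoff b ε y * v y
      = cutoff b ε x * (v x - v y) + v y * (cutoff b ε x - cutoff b ε y) := by ring
  rw [h3, NNReal.coe_mk]
  calc |cutoff b ε x * (v x - v y) + v y * (cutoff b ε x - cutoff b ε y)|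
      ≤ |cutoff b ε x| * |v x - v y| + |v y| * |cutoff b ε x - cutoff b ε y| := by
        rw [← abs_mul, ← abs_mul]; exact abs_add_le _ _
    _ ≤ 1 * (C * dist x y) + B * (K * dist x y) := by
        gcongr
        · rw [abs_of_nonneg (cutoff_nonneg b ε x)]; exact cutoff_le_one b ε x
        · exact hB y
    _ = (C + B * K) * dist x y := by ring

theorem tendsto_cutoff {b : Tri} {x : Plane} (hx : x ∈ openTri b) :
    Tendsto (fun ε => cutoff b ε x) (𝓝[>] 0) (𝓝 1) := by
  refine tendsto_const_nhds.congr' ?_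
  have h1 : ∀ᶠ ε : ℝ in 𝓝[>] 0, ∀ i, ε < 3 / 2 * b.coord i x := by
    rw [eventually_all]
    intro i
    exact eventually_nhdsWithin_of_eventually_nhds
      (gt_mem_nhds (mul_pos (by norm_num) (mem_openTri.1 hx i)))
  filter_upwards [h1, self_mem_nhdsWithin] with ε h2 (h3 : 0 < ε)
  have h4 : ∀ i, 1 ≤ 3 * b.coord i x / ε - 1 := fun i => by
    have := h2 i
    rw [le_sub_iff_add_le, le_div_iff₀ h3]; linarith
  rw [cutoff, min_eq_left (le_min (h4 0) (le_min (h4 1) (h4 2))), max_eq_right zero_le_one]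

theorem volume_affine_level {L : Plane →ᵃ[ℝ] ℝ} {x y : Plane} (h : L x ≠ L y) (a : ℝ) :
    volume {z | L z = a} = 0 := by
  let S : AffineSubspace ℝ Plane := (AffineSubspace.mk' a (⊥ : Submodule ℝ ℝ)).comap L
  have hS : (S : Set Plane) = {z | L z = a} := by
    ext z
    simp [S, AffineSubspace.mem_mk', sub_eq_zero]
  rw [← hS]
  refine Measure.addHaar_affineSubspace _ _ fun htop => h ?_
  have hall : ∀ z, L z = a := fun z => by
    have : z ∈ (S : Set Plane) := by rw [htop]; trivial
    rwa [hS] at this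
  rw [hall, hall]

theorem exists_ne_coord (b : Tri) (k : Fin 3) : ∃ x y, b.coord k x ≠ b.coord k y := by
  obtain ⟨i, hi⟩ : ∃ i : Fin 3, k ≠ i := by revert k; decide
  exact ⟨b k, b i, by rw [b.coord_apply_eq, b.coord_apply_ne hi]; norm_num⟩

theorem ae_coord_ne (b : Tri) (k : Fin 3) (a : ℝ) : ∀ᵐ x, b.coord k x ≠ a := by
  obtain ⟨x, y, h⟩ := exists_ne_coord b k
  have := volume_affine_level h a
  rw [ae_iff]
  simpa using this

/-- In the cone the minimum in the cutoff is attained by coordinate `k`, so the cutoff is a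
piecewise affine function of this coordinate, with slope `3 / ε` between its kinks at `ε / 3` and `2
ε / 3`. The kinks lie on null lines, and the rest is the product rule. -/
theorem ae_gradient_cutoff_mul (b : Tri) (k : Fin 3) {ε : ℝ} (hε : 0 < ε) {v : Plane → ℝ}
    {C : NNReal} (hv : LipschitzWith C v) :
    ∀ᵐ x ∂volume.restrict (cone b k), gradient (fun x => cutoff b ε x * v x) x
      = cutoff b ε x • gradient v x + (if 3 * b.coord k x ∈ Ioo ε (2 * ε) then
          (3 / ε * v x) • affGrad (b.coord k) else 0) := by
  filter_upwards [ae_restrict_of_ae hv.ae_differentiableAt,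
    ae_restrict_of_ae (ae_coord_ne b k (ε / 3)), ae_restrict_of_ae (ae_coord_ne b k (2 * ε / 3)),
    ae_restrict_mem (isOpen_cone b k).measurableSet] with x hd h1 h2 hx
  have hle : ∀ z ∈ cone b k, ∀ i, b.coord k z ≤ b.coord i z := fun z hz i => by
    by_cases hi : i = k
    · rw [hi]
    · exact (hz.2 i hi).le
  have hnear := (isOpen_cone b k).mem_nhds hx
  have hck := (continuous_coord b k).continuousAt (x := x)
  have hvg : HasGradientAt v (gradient v x) x := hd.hasGradientAt
  rcases lt_or_gt_of_ne h1 with h3 | h3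
  · have hn : ¬ 3 * b.coord k x ∈ Ioo ε (2 * ε) := fun h => by linarith [h.1]
    have hz : ∀ᶠ z in 𝓝 x, cutoff b ε z = 0 := by
      filter_upwards [hnear, hck.eventually (gt_mem_nhds h3)] with z hz hz2
      rw [cutoff_eq hε (hle z hz)]
      refine max_eq_left ((min_le_right _ _).trans ?_)
      rw [sub_nonpos, div_le_one hε]; linarith
    rw [if_neg hn, hz.self_of_nhds, zero_smul, add_zero]
    refine HasGradientAt.gradient ((hasGradientAt_const x (0 : ℝ)).congr_of_eventuallyEq ?_)
    filter_upwards [hz] with z hz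
    rw [hz, zero_mul]
  rcases lt_or_gt_of_ne h2 with h4 | h4
  · have hn : 3 * b.coord k x ∈ Ioo ε (2 * ε) := ⟨by linarith, by linarith⟩
    have hz : ∀ᶠ z in 𝓝 x, cutoff b ε z = 3 * b.coord k z / ε - 1 := by
      filter_upwards [hnear, hck.eventually (gt_mem_nhds h4), hck.eventually (lt_mem_nhds h3)]
        with z hz hz2 hz3
      rw [cutoff_eq hε (hle z hz), min_eq_right, max_eq_right]
      · rw [sub_nonneg, one_le_div hε]; linarith
      · rw [sub_le_iff_le_add, div_le_iff₀ hε]; linarith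
    rw [if_pos hn, hz.self_of_nhds]
    refine HasGradientAt.gradient ?_
    have hL := (hasGradientAt_affine (b.coord k) x).hasFDerivAt
    have hL2 := ((hL.const_mul (3 / ε)).sub_const 1).mul hvg.hasFDerivAt
    rw [hasGradientAt_iff_hasFDerivAt]
    refine (hL2.congr_of_eventuallyEq ?_).congr_fderiv ?_
    · filter_upwards [hz] with z hz
      rw [hz, Pi.mul_apply]; ring
    · ext u
      simp
      ring
  · have hn : ¬ 3 * b.coord k x ∈ Ioo ε (2 * ε) := fun h => by linarith [h.2]
    have hz : ∀ᶠ z in 𝓝 x, cutoff b ε z = 1 := by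
      filter_upwards [hnear, hck.eventually (lt_mem_nhds h4)] with z hz hz2
      rw [cutoff_eq hε (hle z hz), min_eq_left, max_eq_right zero_le_one]
      rw [le_sub_iff_add_le, le_div_iff₀ hε]; linarith
    rw [if_neg hn, hz.self_of_nhds, one_smul, add_zero]
    refine HasGradientAt.gradient (hvg.congr_of_eventuallyEq ?_)
    filter_upwards [hz] with z hz
    rw [hz, one_mul]

/-! ### Decomposition of a triangle into cones -/

/-- Only points with two equal coordinates can be missed, and these lie on three lines. -/
theorem ae_mem_iUnion_cone (b : Tri) : (⋃ k, cone b k : Set Plane) =ᵐ[volume] openTri b := by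
  have h : ∀ i j : Fin 3, i ≠ j → ∀ᵐ x, b.coord i x ≠ b.coord j x := by
    intro i j hij
    have h1 : (b.coord i - b.coord j) (b i) ≠ (b.coord i - b.coord j) (b j) := by
      simp [b.coord_apply_ne hij, b.coord_apply_ne hij.symm]
      norm_num
    have := volume_affine_level h1 0
    rw [ae_iff]
    simpa [sub_eq_zero] using this
  filter_upwards [h 0 1 (by decide), h 0 2 (by decide), h 1 2 (by decide)] with x h1 h2 h3
  refine propext ⟨fun hx => ?_, fun hx => ?_⟩
  · obtain ⟨k, hk⟩ := mem_iUnion.1 hx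
    exact cone_subset_openTri b k hk
  · obtain ⟨k, hk⟩ := Finite.exists_min fun i => b.coord i x
    refine mem_iUnion.2 ⟨k, mem_openTri.1 hx k, fun i hi => (hk i).lt_of_ne fun he => ?_⟩
    fin_cases k <;> fin_cases i <;> simp_all

theorem integral_openTri_eq_sum_cone (b : Tri) {f : Plane → ℝ} (hf : IntegrableOn f (openTri b)) :
    ∫ x in openTri b, f x = ∑ k, ∫ x in cone b k, f x := by
  rw [← setIntegral_congr_set (ae_mem_iUnion_cone b), integral_iUnion_fintype]
  · exact fun k => (isOpen_cone b k).measurableSet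
  · intro i j hij
    rw [Function.onFun, disjoint_left]
    intro x hi hj
    exact lt_asymm (hi.2 j hij.symm) (hj.2 i hij)
  · exact fun k => hf.mono_set (cone_subset_openTri b k)

/-- The product of the length on `(0, 1)` and the arc length on an edge. -/
def coneProd (b : Tri) (k : Fin 3) : Measure (ℝ × Plane) :=
  (volume.restrict (Ioo (0 : ℝ) 1)).prod (edgeMeasure b k)

theorem coneMeasure_eq (b : Tri) (k : Fin 3) : coneMeasure b k
    = (coneProd b k).withDensity fun z => ENNReal.ofReal (1 - z.1) :=
  prod_withDensity_left (by fun_prop)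

theorem ae_coneProd (b : Tri) (k : Fin 3) :
    ∀ᵐ z ∂coneProd b k, z.1 ∈ Ioo (0 : ℝ) 1 ∧ z.2 ∈ openEdge b k := by
  have h1 : ∀ᵐ t ∂volume.restrict (Ioo (0 : ℝ) 1), t ∈ Ioo (0 : ℝ) 1 :=
    ae_restrict_mem measurableSet_Ioo
  have h2 : ∀ᵐ y ∂edgeMeasure b k, y ∈ openEdge b k := ae_restrict_mem (measurableSet_openEdge b k)
  exact (Measure.quasiMeasurePreserving_fst.ae h1).and (Measure.quasiMeasurePreserving_snd.ae h2)

theorem coneProd_restrict (b : Tri) (k : Fin 3) {ε : ℝ} (hε : 0 < ε) (hε2 : ε < 1 / 2) :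
    (coneProd b k).restrict (Ioo ε (2 * ε) ×ˢ univ)
      = (volume.restrict (Ioo ε (2 * ε))).prod (edgeMeasure b k) := by
  rw [coneProd, ← Measure.prod_restrict, Measure.restrict_univ,
    Measure.restrict_restrict measurableSet_Ioo, inter_eq_left.2]
  exact Ioo_subset_Ioo hε.le (by linarith)

/-! ### Boundary strips and Green's formula on one triangle -/

section Cone

variable {b : Tri} {k : Fin 3}

theorem coneFactor_pos (b : Tri) (k : Fin 3) : 0 < (3 * ‖affGrad (b.coord k)‖)⁻¹ := by
  have := norm_pos_iff.2 (coordGrad_ne_zero b k)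
  positivity

theorem ae_toReal_coneProd (b : Tri) (k : Fin 3) (H : Plane → ℝ) :
    (fun z : ℝ × Plane => (ENNReal.ofReal (1 - z.1)).toReal • H (coneParam b z))
      =ᵐ[coneProd b k] fun z => (1 - z.1) * H (coneParam b z) := by
  filter_upwards [ae_coneProd b k] with z hz
  rw [ENNReal.toReal_ofReal (by linarith [hz.1.2]), smul_eq_mul]

theorem IntegrableOn.map_cone {H : Plane → ℝ} (hH : IntegrableOn H (cone b k)) :
    Integrable H (Measure.map (coneParam b) (coneMeasure b k)) := by
  rw [IntegrableOn, restrict_cone] at hH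
  rwa [integrable_smul_measure (by simpa using coneFactor_pos b k)
    ENNReal.ofReal_ne_top] at hH

theorem integrable_coneProd {H : Plane → ℝ} (hH : IntegrableOn H (cone b k)) :
    Integrable (fun z => (1 - z.1) * H (coneParam b z)) (coneProd b k) := by
  have h1 := IntegrableOn.map_cone hH
  have h2 := h1.comp_measurable (measurable_coneParam b)
  rw [coneMeasure_eq, integrable_withDensity_iff_integrable_smul' (by fun_prop) (by simp)] at h2
  exact h2.congr (ae_toReal_coneProd b k H)

theorem integral_cone {H : Plane → ℝ} (hH : IntegrableOn H (cone b k)) :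
    ∫ x in cone b k, H x = (3 * ‖affGrad (b.coord k)‖)⁻¹
      * ∫ z, (1 - z.1) * H (coneParam b z) ∂coneProd b k := by
  have h1 := IntegrableOn.map_cone hH
  rw [restrict_cone, integral_smul_measure, ENNReal.toReal_ofReal (coneFactor_pos b k).le,
    smul_eq_mul, integral_map (measurable_coneParam b).aemeasurable h1.aestronglyMeasurable,
    coneMeasure_eq, integral_withDensity_eq_integral_toReal_smul (by fun_prop) (by simp),
    integral_congr_ae (ae_toReal_coneProd b k H)]

/-- `γ` is the trace of the normal component of `σ` on an edge of the triangle. -/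
def HasEdgeTrace (b : Tri) (k : Fin 3) (σ : Plane → Plane) (γ : Plane → ℝ) : Prop :=
  Integrable γ (edgeMeasure b k) ∧
  Tendsto (fun ε : ℝ => (ENNReal.ofReal ε)⁻¹ * ∫⁻ t in Ioo (0 : ℝ) ε,
      ∫⁻ y, ‖inner ℝ (edgeNormal b k) (σ (y + t • (center b - y))) - γ y‖ₑ ∂edgeMeasure b k)
    (𝓝[>] 0) (𝓝 0)

theorem exists_norm_center_sub_le (b : Tri) : ∃ R, 0 ≤ R ∧ ∀ y ∈ closedTri b, ‖center b - y‖ ≤ R := by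
  obtain ⟨R, hR⟩ := (isCompact_closedTri b).isBounded.subset_closedBall (center b)
  refine ⟨max R 0, le_max_right _ _, fun y hy => ?_⟩
  have := hR hy
  rw [Metric.mem_closedBall, dist_comm, dist_eq_norm] at this
  exact this.trans (le_max_left _ _)

theorem abs_sub_coneParam_le {v : Plane → ℝ} {C : NNReal} (hv : LipschitzWith C v) {R : ℝ}
    (hR : ∀ y ∈ closedTri b, ‖center b - y‖ ≤ R) {z : ℝ × Plane} (ht : 0 ≤ z.1)
    (hy : z.2 ∈ openEdge b k) : |v (coneParam b z) - v z.2| ≤ C * R * z.1 := by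
  have h1 := hv.dist_le_mul (coneParam b z) z.2
  rw [Real.dist_eq, dist_eq_norm, coneParam, add_sub_cancel_left, norm_smul,
    Real.norm_of_nonneg ht] at h1
  have h2 := hR _ (openEdge_subset_closedTri b k hy)
  calc _ ≤ _ := h1
    _ ≤ C * (z.1 * R) := by gcongr
    _ = _ := by ring

/-- The flux through a strip along an edge in cone coordinates. -/
theorem integral_strip {σ : Plane → Plane} (hσ : IntegrableOn σ (cone b k)) {v : Plane → ℝ}
    (hv : Continuous v) {B : ℝ} (hB : ∀ x, |v x| ≤ B) (ε : ℝ) :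
    ∫ x in cone b k, (if 3 * b.coord k x ∈ Ioo ε (2 * ε) then
        3 / ε * v x * inner ℝ (σ x) (affGrad (b.coord k)) else 0)
      = -(ε⁻¹ * ∫ z in Ioo ε (2 * ε) ×ˢ univ, (1 - z.1) * (v (coneParam b z)
          * inner ℝ (edgeNormal b k) (σ (coneParam b z))) ∂coneProd b k) := by
  have h0 := norm_pos_iff.2 (coordGrad_ne_zero b k)
  have hm : MeasurableSet {x | 3 * b.coord k x ∈ Ioo ε (2 * ε)} :=
    ((continuous_coord b k).const_mul 3).measurable measurableSet_Ioo
  have hi : IntegrableOn (fun x => v x * inner ℝ (σ x) (affGrad (b.coord k))) (cone b k) := by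
    refine Integrable.bdd_mul (c := B) (hσ.inner_const (affGrad (b.coord k)))
      hv.aestronglyMeasurable (Eventually.of_forall hB)
  have hi2 : IntegrableOn (fun x => if 3 * b.coord k x ∈ Ioo ε (2 * ε) then
        3 / ε * v x * inner ℝ (σ x) (affGrad (b.coord k)) else 0) (cone b k) := by
    refine ((hi.const_mul (3 / ε)).indicator hm).congr (Eventually.of_forall fun x => ?_)
    simp only [indicator, mem_ofPred_eq, mul_assoc]
  rw [integral_cone hi2, ← integral_indicator (measurableSet_Ioo.prod MeasurableSet.univ),
    ← integral_const_mul, ← integral_const_mul, ← integral_neg]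
  refine integral_congr_ae ?_
  filter_upwards [ae_coneProd b k] with z hz
  -- The strip becomes `ε < t < 2ε`. The factor `3 ‖∇ b.coord k‖` from the gradient of the cutoff
  -- cancels against the area factor, which leaves the plain average `1 / ε`; the sign comes from
  -- the outward normal.
  have hc : 3 * b.coord k (coneParam b z) = z.1 := by
    rw [coneParam, coord_add_smul_sub, coord_center, hz.2.1]; ring
  by_cases h : z.1 ∈ Ioo ε (2 * ε)
  · rw [indicator_of_mem (by simpa using h), if_pos (by rwa [hc]), edgeNormal, real_inner_smul_left,
      real_inner_comm]
    field_simp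
  · rw [indicator_of_notMem (by simpa using h), if_neg (by rwa [hc])]; simp

/-- The strip integral is an average over `ε < t < 2ε` of the flux against `v`. Replacing the flux
by `γ` costs at most `B` times twice the trace average at `2ε`; freezing `v` on the edge and
dropping the weight `1 - t` costs `O(ε)` times the norm of `γ`. -/
theorem tendsto_strip_of_trace {σ : Plane → Plane} (hσ : IntegrableOn σ (cone b k))
    {v : Plane → ℝ} {C : NNReal} (hv : LipschitzWith C v) {B : ℝ} (hB : ∀ x, |v x| ≤ B)
    {γ : Plane → ℝ} (hγ : HasEdgeTrace b k σ γ) :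
    Tendsto (fun ε : ℝ => ∫ x in cone b k, (if 3 * b.coord k x ∈ Ioo ε (2 * ε) then
        3 / ε * v x * inner ℝ (σ x) (affGrad (b.coord k)) else 0)) (𝓝[>] 0)
      (𝓝 (-∫ y, γ y * v y ∂edgeMeasure b k)) := by
  simp only [integral_strip hσ hv.continuous hB]
  refine Tendsto.neg ?_
  obtain ⟨R, hR0, hR⟩ := exists_norm_center_sub_le b
  have hB0 : 0 ≤ B := (abs_nonneg _).trans (hB 0)
  set S : ℝ × Plane → ℝ := fun z => inner ℝ (edgeNormal b k) (σ (coneParam b z)) with hS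
  set c : ℝ := 2 * (B + C * R) with hc
  have hc0 : 0 ≤ c := by positivity
  have hγv : Integrable (fun y => γ y * v y) (edgeMeasure b k) :=
    hγ.1.mul_bdd (c := B) hv.continuous.aestronglyMeasurable (Eventually.of_forall hB)
  have hK : Integrable (fun z => (1 - z.1) * (v (coneParam b z) * S z)) (coneProd b k) := by
    refine integrable_coneProd (H := fun x => v x * inner ℝ (edgeNormal b k) (σ x)) ?_
    exact Integrable.bdd_mul (c := B) (hσ.const_inner _) hv.continuous.aestronglyMeasurable
      (Eventually.of_forall hB)
  set T : ℝ → ℝ≥0∞ := fun ε => (ENNReal.ofReal ε)⁻¹ * ∫⁻ t in Ioo (0 : ℝ) ε,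
      ∫⁻ y, ‖inner ℝ (edgeNormal b k) (σ (y + t • (center b - y))) - γ y‖ₑ ∂edgeMeasure b k
    with hT
  set Γ : ℝ≥0∞ := ∫⁻ y, ‖γ y‖ₑ ∂edgeMeasure b k with hΓ
  have hΓt : Γ ≠ ⊤ := hγ.1.hasFiniteIntegral.ne
  rw [tendsto_iff_edist_tendsto_0]
  have hlim : Tendsto (fun ε : ℝ => ENNReal.ofReal B * (2 * T (2 * ε))
      + ENNReal.ofReal (c * ε) * Γ) (𝓝[>] 0) (𝓝 0) := by
    have h2 : Tendsto (fun ε : ℝ => 2 * ε) (𝓝[>] 0) (𝓝[>] 0) := by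
      refine tendsto_nhdsWithin_iff.2 ⟨?_, ?_⟩
      · have : Tendsto (fun ε : ℝ => 2 * ε) (𝓝 0) (𝓝 (2 * 0)) :=
          (continuous_const.mul continuous_id).tendsto 0
        rw [mul_zero] at this
        exact this.mono_left nhdsWithin_le_nhds
      · filter_upwards [self_mem_nhdsWithin] with ε (hε : 0 < ε)
        exact mul_pos two_pos hε
    have h3 := hγ.2.comp h2
    have h4 : Tendsto (fun ε : ℝ => ENNReal.ofReal (c * ε)) (𝓝[>] 0) (𝓝 0) := by
      have : Tendsto (fun ε : ℝ => ENNReal.ofReal (c * ε)) (𝓝 0) (𝓝 (ENNReal.ofReal (c * 0))) :=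
        (ENNReal.continuous_ofReal.comp (continuous_const.mul continuous_id)).tendsto 0
      rw [mul_zero, ENNReal.ofReal_zero] at this
      exact this.mono_left nhdsWithin_le_nhds
    have h5 := ENNReal.Tendsto.const_mul (a := ENNReal.ofReal B)
      (ENNReal.Tendsto.const_mul (a := 2) h3 (Or.inr (by simp))) (Or.inr (by simp))
    have h6 := ENNReal.Tendsto.mul_const (b := Γ) h4 (Or.inr hΓt)
    have h7 := h5.add h6
    simp only [mul_zero, zero_mul, add_zero] at h7
    exact h7
  refine tendsto_of_tendsto_of_tendsto_of_le_of_le' tendsto_const_nhds hlim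
    (Eventually.of_forall fun _ => zero_le) ?_
  filter_upwards [Ioo_mem_nhdsGT (show (0 : ℝ) < 1 / 2 by norm_num)] with ε hε
  have hε0 : 0 < ε := hε.1
  set P := (volume.restrict (Ioo ε (2 * ε))).prod (edgeMeasure b k) with hP
  have hvol : (volume.restrict (Ioo ε (2 * ε))) univ = ENNReal.ofReal ε := by
    rw [Measure.restrict_apply_univ, Real.volume_Ioo]; congr 1; ring
  have h1 : ∫ y, γ y * v y ∂edgeMeasure b k = ε⁻¹ * ∫ z, γ z.2 * v z.2 ∂P := by
    have := integral_fun_snd (μ := volume.restrict (Ioo ε (2 * ε))) (ν := edgeMeasure b k)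
      (fun y => γ y * v y)
    rw [this, Measure.real, hvol, ENNReal.toReal_ofReal hε0.le, smul_eq_mul,
      inv_mul_cancel_left₀ hε0.ne']
  have hK' : Integrable (fun z => (1 - z.1) * (v (coneParam b z) * S z)) P := by
    rw [hP, ← coneProd_restrict b k hε0 hε.2]; exact hK.restrict
  have hγv' : Integrable (fun z : ℝ × Plane => γ z.2 * v z.2) P := hγv.comp_snd _
  rw [coneProd_restrict b k hε0 hε.2, h1, edist_eq_enorm_sub, ← mul_sub, ← integral_sub hK' hγv',
    enorm_mul]
  have hae : ∀ᵐ z ∂P, z.1 ∈ Ioo ε (2 * ε) ∧ z.2 ∈ openEdge b k := by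
    have h1 : ∀ᵐ t ∂volume.restrict (Ioo ε (2 * ε)), t ∈ Ioo ε (2 * ε) :=
      ae_restrict_mem measurableSet_Ioo
    have h2 : ∀ᵐ y ∂edgeMeasure b k, y ∈ openEdge b k :=
      ae_restrict_mem (measurableSet_openEdge b k)
    exact (Measure.quasiMeasurePreserving_fst.ae h1).and
      (Measure.quasiMeasurePreserving_snd.ae h2)
  have hpt : ∀ᵐ z ∂P, ‖(1 - z.1) * (v (coneParam b z) * S z) - γ z.2 * v z.2‖ₑ
      ≤ ENNReal.ofReal B * ‖S z - γ z.2‖ₑ + ENNReal.ofReal (c * ε) * ‖γ z.2‖ₑ := by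
    filter_upwards [hae] with z hz
    have ht0 : 0 < z.1 := hε0.trans hz.1.1
    have ht1 : z.1 < 1 := hz.1.2.trans (by linarith [hε.2])
    -- The first summand carries the deviation of the flux from its trace. The second one carries
    -- the variation of `v` along the segment, at most `C R t`, and the Jacobian defect, at most `B
    -- t`; with `t < 2ε` this yields the constant `c`.
    have e1 : (1 - z.1) * (v (coneParam b z) * S z) - γ z.2 * v z.2
        = (1 - z.1) * v (coneParam b z) * (S z - γ z.2)
          + ((v (coneParam b z) - v z.2) - z.1 * v (coneParam b z)) * γ z.2 := by ring
    have e2 : |(1 - z.1) * v (coneParam b z)| ≤ B := by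
      rw [abs_mul, abs_of_pos (by linarith)]
      calc (1 - z.1) * |v (coneParam b z)| ≤ 1 * B :=
            mul_le_mul (by linarith) (hB _) (abs_nonneg _) zero_le_one
        _ = B := one_mul B
    have e3 : |(v (coneParam b z) - v z.2) - z.1 * v (coneParam b z)| ≤ c * ε := by
      refine (abs_sub _ _).trans ?_
      have := abs_sub_coneParam_le hv hR ht0.le hz.2
      have h5 : |z.1 * v (coneParam b z)| ≤ z.1 * B := by
        rw [abs_mul, abs_of_pos ht0]; exact mul_le_mul_of_nonneg_left (hB _) ht0.le
      calc _ ≤ C * R * z.1 + z.1 * B := add_le_add this h5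
        _ = (B + C * R) * z.1 := by ring
        _ ≤ (B + C * R) * (2 * ε) := by gcongr; exact hz.1.2.le
        _ = c * ε := by rw [hc]; ring
    rw [e1]
    refine (enorm_add_le _ _).trans ?_
    refine add_le_add ?_ ?_ <;> rw [enorm_mul] <;> refine mul_le_mul_left ?_ _ <;>
      rw [Real.enorm_eq_ofReal_abs]
    · exact ENNReal.ofReal_le_ofReal e2
    · exact ENNReal.ofReal_le_ofReal e3
  have hεinv : ‖ε⁻¹‖ₑ = (ENNReal.ofReal ε)⁻¹ := by
    rw [Real.enorm_of_nonneg (by positivity), ENNReal.ofReal_inv_of_pos hε0]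
  have hεtop : ENNReal.ofReal ε ≠ ⊤ := by simp
  have hεne : ENNReal.ofReal ε ≠ 0 := by simpa using hε0
  have hγm : AEMeasurable (fun z : ℝ × Plane => ENNReal.ofReal (c * ε) * ‖γ z.2‖ₑ) P :=
    (hγ.1.aestronglyMeasurable.comp_snd.enorm).const_mul _
  have hint1 : ∫⁻ z, ‖S z - γ z.2‖ₑ ∂P ≤ ENNReal.ofReal (2 * ε) * T (2 * ε) := by
    refine (lintegral_prod_le _).trans ?_
    rw [hT, ← mul_assoc, ENNReal.mul_inv_cancel (by simpa using hε0)
      ENNReal.ofReal_ne_top, one_mul]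
    exact lintegral_mono_set (Ioo_subset_Ioo hε0.le le_rfl)
  have hint2 : ∫⁻ z, ‖γ z.2‖ₑ ∂P = ENNReal.ofReal ε * Γ := by
    rw [lintegral_prod _ hγ.1.aestronglyMeasurable.comp_snd.enorm]
    exact (lintegral_const Γ).trans (by rw [hvol, mul_comm])
  rw [hεinv]
  calc (ENNReal.ofReal ε)⁻¹ * ‖∫ z, (1 - z.1) * (v (coneParam b z) * S z) - γ z.2 * v z.2 ∂P‖ₑ
      ≤ (ENNReal.ofReal ε)⁻¹ * (ENNReal.ofReal B * (ENNReal.ofReal (2 * ε) * T (2 * ε))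
          + ENNReal.ofReal (c * ε) * (ENNReal.ofReal ε * Γ)) := by
        gcongr
        refine (enorm_integral_le_lintegral_enorm _).trans ((lintegral_mono_ae hpt).trans ?_)
        rw [lintegral_add_right' _ hγm, lintegral_const_mul' _ _ (by simp),
          lintegral_const_mul' _ _ (by simp), hint2]
        gcongr
    _ = ((ENNReal.ofReal ε)⁻¹ * ENNReal.ofReal ε) * (ENNReal.ofReal B * (2 * T (2 * ε))
          + ENNReal.ofReal (c * ε) * Γ) := by
        rw [ENNReal.ofReal_mul zero_le_two, ENNReal.ofReal_ofNat]; ring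
    _ = _ := by rw [ENNReal.inv_mul_cancel hεne hεtop, one_mul]

/-- In the strip `|v| ≤ 2 C R ε`, which compensates the factor `1 / ε`. What remains is the integral
of an integrable function over shrinking strips, so no trace of `σ` is needed. -/
theorem tendsto_strip_of_vanishing {σ : Plane → Plane} (hσ : IntegrableOn σ (cone b k))
    {v : Plane → ℝ} {C : NNReal} (hv : LipschitzWith C v) {B : ℝ} (hB : ∀ x, |v x| ≤ B)
    (h0 : ∀ y ∈ openEdge b k, v y = 0) :
    Tendsto (fun ε : ℝ => ∫ x in cone b k, (if 3 * b.coord k x ∈ Ioo ε (2 * ε) then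
        3 / ε * v x * inner ℝ (σ x) (affGrad (b.coord k)) else 0)) (𝓝[>] 0) (𝓝 0) := by
  simp only [integral_strip hσ hv.continuous hB]
  rw [show 𝓝 (0 : ℝ) = 𝓝 (-0) by rw [neg_zero]]
  refine Tendsto.neg ?_
  obtain ⟨R, hR0, hR⟩ := exists_norm_center_sub_le b
  have hS := (integrable_coneProd (H := fun x => inner ℝ (edgeNormal b k) (σ x))
    (hσ.const_inner _)).norm
  set S : ℝ × Plane → ℝ := fun z => ‖(1 - z.1) * inner ℝ (edgeNormal b k) (σ (coneParam b z))‖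
    with hSdef
  have hms : ∀ ε : ℝ, MeasurableSet (Ioo ε (2 * ε) ×ˢ (univ : Set Plane)) := fun ε =>
    measurableSet_Ioo.prod MeasurableSet.univ
  have hlim : Tendsto (fun ε : ℝ => 2 * (C * R) * ∫ z, (Ioo ε (2 * ε) ×ˢ univ).indicator S z
      ∂coneProd b k) (𝓝[>] 0) (𝓝 (2 * (C * R) * ∫ z, 0 ∂coneProd b k)) := by
    refine Tendsto.const_mul _ (tendsto_integral_filter_of_dominated_convergence S ?_ ?_ hS ?_)
    · exact Eventually.of_forall fun ε => hS.aestronglyMeasurable.indicator (hms ε)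
    · refine Eventually.of_forall fun ε => Eventually.of_forall fun z => ?_
      refine (norm_indicator_le_norm_self _ _).trans ?_
      rw [hSdef, norm_norm]
    · filter_upwards [ae_coneProd b k] with z hz
      -- A fixed `t` lies outside the strip as soon as `2ε < t`.
      refine tendsto_const_nhds.congr' ?_
      filter_upwards [Ioo_mem_nhdsGT (show 0 < z.1 / 2 by linarith [hz.1.1])] with ε hε
      rw [indicator_of_notMem]
      rintro ⟨h1, -⟩
      linarith [h1.2, hε.2]
  rw [integral_zero, mul_zero] at hlim
  refine squeeze_zero_norm' ?_ hlim
  filter_upwards [self_mem_nhdsWithin] with ε (hε : 0 < ε)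
  rw [← integral_indicator (hms ε), ← integral_const_mul, ← integral_const_mul]
  refine norm_integral_le_of_norm_le ((hS.indicator (hms ε)).const_mul _) ?_
  filter_upwards [ae_coneProd b k] with z hz
  by_cases h : z ∈ Ioo ε (2 * ε) ×ˢ (univ : Set Plane)
  · rw [indicator_of_mem h, indicator_of_mem h, hSdef]
    have h1 := abs_sub_coneParam_le hv hR hz.1.1.le hz.2
    rw [h0 _ hz.2, sub_zero] at h1
    have h2 : z.1 ≤ 2 * ε := h.1.2.le
    have h3 : |v (coneParam b z)| ≤ C * R * (2 * ε) := h1.trans (by gcongr)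
    have h4 : ε⁻¹ * ((1 - z.1) * (v (coneParam b z)
        * inner ℝ (edgeNormal b k) (σ (coneParam b z)))) = (ε⁻¹ * v (coneParam b z))
        * ((1 - z.1) * inner ℝ (edgeNormal b k) (σ (coneParam b z))) := by ring
    rw [h4, norm_mul]
    refine mul_le_mul_of_nonneg_right ?_ (norm_nonneg _)
    rw [norm_mul, norm_inv, Real.norm_of_nonneg hε.le, Real.norm_eq_abs, inv_mul_le_iff₀ hε]
    linarith
  · rw [indicator_of_notMem h, indicator_of_notMem h]; simp

/-- Green's formula on a triangle for a vector field with normal traces. -/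
theorem green_triangle {σ : Plane → Plane} {ψ : Plane → ℝ} (hσ : IntegrableOn σ (openTri b))
    (hψ : IntegrableOn ψ (openTri b))
    (hweak : ∀ (w : Plane → ℝ) (C : NNReal), LipschitzWith C w → HasCompactSupport w →
      tsupport w ⊆ openTri b →
      ∫ x in openTri b, inner ℝ (σ x) (gradient w x) = ∫ x in openTri b, ψ x * w x)
    {v : Plane → ℝ} {C : NNReal} (hv : LipschitzWith C v) {B : ℝ} (hB : ∀ x, |v x| ≤ B)
    {γ : Fin 3 → Plane → ℝ} (hγ : ∀ k, HasEdgeTrace b k σ (γ k) ∨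
      (γ k = 0 ∧ ∀ y ∈ openEdge b k, v y = 0)) :
    ∫ x in openTri b, ψ x * v x = (∫ x in openTri b, inner ℝ (σ x) (gradient v x))
      - ∑ k, ∫ y, γ k y * v y ∂edgeMeasure b k := by
  have hmT := (isOpen_openTri b).measurableSet
  have hgi : IntegrableOn (fun x => inner ℝ (σ x) (gradient v x)) (openTri b) := by
    refine Integrable.mono' (hσ.norm.mul_const (C : ℝ))
      (hσ.aestronglyMeasurable.inner (measurable_gradient v).aestronglyMeasurable)
      (Eventually.of_forall fun x => ?_)
    exact (norm_inner_le_norm _ _).trans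
      (mul_le_mul_of_nonneg_left (norm_gradient_le hv x) (norm_nonneg _))
  have hψv : IntegrableOn (fun x => ψ x * v x) (openTri b) :=
    Integrable.mul_bdd (c := B) hψ hv.continuous.aestronglyMeasurable (Eventually.of_forall hB)
  have hlim : ∀ {f : Plane → ℝ}, IntegrableOn f (openTri b) →
      Tendsto (fun ε => ∫ x in openTri b, cutoff b ε x * f x) (𝓝[>] 0)
        (𝓝 (∫ x in openTri b, f x)) := by
    intro f hf
    refine tendsto_integral_filter_of_dominated_convergence (fun x => ‖f x‖) ?_ ?_ hf.norm ?_
    · exact Eventually.of_forall fun ε =>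
        (continuous_cutoff b ε).aestronglyMeasurable.mul hf.aestronglyMeasurable
    · refine Eventually.of_forall fun ε => Eventually.of_forall fun x => ?_
      rw [norm_mul, Real.norm_of_nonneg (cutoff_nonneg b ε x)]
      exact mul_le_of_le_one_left (norm_nonneg _) (cutoff_le_one b ε x)
    · filter_upwards [ae_restrict_mem hmT] with x hx
      simpa using (tendsto_cutoff hx).mul_const (f x)
  have hstrip : ∀ k, Tendsto (fun ε : ℝ => ∫ x in cone b k,
      (if 3 * b.coord k x ∈ Ioo ε (2 * ε) then
        3 / ε * v x * inner ℝ (σ x) (affGrad (b.coord k)) else 0)) (𝓝[>] 0)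
      (𝓝 (-∫ y, γ k y * v y ∂edgeMeasure b k)) := by
    intro k
    have hσk := hσ.mono_set (cone_subset_openTri b k)
    rcases hγ k with h | ⟨h1, h2⟩
    · exact tendsto_strip_of_trace hσk hv hB h
    · simpa [h1] using tendsto_strip_of_vanishing hσk hv hB h2
  -- The weak equation tested with `cutoff * v`, with the product rule applied cone by cone. Letting
  -- `ε → 0` on both sides gives the formula.
  have hid : ∀ ε : ℝ, 0 < ε → ∫ x in openTri b, cutoff b ε x * (ψ x * v x)
      = (∫ x in openTri b, cutoff b ε x * inner ℝ (σ x) (gradient v x))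
        + ∑ k, ∫ x in cone b k, (if 3 * b.coord k x ∈ Ioo ε (2 * ε) then
        3 / ε * v x * inner ℝ (σ x) (affGrad (b.coord k)) else 0) := by
    intro ε hε
    obtain ⟨C', hC'⟩ := exists_lipschitzWith_cutoff_mul b ε hv hB
    have h1 := hweak _ C' hC' (hasCompactSupport_cutoff_mul b hε v)
      (tsupport_cutoff_mul_subset b hε v)
    have h2 : ∀ x, cutoff b ε x * (ψ x * v x) = ψ x * (cutoff b ε x * v x) := fun x => by ring
    simp only [h2]
    rw [← h1]
    have hi1 : IntegrableOn (fun x => inner ℝ (σ x) (gradient (fun x => cutoff b ε x * v x) x))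
        (openTri b) := by
      refine Integrable.mono' (hσ.norm.mul_const (C' : ℝ))
        (hσ.aestronglyMeasurable.inner (measurable_gradient _).aestronglyMeasurable)
        (Eventually.of_forall fun x => ?_)
      exact (norm_inner_le_norm _ _).trans
        (mul_le_mul_of_nonneg_left (norm_gradient_le hC' x) (norm_nonneg _))
    have hi2 : IntegrableOn (fun x => cutoff b ε x * inner ℝ (σ x) (gradient v x))
        (openTri b) := by
      refine Integrable.bdd_mul (c := 1) hgi (continuous_cutoff b ε).aestronglyMeasurable
        (Eventually.of_forall fun x => ?_)
      rw [Real.norm_of_nonneg (cutoff_nonneg b ε x)]; exact cutoff_le_one b ε x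
    rw [integral_openTri_eq_sum_cone b hi1, integral_openTri_eq_sum_cone b hi2,
      ← Finset.sum_add_distrib]
    refine Finset.sum_congr rfl fun k _ => ?_
    have hsub := cone_subset_openTri b k
    rw [← sub_eq_iff_eq_add', ← integral_sub (hi1.mono_set hsub) (hi2.mono_set hsub)]
    refine integral_congr_ae ?_
    filter_upwards [ae_gradient_cutoff_mul b k hε hv] with x hx
    rw [hx, inner_add_right, real_inner_smul_right, add_sub_cancel_left]
    split_ifs
    · rw [real_inner_smul_right]
    · rw [inner_zero_right]
  have hl := hlim hψv
  have hr := (hlim hgi).add (tendsto_finsetSum Finset.univ fun k _ => hstrip k)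
  rw [Finset.sum_neg_distrib, ← sub_eq_add_neg] at hr
  refine tendsto_nhds_unique hl (hr.congr' ?_)
  filter_upwards [self_mem_nhdsWithin] with ε hε
  rw [hid ε hε]

end Cone

/-! ### Piecewise affine functions -/

/-- By convexity `v` can be followed along a segment in `K`. At each point it has a right
derivative, namely the slope of one of the affine pieces, and the mean value inequality for right
derivatives applies. The sum of all gradient norms is a convenient common bound. -/
theorem exists_lipschitzOnWith_of_piecewise_affine {n : ℕ} {K : Set Plane} (hK : Convex ℝ K)
    {mesh : Fin n → Fin 3 → Plane} (hcov : ⋃ m, closedTri (mesh m) = K) {v : Plane → ℝ}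
    (hv : ContinuousOn v K) {L : Fin n → Plane →ᵃ[ℝ] ℝ}
    (hL : ∀ m, EqOn v (L m) (closedTri (mesh m))) : ∃ C, LipschitzOnWith C v K := by
  refine ⟨∑ m, ‖affGrad (L m)‖₊, LipschitzOnWith.of_dist_le_mul fun x hx y hy => ?_⟩
  set C : ℝ := ((∑ m, ‖affGrad (L m)‖₊ : NNReal) : ℝ) with hC
  have hCm : ∀ m, ‖affGrad (L m)‖ ≤ C := fun m => by
    rw [hC, NNReal.coe_sum]
    exact Finset.single_le_sum (f := fun m => ((‖affGrad (L m)‖₊ : NNReal) : ℝ))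
      (fun _ _ => NNReal.coe_nonneg _) (Finset.mem_univ m)
  let p : ℝ →ᵃ[ℝ] Plane := AffineMap.lineMap y x
  have hpc : Continuous p := AffineMap.lineMap_continuous
  have hpK : ∀ s ∈ Icc (0 : ℝ) 1, p s ∈ K := fun s hs =>
    hK.segment_subset hy hx (by rw [segment_eq_image_lineMap]; exact ⟨s, hs, rfl⟩)
  have key : ∀ t ∈ Ico (0 : ℝ) 1, ∃ d, HasDerivWithinAt (fun s => v (p s)) d (Ici t) t ∧
      ‖d‖ ≤ C * dist x y := by
    intro t ht
    -- Finitely many elements cover the segment, so one of them is met arbitrarily close to the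
    -- right of `t`. Being closed and convex, it contains a whole interval `[t, s1]`.
    obtain ⟨m, hm⟩ : ∃ m, ∃ᶠ s in 𝓝[>] t, p s ∈ closedTri (mesh m) := by
      by_contra! h
      have h1 : ∀ᶠ s in 𝓝[>] t, s ∈ Ioo t 1 := Ioo_mem_nhdsGT ht.2
      obtain ⟨s, hs, hs1⟩ := ((eventually_all.2 h).and h1).exists
      have := hpK s ⟨ht.1.trans hs1.1.le, hs1.2.le⟩
      rw [← hcov] at this
      obtain ⟨m, hm⟩ := mem_iUnion.1 this
      exact hs m hm
    have ht0 : p t ∈ closedTri (mesh m) :=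
      (isClosed_closedTri _).mem_of_frequently_of_tendsto hm
        (hpc.continuousAt.mono_left nhdsWithin_le_nhds)
    obtain ⟨s1, hs1, hts1⟩ := (hm.and_eventually self_mem_nhdsWithin).exists
    have hconv : Convex ℝ (p ⁻¹' closedTri (mesh m)) := (convex_closedTri _).affine_preimage p
    have hin : Icc t s1 ⊆ p ⁻¹' closedTri (mesh m) := hconv.ordConnected.out ht0 hs1
    have hder : HasDerivAt (fun s : ℝ => s * (L m x - L m y) + L m y) (L m x - L m y) t := by
      simpa using ((hasDerivAt_id t).mul_const (L m x - L m y)).add_const (L m y)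
    refine ⟨L m x - L m y, hder.hasDerivWithinAt.congr_of_eventuallyEq ?_ ?_, ?_⟩
    · filter_upwards [Icc_mem_nhdsGE hts1] with s hs
      rw [hL m (hin hs), AffineMap.apply_lineMap, AffineMap.lineMap_apply]; simp
    · rw [hL m ht0, AffineMap.apply_lineMap, AffineMap.lineMap_apply]; simp
    · rw [← inner_affGrad_sub, dist_eq_norm]
      exact (norm_inner_le_norm _ _).trans (mul_le_mul_of_nonneg_right (hCm m) (norm_nonneg _))
  choose! d hd hdC using key
  have := norm_image_sub_le_of_norm_deriv_right_le_segment (f := fun s => v (p s)) (f' := d)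
    (C := C * dist x y) (a := 0) (b := 1) (hv.comp hpc.continuousOn hpK) hd hdC 1 (by simp)
  simpa [p, dist_eq_norm] using this

theorem eq_vertex {b : Tri} {y : Plane} {i j : Fin 3} (hij : i ≠ j) (hi : b.coord i y = 0)
    (hj : b.coord j y = 0) : y ∈ range b := by
  obtain ⟨l, hli, hlj, hall⟩ : ∃ l : Fin 3, l ≠ i ∧ l ≠ j ∧ ∀ m, m ≠ l → m = i ∨ m = j := by
    clear hi hj; revert i j; decide
  have hl : b.coord l y = 1 := by
    have h := b.sum_coord_apply_eq_one y
    rw [Finset.sum_eq_single l] at h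
    · exact h
    · intro m _ hm
      rcases hall m hm with rfl | rfl <;> assumption
    · simp
  refine ⟨l, b.ext_elem fun m => ?_⟩
  by_cases hm : m = l
  · rw [hm, hl, b.coord_apply_eq]
  · rw [b.coord_apply_ne hm]
    rcases hall m hm with rfl | rfl
    · exact hi.symm
    · exact hj.symm

/-! ### Discrete functions and their fluxes on the edges of a subdomain -/

section Mesh

variable {b : Tri} {n : ℕ} {mesh : Fin n → Tri}

/-- A point on an edge of the triangle that is no node belongs to exactly one mesh element. -/
theorem mesh_unique (hc : IsConforming fun m => ⇑(mesh m))
    (hcov : ⋃ m, closedTri (mesh m) = closedTri b) {k : Fin 3} {y : Plane}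
    (hy : y ∈ openEdge b k) (hv : ∀ m, y ∉ range (mesh m)) {m m' : Fin n}
    (hm : y ∈ closedTri (mesh m)) (hm' : y ∈ closedTri (mesh m')) : m = m' := by
  by_contra hne
  have hsub : ∀ m, closedTri (mesh m) ⊆ closedTri b := fun m =>
    hcov ▸ subset_iUnion (fun m => closedTri (mesh m)) m
  have hnot := openEdge_notMem_openTri hy
  obtain ⟨j, hj⟩ : ∃ j, (mesh m).coord j y = 0 := by
    by_contra! h
    refine hnot (interior_mono (hsub m) (mem_openTri.2 fun i => ?_))
    exact (mem_closedTri.1 hm i).lt_of_ne (h i).symm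
  have hedge : y ∈ openEdge (mesh m) j := by
    refine ⟨hj, fun i hi => (mem_closedTri.1 hm i).lt_of_ne fun h => hv m ?_⟩
    exact eq_vertex hi h.symm hj
  obtain ⟨j', c, hc0, h1, h2, -⟩ := (faceToFace hc hne).exists_edge hedge hm'
  exact hnot (interior_mono (union_subset (hsub m) (hsub m')) (mem_interior_union hedge h1 hc0 h2))

/-- All other elements are closed and miss `y`, so near `y` the function is affine inside the
triangle and its gradient is constant. This makes the limit in `bdryGrad` meaningful off the nodes.
-/
theorem mesh_gradient (hc : IsConforming fun m => ⇑(mesh m))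
    (hcov : ⋃ m, closedTri (mesh m) = closedTri b) {k : Fin 3} {y : Plane}
    (hy : y ∈ openEdge b k) (hv : ∀ m, y ∉ range (mesh m)) {v : Plane → ℝ}
    {L : Fin n → Plane →ᵃ[ℝ] ℝ} (hL : ∀ m, EqOn v (L m) (closedTri (mesh m))) {m : Fin n}
    (hm : y ∈ closedTri (mesh m)) :
    limUnder (𝓝[openTri b] y) (gradient v) = affGrad (L m) := by
  have hne : (𝓝[openTri b] y).NeBot := by
    rw [← mem_closure_iff_nhdsWithin_neBot, closure_openTri]
    exact openEdge_subset_closedTri b k hy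
  have h1 : ∀ᶠ z in 𝓝 y, ∀ m', m' ≠ m → z ∉ closedTri (mesh m') := by
    rw [eventually_all]
    intro m'
    by_cases h : m' = m
    · simp [h]
    · have hn : y ∉ closedTri (mesh m') := fun h' => h (mesh_unique hc hcov hy hv h' hm)
      filter_upwards [(isClosed_closedTri (mesh m')).isOpen_compl.mem_nhds hn] with z hz _ using hz
  refine Tendsto.limUnder_eq (tendsto_const_nhds.congr' ?_)
  filter_upwards [nhdsWithin_le_nhds (eventually_eventually_nhds.2 h1), self_mem_nhdsWithin]
    with z hz hzT
  refine (HasGradientAt.gradient ((hasGradientAt_affine (L m) z).congr_of_eventuallyEq ?_)).symm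
  filter_upwards [hz, (isOpen_openTri b).mem_nhds hzT] with x hx hxT
  have h2 := openTri_subset_closedTri b hxT
  rw [← hcov] at h2
  obtain ⟨m', hm'⟩ := mem_iUnion.1 h2
  have h3 : m' = m := by
    by_contra h
    exact hx m' h hm'
  exact hL m (h3 ▸ hm')

instance : NullSingletonClass (Measure.hausdorffMeasure 1 : Measure Plane) :=
  Measure.nullSingletonClass_hausdorff Plane one_pos

theorem ae_edgeMeasure_notMem_finite (b : Tri) (k : Fin 3) {N : Set Plane} (hN : N.Finite) :
    ∀ᵐ y ∂edgeMeasure b k, y ∉ N := by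
  rw [edgeMeasure]
  exact ae_restrict_of_ae (measure_eq_zero_iff_ae_notMem.1 (hN.measure_zero _))

theorem ae_edgeMeasure_mem (b : Tri) (k : Fin 3) : ∀ᵐ y ∂edgeMeasure b k, y ∈ openEdge b k :=
  ae_restrict_mem (measurableSet_openEdge b k)

theorem memLp_top_edge {f : Plane → ℝ} (hf : ContinuousOn f (closedTri b)) (k : Fin 3) :
    MemLp f ⊤ (edgeMeasure b k) := by
  obtain ⟨B, hB⟩ := (isCompact_closedTri b).exists_bound_of_continuousOn hf
  refine memLp_top_of_bound ((hf.mono (openEdge_subset_closedTri b k)).aestronglyMeasurable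
    (measurableSet_openEdge b k)) B ?_
  filter_upwards [ae_edgeMeasure_mem b k] with y hy
  exact hB y (openEdge_subset_closedTri b k hy)

/-- The matrix-vector product as a continuous linear map. -/
def matCLM : Mat →ₗ[ℝ] (Plane →L[ℝ] Plane) :=
  LinearMap.toContinuousLinearMap.toLinearMap ∘ₗ Matrix.toEuclideanLin.toLinearMap

theorem continuous_matCLM : Continuous matCLM := LinearMap.continuous_of_finiteDimensional _

/-- Off the finitely many nodes, a null set for arc length, the flux is a finite sum of continuous
functions cut off to the elements. -/
theorem memLp_top_flux {A : Plane → Mat} (hA : ContinuousOn A (closedTri b))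
    (hc : IsConforming fun m => ⇑(mesh m)) (hcov : ⋃ m, closedTri (mesh m) = closedTri b)
    {v : Plane → ℝ} {L : Fin n → Plane →ᵃ[ℝ] ℝ} (hL : ∀ m, EqOn v (L m) (closedTri (mesh m)))
    (k : Fin 3) :
    MemLp (fun y => inner ℝ (outwardNormal b y)
      (mulV (A y) (limUnder (𝓝[openTri b] y) (gradient v)))) ⊤ (edgeMeasure b k) := by
  have h1 : ∀ m, MemLp ((closedTri (mesh m)).indicator fun y =>
      inner ℝ (edgeNormal b k) (mulV (A y) (affGrad (L m)))) ⊤ (edgeMeasure b k) := by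
    intro m
    refine MemLp.indicator (isClosed_closedTri _).measurableSet (memLp_top_edge ?_ k)
    have h2 : ContinuousOn (fun y => matCLM (A y) (affGrad (L m))) (closedTri b) :=
      (continuous_matCLM.comp_continuousOn hA).clm_apply continuousOn_const
    exact continuousOn_const.inner h2
  refine (memLp_finsetSum Finset.univ fun m _ => h1 m).ae_eq ?_
  filter_upwards [ae_edgeMeasure_mem b k,
    ae_edgeMeasure_notMem_finite b k (finite_iUnion fun m => finite_range (mesh m))] with y hy hN
  have hv : ∀ m, y ∉ range (mesh m) := fun m h => hN (mem_iUnion.2 ⟨m, h⟩)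
  have h2 := openEdge_subset_closedTri b k hy
  rw [← hcov] at h2
  obtain ⟨m, hm⟩ := mem_iUnion.1 h2
  rw [Finset.sum_eq_single m, indicator_of_mem hm, outwardNormal_eq b hy,
    mesh_gradient hc hcov hy hv hL hm]
  · intro m' _ hne
    exact indicator_of_notMem (fun h => hne (mesh_unique hc hcov hy hv h hm)) _
  · simp

end Mesh

/-! ### The transformed data -/

theorem mulV_apply (M : Mat) (v : Plane) (i : Fin 2) : mulV M v i = M i 0 * v 0 + M i 1 * v 1 := by
  fin_cases i <;> simp [mulV, Matrix.toLpLin_apply]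

/-- A kernel vector is a linear relation between two edge vectors; pairing it with the gradients of
the coordinates 1 and 2 shows that it is trivial. -/
theorem det_edgeMatrix_ne_zero (b : Tri) : (edgeMatrix b).det ≠ 0 := by
  intro h
  obtain ⟨v, hv, h0⟩ := Matrix.exists_mulVec_eq_zero_iff.2 h
  have h1 : v 0 • (b 1 - b 0) - v 1 • (b 2 - b 0) = 0 := by
    ext i
    have := congrFun h0 i
    simp only [edgeMatrix, Matrix.mulVec, dotProduct, Fin.sum_univ_two, Matrix.of_apply,
      Matrix.cons_val_zero, Matrix.cons_val_one, Pi.zero_apply] at this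
    simp only [PiLp.sub_apply, PiLp.smul_apply, PiLp.zero_apply, smul_eq_mul] at this ⊢
    linarith
  have h2 : ∀ k, v 0 * (b.coord k (b 1) - b.coord k (b 0))
      - v 1 * (b.coord k (b 2) - b.coord k (b 0)) = 0 := by
    intro k
    have h3 := congrArg (inner ℝ (affGrad (b.coord k))) h1
    rwa [inner_sub_right, inner_smul_right, inner_smul_right, inner_affGrad_sub,
      inner_affGrad_sub, inner_zero_right] at h3
  have e1 := h2 1
  have e2 := h2 2
  simp only [b.coord_apply] at e1 e2
  refine hv (funext fun i => ?_)
  fin_cases i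
  · simpa using e1
  · simpa using e2

theorem det_jac_ne_zero (s r : Tri) : (jac s r).det ≠ 0 := by
  rw [jac, Matrix.det_mul, Matrix.det_nonsing_inv, Ring.inverse_eq_inv']
  exact mul_ne_zero (det_edgeMatrix_ne_zero s) (inv_ne_zero (det_edgeMatrix_ne_zero r))

theorem jac_inv_mul (s r : Tri) : (jac s r)⁻¹ * edgeMatrix s = edgeMatrix r := by
  have hs : IsUnit (edgeMatrix s).det := (det_edgeMatrix_ne_zero s).isUnit
  have hr : IsUnit (edgeMatrix r).det := (det_edgeMatrix_ne_zero r).isUnit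
  rw [jac, Matrix.mul_inv_rev, Matrix.nonsing_inv_nonsing_inv _ hr, mul_assoc,
    Matrix.nonsing_inv_mul _ hs, mul_one]

/-- The map `φ_d⁻¹` as an affine map. -/
def affInvMap (s r : Fin 3 → Plane) : Plane →ᵃ[ℝ] Plane :=
  (Matrix.toEuclideanLin (jac s r)⁻¹).toAffineMap.comp
    (AffineMap.id ℝ Plane - AffineMap.const ℝ Plane (s 0)) + AffineMap.const ℝ Plane (r 0)

theorem affInvMap_apply (s r : Fin 3 → Plane) (y : Plane) : affInvMap s r y = affInv s r y := rfl

theorem continuous_affInv (s r : Fin 3 → Plane) : Continuous (affInv s r) :=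
  (affInvMap s r).continuous_of_finiteDimensional

theorem affInv_vertex (s r : Tri) (i : Fin 3) : affInv s r (s i) = r i := by
  have h := jac_inv_mul s r
  have key : ∀ (v : Plane) (j : Fin 2), mulV (jac s r)⁻¹ v j
      = (jac s r)⁻¹ j 0 * v 0 + (jac s r)⁻¹ j 1 * v 1 := mulV_apply _
  have hj : ∀ j l : Fin 2, (jac s r)⁻¹ j 0 * edgeMatrix s 0 l + (jac s r)⁻¹ j 1 * edgeMatrix s 1 l
      = edgeMatrix r j l := by
    intro j l
    rw [← h, Matrix.mul_apply, Fin.sum_univ_two]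
  rw [affInv]
  ext j
  rw [PiLp.add_apply, key]
  have h0 := hj j 0
  have h1 := hj j 1
  simp only [edgeMatrix, Matrix.of_apply, Matrix.cons_val_zero, Matrix.cons_val_one,
    PiLp.sub_apply] at h0 h1
  fin_cases i <;> simp only [PiLp.sub_apply, Fin.zero_eta, Fin.mk_one, Fin.reduceFinMk] <;> linarith

theorem affInv_mem (s r : Tri) {y : Plane} (hy : y ∈ closedTri s) : affInv s r y ∈ closedTri r := by
  have h : closedTri s ⊆ affInvMap s r ⁻¹' closedTri r := by
    refine convexHull_min ?_ ((convex_closedTri r).affine_preimage _)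
    rintro _ ⟨i, rfl⟩
    rw [mem_preimage, affInvMap_apply, affInv_vertex]
    exact subset_convexHull ℝ _ (mem_range_self i)
  exact h hy

theorem closedTri_ae_eq_openTri (b : Tri) : (closedTri b : Set Plane) =ᵐ[volume] openTri b :=
  (interior_ae_eq_of_null_frontier ((convex_closedTri b).addHaar_frontier volume)).symm

theorem map_affInv_volume (s r : Tri) : ∃ c : ℝ≥0∞, c ≠ ⊤ ∧
    Measure.map (affInv s r) (volume : Measure Plane) = c • volume := by
  set L := Matrix.toEuclideanLin (jac s r)⁻¹ with hL
  have hdet : LinearMap.det L ≠ 0 := by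
    have : LinearMap.det L = ((jac s r)⁻¹).det := by
      rw [hL, Matrix.toEuclideanLin_eq_toLin_orthonormal, LinearMap.det_toLin]
    rw [this, Matrix.det_nonsing_inv, Ring.inverse_eq_inv']
    exact inv_ne_zero (det_jac_ne_zero s r)
  have hLm : Measurable L := L.continuous_of_finiteDimensional.measurable
  refine ⟨ENNReal.ofReal |(LinearMap.det L)⁻¹|, ENNReal.ofReal_ne_top, ?_⟩
  have h1 : affInv s r = (fun x => x + r 0) ∘ L ∘ fun y => y + -(s 0) := by
    ext y : 1
    rw [affInv, sub_eq_add_neg]; rfl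
  rw [h1, ← Measure.map_map (measurable_add_const _) (hLm.comp (measurable_add_const _)),
    ← Measure.map_map hLm (measurable_add_const _),
    map_add_right_eq_self (volume : Measure Plane) (-(s 0)),
    Measure.map_linearMap_addHaar_eq_smul_addHaar _ hdet, Measure.map_smul,
    map_add_right_eq_self]

theorem memLp_comp_affInv (s r : Tri) {ψ : Plane → ℝ}
    (hψ : MemLp ψ 2 (volume.restrict (openTri r))) :
    MemLp (fun y => ψ (affInv s r y)) 2 (volume.restrict (openTri s)) := by
  obtain ⟨c, hc, hmap⟩ := map_affInv_volume s r
  have hm := (continuous_affInv s r).measurable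
  -- The inverse map was shown to send closed triangles to closed triangles, and the boundary is a
  -- null set.
  rw [← Measure.restrict_congr_set (closedTri_ae_eq_openTri r)] at hψ
  have hle : Measure.map (affInv s r) (volume.restrict (openTri s))
      ≤ c • volume.restrict (closedTri r) := by
    rw [← Measure.restrict_smul, ← hmap, Measure.restrict_map hm (isClosed_closedTri r).measurableSet]
    refine Measure.map_mono (Measure.restrict_mono (fun y hy => ?_) le_rfl) hm
    exact affInv_mem s r (openTri_subset_closedTri s hy)
  have h2 := MemLp.of_measure_le_smul hc hle hψ
  exact (memLp_map_measure_iff h2.aestronglyMeasurable hm.aemeasurable).1 h2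

theorem inner_mulV_comm {M : Mat} (hM : M.IsSymm) (v w : Plane) :
    inner ℝ (mulV M v) w = inner ℝ (mulV M w) v := by
  have h : M 0 1 = M 1 0 := hM.apply 1 0
  simp only [PiLp.inner_apply, Fin.sum_univ_two, mulV_apply, h]
  simp
  ring

theorem isSymm_transCoeff {D : ℕ} (s r : Fin D → Fin 3 → Plane) (a : Plane → Mat) (d : Fin D)
    (y : Plane) (h : (a (affInv (s d) (r d) y)).IsSymm) : (transCoeff s r a d y).IsSymm := by
  rw [transCoeff]
  refine Matrix.IsSymm.smul ?_ _
  rw [Matrix.IsSymm, Matrix.transpose_mul, Matrix.transpose_mul, Matrix.transpose_transpose, h.eq,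
    mul_assoc]

theorem continuousOn_transCoeff {D : ℕ} {s r : Fin D → Tri} {a : Plane → Mat} {S : Set Plane}
    (ha : ContinuousOn a S) (hS : ∀ d, closedTri (r d) ⊆ S) (d : Fin D) :
    ContinuousOn (transCoeff (fun d => ⇑(s d)) (fun d => ⇑(r d)) a d) (closedTri (s d)) := by
  have h1 : ContinuousOn (fun y => a (affInv (s d) (r d) y)) (closedTri (s d)) :=
    ha.comp (continuous_affInv _ _).continuousOn fun y hy => hS d (affInv_mem (s d) (r d) hy)
  unfold transCoeff
  exact ContinuousOn.smul (f := fun _ => |(jac (s d) (r d)).det|⁻¹) continuousOn_const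
    ((continuousOn_const.mul h1).mul continuousOn_const)

/-! ### Integration along interfaces -/

theorem closedEdge_ae_eq_openEdge (b : Tri) (k : Fin 3) :
    (closedEdge b k : Set Plane) =ᵐ[Measure.hausdorffMeasure 1] openEdge b k := by
  have h : ∀ᵐ y ∂(Measure.hausdorffMeasure 1 : Measure Plane), y ∉ range b :=
    measure_eq_zero_iff_ae_notMem.1 ((finite_range b).measure_zero _)
  filter_upwards [h] with y hy
  refine propext ⟨fun hc => ⟨hc.1, fun i hi => (hc.2 i hi).lt_of_ne fun h0 => hy ?_⟩,
    fun ho => openEdge_subset_closedEdge b k ho⟩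
  exact eq_vertex hi h0.symm hc.1

theorem restrict_interface {D : ℕ} {s : Fin D → Tri} {d e : Fin D} {k : Fin 3}
    (h : interface (fun d => ⇑(s d)) d e = closedEdge (s d) k) :
    (Measure.hausdorffMeasure 1).restrict (interface (fun d => ⇑(s d)) d e)
      = edgeMeasure (s d) k := by
  rw [h, Measure.restrict_congr_set (closedEdge_ae_eq_openEdge (s d) k), edgeMeasure]

theorem restrict_interface_comm {D : ℕ} (s : Fin D → Fin 3 → Plane) (d e : Fin D) :
    (Measure.hausdorffMeasure 1).restrict (interface s d e)
      = (Measure.hausdorffMeasure 1).restrict (interface s e d) := by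
  rw [interface, inter_comm]; rfl

theorem bip_comm {D : ℕ} (s : Fin D → Fin 3 → Plane) (d e : Fin D) (f g : Plane → ℝ) :
    bip s d e f g = bip s e d f g := by
  rw [bip, bip, restrict_interface_comm]

/-- The default value `0` is integrable too. Integrability and symmetry in `(d, e)` suffice later,
because all terms with the trace of `η` cancel in the final sum. -/
theorem trace_integrable {D : ℕ} (s : Fin D → Fin 3 → Plane) (η : Plane → ℝ) (d e : Fin D) :
    IntegrableOn (ifaceTrace s η d e) (interface s d e) (Measure.hausdorffMeasure 1) := by
  unfold ifaceTrace trace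
  split_ifs with h
  · exact h.choose_spec.1
  · exact integrableOn_zero

theorem ifaceTrace_comm {D : ℕ} (s : Fin D → Fin 3 → Plane) (η : Plane → ℝ) (d e : Fin D) :
    ifaceTrace s η d e = ifaceTrace s η e d := by
  unfold ifaceTrace
  rw [show interface s d e = interface s e d from inter_comm _ _]

theorem normalTrace_spec {D : ℕ} {s : Fin D → Fin 3 → Plane} {d e : Fin D} {σ : Plane → Plane}
    (h : ∃ γ, IsNormalTrace s d e σ γ) : IsNormalTrace s d e σ (normalTrace s d e σ) := by
  rw [normalTrace, dif_pos h]; exact h.choose_spec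

theorem IsNormalTrace.hasEdgeTrace {D : ℕ} {s : Fin D → Tri} {d e : Fin D} {k : Fin 3}
    (hk : interface (fun d => ⇑(s d)) d e = closedEdge (s d) k) {σ : Plane → Plane}
    {γ : Plane → ℝ} (h : IsNormalTrace (fun d => ⇑(s d)) d e σ γ) :
    HasEdgeTrace (s d) k σ γ := by
  unfold IsNormalTrace IntegrableOn at h
  rw [restrict_interface hk] at h
  refine ⟨h.1, h.2.congr fun ε => ?_⟩
  congr 1
  refine lintegral_congr fun t => lintegral_congr_ae ?_
  filter_upwards [ae_edgeMeasure_mem (s d) k] with y hy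
  rw [outwardNormal_eq (s d) hy]

/-! ### Weak solutions on the subdomains -/

theorem integrableOn_mulV {b : Tri} {A : Plane → Mat} (hA : ContinuousOn A (closedTri b))
    {G : Plane → Plane} (hG : MemLp G 2 (volume.restrict (openTri b))) :
    MemLp (fun y => mulV (A y) (G y)) 2 (volume.restrict (openTri b)) := by
  have hc : ContinuousOn (fun y => matCLM (A y)) (closedTri b) :=
    continuous_matCLM.comp_continuousOn hA
  obtain ⟨B, hB⟩ := (isCompact_closedTri b).exists_bound_of_continuousOn hc
  refine MemLp.of_le_mul (c := B) hG ?_ ?_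
  · exact isBoundedBilinearMap_apply.continuous.comp_aestronglyMeasurable
      (((hc.mono (openTri_subset_closedTri b)).aestronglyMeasurable
        (isOpen_openTri b).measurableSet).prodMk hG.aestronglyMeasurable)
  · filter_upwards [ae_restrict_mem (isOpen_openTri b).measurableSet] with y hy
    exact (matCLM (A y)).le_of_opNorm_le (hB y (openTri_subset_closedTri b hy)) _

instance isFiniteMeasure_restrict_openTri (b : Tri) :
    IsFiniteMeasure (volume.restrict (openTri b)) := by
  refine ⟨?_⟩
  rw [Measure.restrict_apply_univ]
  exact (measure_mono (openTri_subset_closedTri b)).trans_lt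
    (isCompact_closedTri b).measure_lt_top

section WeakSolution

variable {D : ℕ} {s : Fin D → Tri} {A : Fin D → Plane → Mat} {ψ : Fin D → Plane → ℝ}
  {η : Plane → ℝ} {G : Plane → Plane}

theorem memLp_openTri {E : Type*} [NormedAddCommGroup E] {f : Plane → E}
    (hf : MemLp f 2 (volume.restrict (domain fun d => ⇑(s d)))) (d : Fin D) :
    MemLp f 2 (volume.restrict (openTri (s d))) :=
  hf.mono_measure (Measure.restrict_mono (openTri_subset_domain s d) le_rfl)

theorem setIntegral_eq_zero_of_disjoint_tsupport {b : Tri} {w : Plane → ℝ}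
    (hw : ∀ x ∈ openTri b, w x = 0) (σ : Plane → Plane) (f : Plane → ℝ) :
    ∫ x in openTri b, inner ℝ (σ x) (gradient w x) = 0 ∧ ∫ x in openTri b, f x * w x = 0 := by
  have hm := (isOpen_openTri b).measurableSet
  constructor
  · rw [setIntegral_congr_fun hm (g := fun _ => (0 : ℝ)), integral_zero]
    intro x hx
    have : HasGradientAt w 0 x := by
      refine (hasGradientAt_const x (0 : ℝ)).congr_of_eventuallyEq ?_
      filter_upwards [(isOpen_openTri b).mem_nhds hx] with z hz using hw z hz
    simp only [this.gradient, inner_zero_right]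
  · rw [setIntegral_congr_fun hm (g := fun _ => (0 : ℝ)), integral_zero]
    intro x hx
    simp only [hw x hx, mul_zero]

/-- A test function supported in `Ω_d` vanishes on the other triangles, so the global sums reduce to
one term each. -/
theorem weakSolution_local (hs : IsConforming fun d => ⇑(s d))
    (hη : IsWeakSolution (fun d => ⇑(s d)) A ψ η G) (d : Fin D) {w : Plane → ℝ} {C : NNReal}
    (hw : LipschitzWith C w) (hc : HasCompactSupport w) (hsup : tsupport w ⊆ openTri (s d)) :
    ∫ x in openTri (s d), inner ℝ (mulV (A d x) (G x)) (gradient w x)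
      = ∫ x in openTri (s d), ψ d x * w x := by
  have h := hη.2 w _ (memH10_of_lipschitz isOpen_domain hw hc
    (hsup.trans (openTri_subset_domain s d)))
  have hz : ∀ e, e ≠ d → ∀ x ∈ openTri (s e), w x = 0 := fun e he x hx =>
    image_eq_zero_of_notMem_tsupport fun hx' => (faceToFace hs he).1.ne_of_mem hx (hsup hx') rfl
  rw [Finset.sum_eq_single d, Finset.sum_eq_single d] at h
  · exact h
  · exact fun e _ he => (setIntegral_eq_zero_of_disjoint_tsupport (hz e he)
      (fun _ => 0) (ψ e)).2
  · simp
  · exact fun e _ he => (setIntegral_eq_zero_of_disjoint_tsupport (hz e he)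
      (fun x => mulV (A e x) (G x)) (ψ e)).1
  · simp

/-- Green's formula on a subdomain for the conormal derivative of a weak solution. -/
theorem green_subdomain (hs : IsConforming fun d => ⇑(s d))
    (hA : ∀ d, ContinuousOn (A d) (closedTri (s d)))
    (hψ : ∀ d, MemLp (ψ d) 2 (volume.restrict (openTri (s d))))
    (hη : IsWeakSolution (fun d => ⇑(s d)) A ψ η G)
    (hflux : ∀ d, ∀ e ∈ neighbors (fun d => ⇑(s d)) d,
      ∃ γ, IsNormalTrace (fun d => ⇑(s d)) d e (fun y => mulV (A d y) (G y)) γ)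
    (d : Fin D) {v : Plane → ℝ} {C : NNReal} (hv : LipschitzWith C v) {B : ℝ}
    (hB : ∀ x, |v x| ≤ B)
    (hv0 : ∀ y ∈ frontier (closedTri (s d)) ∩ frontier (domain fun d => ⇑(s d)), v y = 0) :
    ip (fun d => ⇑(s d)) d (ψ d) v = energy (fun d => ⇑(s d)) A d G (gradient v)
      - ∑ e ∈ neighbors (fun d => ⇑(s d)) d, bip (fun d => ⇑(s d)) d e
          (normalTrace (fun d => ⇑(s d)) d e fun y => mulV (A d y) (G y)) v := by
  set S : Fin D → Fin 3 → Plane := fun d => ⇑(s d) with hS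
  set γ : Fin D → Plane → ℝ := fun e => normalTrace S d e fun y => mulV (A d y) (G y) with hγdef
  -- The edge assigned to a neighbor is the shared one; to other indices the edge 0 is assigned as a
  -- dummy.
  have hex : ∀ e, ∃ k, e ∈ neighbors S d → interface S d e = closedEdge (s d) k := by
    intro e
    by_cases he : e ∈ neighbors S d
    · obtain ⟨k, hk⟩ := exists_interface_eq hs he
      exact ⟨k, fun _ => hk⟩
    · exact ⟨0, fun h => absurd h he⟩
  choose kk hkk using hex
  have htr : ∀ e ∈ neighbors S d, HasEdgeTrace (s d) (kk e) (fun y => mulV (A d y) (G y)) (γ e) :=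
    fun e he => (normalTrace_spec (hflux d e he)).hasEdgeTrace (hkk e he)
  have hsub : ∀ e ∈ neighbors S d, openEdge (s d) (kk e) ⊆ closedTri (s e) := by
    intro e he y hy
    have h1 : y ∈ interface S d e := by
      rw [hkk e he]; exact openEdge_subset_closedEdge _ _ hy
    exact (isClosed_closedTri _).frontier_subset h1.2
  have huniq : ∀ e ∈ neighbors S d, ∀ e' ∈ neighbors S d, kk e = kk e' → e = e' := by
    intro e he e' he' hk
    obtain ⟨y, hy⟩ := (openEdge_nontrivial (s d) (kk e)).nonempty
    exact edge_unique hs hy (hsub e he hy) (hsub e' he' (hk ▸ hy))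
      (mem_neighbors_iff.1 he).1 (mem_neighbors_iff.1 he').1
  have hint : ∀ e ∈ neighbors S d, Integrable (fun y => γ e y * v y) (edgeMeasure (s d) (kk e)) :=
    fun e he => (htr e he).1.mul_bdd (c := B) hv.continuous.aestronglyMeasurable
      (Eventually.of_forall hB)
  -- Traces indexed by neighbors are regrouped by edges. By `huniq` each sum has at most one term;
  -- it is empty exactly when no neighbor lies across the edge, and then the open edge is part of
  -- `∂Ω`, where `v` vanishes.
  let γ' : Fin 3 → Plane → ℝ := fun k y => ∑ e ∈ neighbors S d with kk e = k, γ e y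
  have hcase : ∀ k, HasEdgeTrace (s d) k (fun y => mulV (A d y) (G y)) (γ' k) ∨
      (γ' k = 0 ∧ ∀ y ∈ openEdge (s d) k, v y = 0) := by
    intro k
    rcases ((neighbors S d).filter fun e => kk e = k).eq_empty_or_nonempty with h | ⟨e, he⟩
    · right
      refine ⟨funext fun y => by simp only [γ', h, Finset.sum_empty, Pi.zero_apply],
        fun y hy => hv0 y ⟨openEdge_subset_frontier _ _ hy, ?_⟩⟩
      refine openEdge_subset_frontier_domain hy fun e hed hye => ?_
      obtain ⟨h1, h2⟩ := mem_neighbors_of_mem hs hy hye hed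
      have h3 : k = kk e := by
        refine openEdge_disjoint (s d) hy ?_
        rw [← hkk e h1, h2]
        exact openEdge_subset_closedEdge _ _ hy
      exact Finset.notMem_empty e (h ▸ Finset.mem_filter.2 ⟨h1, h3.symm⟩)
    · left
      obtain ⟨h1, h2⟩ := Finset.mem_filter.1 he
      have h3 : (neighbors S d).filter (fun e => kk e = k) = {e} := by
        refine Finset.eq_singleton_iff_unique_mem.2 ⟨he, fun e' he' => ?_⟩
        obtain ⟨h1', h2'⟩ := Finset.mem_filter.1 he'
        exact huniq e' h1' e h1 (h2'.trans h2.symm)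
      have h4 : γ' k = γ e := funext fun y => by simp only [γ', h3, Finset.sum_singleton]
      rw [h4, ← h2]
      exact htr e h1
  have hσ : IntegrableOn (fun y => mulV (A d y) (G y)) (openTri (s d)) :=
    (integrableOn_mulV (hA d) (memLp_openTri hη.1.2.1 d)).integrable (by norm_num)
  have hψ' : IntegrableOn (ψ d) (openTri (s d)) := (hψ d).integrable (by norm_num)
  have hgreen := green_triangle hσ hψ' (fun w C' hw hc hsup => weakSolution_local hs hη d hw hc hsup)
    hv hB hcase
  have hsum : ∑ k, ∫ y, γ' k y * v y ∂edgeMeasure (s d) k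
      = ∑ e ∈ neighbors S d, bip S d e (γ e) v := by
    rw [← Finset.sum_fiberwise (neighbors S d) kk]
    refine Finset.sum_congr rfl fun k _ => ?_
    simp only [γ', Finset.sum_mul]
    rw [integral_finsetSum]
    · refine Finset.sum_congr rfl fun e he => ?_
      obtain ⟨h1, h2⟩ := Finset.mem_filter.1 he
      rw [bip, restrict_interface (hkk e h1), h2]
    · intro e he
      obtain ⟨h1, h2⟩ := Finset.mem_filter.1 he
      exact h2 ▸ hint e h1
  rw [hsum] at hgreen
  exact hgreen

/-- The normal flux of a weak solution is continuous across the interfaces. -/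
theorem normalTrace_add_eq_zero (hs : IsConforming fun d => ⇑(s d))
    (hA : ∀ d, ContinuousOn (A d) (closedTri (s d)))
    (hψ : ∀ d, MemLp (ψ d) 2 (volume.restrict (openTri (s d))))
    (hη : IsWeakSolution (fun d => ⇑(s d)) A ψ η G)
    (hflux : ∀ d, ∀ e ∈ neighbors (fun d => ⇑(s d)) d,
      ∃ γ, IsNormalTrace (fun d => ⇑(s d)) d e (fun y => mulV (A d y) (G y)) γ)
    {d e : Fin D} (he : e ∈ neighbors (fun d => ⇑(s d)) d) :
    ∀ᵐ y ∂(Measure.hausdorffMeasure 1).restrict (interface (fun d => ⇑(s d)) d e),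
      normalTrace (fun d => ⇑(s d)) d e (fun y => mulV (A d y) (G y)) y
        + normalTrace (fun d => ⇑(s d)) e d (fun y => mulV (A e y) (G y)) y = 0 := by
  set S : Fin D → Fin 3 → Plane := fun d => ⇑(s d) with hS
  set γ : Fin D → Fin D → Plane → ℝ := fun d e =>
    normalTrace S d e fun y => mulV (A d y) (G y) with hγdef
  have hne : e ≠ d := (mem_neighbors_iff.1 he).1
  have he' : d ∈ neighbors S e := mem_neighbors_comm.1 he
  obtain ⟨k, hk⟩ := exists_interface_eq hs he
  have hμ := restrict_interface hk
  have hi1 : Integrable (γ d e) ((Measure.hausdorffMeasure 1).restrict (interface S d e)) :=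
    (normalTrace_spec (hflux d e he)).1
  have hi2 : Integrable (γ e d) ((Measure.hausdorffMeasure 1).restrict (interface S d e)) := by
    rw [restrict_interface_comm]; exact (normalTrace_spec (hflux e d he')).1
  -- An open set around the inner points of the interface that meets no other closed triangle.
  set O : Set Plane := domain S ∩ ⋂ f : Fin D, {x | f ≠ d → f ≠ e → x ∉ closedTri (s f)} with hO
  have hOo : IsOpen O := by
    refine isOpen_domain.inter (isOpen_iInter_of_finite fun f => ?_)
    by_cases h : f ≠ d ∧ f ≠ e
    · have : {x | f ≠ d → f ≠ e → x ∉ closedTri (s f)} = (closedTri (s f))ᶜ := by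
        ext x; exact ⟨fun hx => hx h.1 h.2, fun hx _ _ => hx⟩
      rw [this]; exact (isClosed_closedTri _).isOpen_compl
    · have : {x | f ≠ d → f ≠ e → x ∉ closedTri (s f)} = univ :=
        eq_univ_of_forall fun x h1 h2 => absurd ⟨h1, h2⟩ h
      rw [this]; exact isOpen_univ
  have hmemO : ∀ y ∈ openEdge (s d) k, y ∈ O := by
    intro y hy
    have hye : y ∈ closedTri (s e) := by
      have : y ∈ interface S d e := hk ▸ openEdge_subset_closedEdge _ _ hy
      exact (isClosed_closedTri _).frontier_subset this.2
    exact ⟨openEdge_subset_domain hs hy hye hne, mem_iInter.2 fun f h1 h2 h3 =>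
      h2 (edge_unique hs hy h3 hye h1 hne)⟩
  -- Fundamental lemma of the calculus of variations: the sum of the two fluxes is tested with
  -- smooth `g` supported in `O`. Adding Green's formulas over all triangles and subtracting the
  -- weak equation leaves only the two sides of this interface.
  have key : ∀ᵐ y ∂(Measure.hausdorffMeasure 1).restrict (interface S d e),
      y ∈ O → γ d e y + γ e d y = 0 := by
    refine hOo.ae_eq_zero_of_integral_contDiff_smul_eq_zero
      ((hi1.add hi2).locallyIntegrable.locallyIntegrableOn O) fun g hg hgc hgO => ?_
    obtain ⟨C, hC⟩ := hg.lipschitzWith_of_hasCompactSupport hgc (by simp)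
    obtain ⟨B, hB⟩ := hg.continuous.bounded_above_of_compact_support hgc
    have hgz : ∀ x, x ∉ O → g x = 0 := fun x hx =>
      image_eq_zero_of_notMem_tsupport fun h => hx (hgO h)
    have hdom : ∀ x ∈ frontier (domain S), g x = 0 := by
      intro x hx
      refine hgz x fun hxO => ?_
      rw [isOpen_domain.frontier_eq] at hx
      exact hx.2 hxO.1
    have hweak := hη.2 g _ (memH10_of_lipschitz isOpen_domain hC hgc
      (hgO.trans inter_subset_left))
    have hgreen : ∀ f, ip S f (ψ f) g = energy S A f G (gradient g)
        - ∑ e ∈ neighbors S f, bip S f e (γ f e) g := fun f =>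
      green_subdomain hs hA hψ hη hflux f hC hB fun y hy => hdom y hy.2
    have hsum : ∑ f, ∑ e ∈ neighbors S f, bip S f e (γ f e) g = 0 := by
      have h1 : ∑ f, ip S f (ψ f) g = ∑ f, energy S A f G (gradient g)
          - ∑ f, ∑ e ∈ neighbors S f, bip S f e (γ f e) g := by
        rw [← Finset.sum_sub_distrib]
        exact Finset.sum_congr rfl fun f _ => hgreen f
      have h2 : ∑ f, energy S A f G (gradient g) = ∑ f, ip S f (ψ f) g := hweak
      linarith
    have hbz : ∀ f f', (f ≠ d ∧ f ≠ e) ∨ (f' ≠ d ∧ f' ≠ e) → bip S f f' (γ f f') g = 0 := by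
      intro f f' h
      refine setIntegral_eq_zero_of_forall_eq_zero fun y hy => ?_
      rw [hgz y, mul_zero]
      intro hyO
      rcases h with h | h
      · exact mem_iInter.1 hyO.2 f h.1 h.2 ((isClosed_closedTri _).frontier_subset hy.1)
      · exact mem_iInter.1 hyO.2 f' h.1 h.2 ((isClosed_closedTri _).frontier_subset hy.2)
    have hin : ∀ f f', f ≠ f' → f' ∈ neighbors S f → (f = d ∧ f' = e) ∨ (f = e ∧ f' = d) →
        ∑ e ∈ neighbors S f, bip S f e (γ f e) g = bip S f f' (γ f f') g := by
      intro f f' hff hmem hor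
      refine Finset.sum_eq_single f' (fun b hb hbf => hbz f b (Or.inr ?_))
        fun h => absurd hmem h
      have hbf' := (mem_neighbors_iff.1 hb).1
      rcases hor with ⟨rfl, rfl⟩ | ⟨rfl, rfl⟩
      · exact ⟨hbf', hbf⟩
      · exact ⟨hbf, hbf'⟩
    rw [Finset.sum_eq_add d e hne.symm (fun f _ hf => Finset.sum_eq_zero fun f' _ =>
      hbz f f' (Or.inl hf)) (by simp) (by simp),
      hin d e hne.symm he (Or.inl ⟨rfl, rfl⟩), hin e d hne he' (Or.inr ⟨rfl, rfl⟩),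
      bip_comm S e d, bip, bip] at hsum
    have hb : ∀ {f : Plane → ℝ},
        Integrable f ((Measure.hausdorffMeasure 1).restrict (interface S d e)) →
        Integrable (fun y => f y * g y)
          ((Measure.hausdorffMeasure 1).restrict (interface S d e)) := fun hf =>
      hf.mul_bdd (c := B) hC.continuous.aestronglyMeasurable (Eventually.of_forall hB)
    rw [← integral_add (hb hi1) (hb hi2)] at hsum
    rw [← hsum]
    refine integral_congr_ae (Eventually.of_forall fun y => ?_)
    simp only [smul_eq_mul]
    ring
  rw [hμ] at key ⊢
  filter_upwards [key, ae_edgeMeasure_mem (s d) k] with y h1 h2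
  exact h1 (hmemO y h2)

end WeakSolution

/-! ### The error representation -/

/-- The normals are the negated, normalized gradients of the coordinates vanishing on the edge, and
these gradients are negative multiples of each other. -/
theorem outwardNormal_eq_neg {D : ℕ} {s : Fin D → Tri} (hs : IsConforming fun d => ⇑(s d))
    {d e : Fin D} {k : Fin 3} {y : Plane} (hy : y ∈ openEdge (s d) k) (he : y ∈ closedTri (s e))
    (hne : e ≠ d) : outwardNormal (s d) y = -outwardNormal (s e) y := by
  obtain ⟨j, c, hc, h1, h2, -⟩ := (faceToFace hs hne.symm).exists_edge hy he
  rw [outwardNormal_eq (s d) hy, outwardNormal_eq (s e) h1, edgeNormal, edgeNormal]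
  have hg : affGrad ((s e).coord j) = c • affGrad ((s d).coord k) := by
    refine ext_inner_right ℝ fun v => ?_
    have e1 := inner_affGrad_sub ((s e).coord j) (y + v) y
    have e2 := inner_affGrad_sub ((s d).coord k) (y + v) y
    rw [add_sub_cancel_left] at e1 e2
    rw [e1, real_inner_smul_left, e2, h2, h2]; ring
  have h0 := norm_pos_iff.2 (coordGrad_ne_zero (s d) k)
  rw [hg, norm_smul, Real.norm_of_nonpos hc.le, smul_smul, ← neg_smul]
  congr 1
  field_simp [hc.ne, h0.ne']

/-- Green's formula is set up for bounded Lipschitz functions on the whole plane. Truncating a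
Lipschitz extension at a bound for `v` on `K` changes nothing on `K`. -/
theorem exists_lipschitz_extension {K : Set Plane} (hK : IsCompact K) {v : Plane → ℝ} {C : NNReal}
    (hv : LipschitzOnWith C v K) :
    ∃ (w : Plane → ℝ) (C' : NNReal) (B : ℝ), LipschitzWith C' w ∧ (∀ x, |w x| ≤ B) ∧ EqOn v w K := by
  obtain ⟨g, hg, hvg⟩ := hv.extend_real
  obtain ⟨B, hB⟩ := hK.exists_bound_of_continuousOn hv.continuousOn
  have hB' : ∀ x ∈ K, |v x| ≤ |B| := fun x hx => (hB x hx).trans (le_abs_self B)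
  refine ⟨fun x => max (-|B|) (min |B| (g x)), _, |B|, (hg.const_min |B|).const_max (-|B|),
    fun x => ?_, fun x hx => ?_⟩
  · rw [abs_le]
    exact ⟨le_max_left _ _, max_le (by linarith [abs_nonneg B]) (min_le_left _ _)⟩
  · have := abs_le.1 (hB' x hx)
    rw [hvg hx] at this ⊢
    simp only
    rw [min_eq_right this.2, max_eq_right this.1]

theorem sum_neighbors_comm {D : ℕ} (s : Fin D → Tri) (f : Fin D → Fin D → ℝ) :
    ∑ d, ∑ e ∈ neighbors (fun d => ⇑(s d)) d, f d e
      = ∑ d, ∑ e ∈ neighbors (fun d => ⇑(s d)) d, f e d :=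
  Finset.sum_comm' fun d e => by
    simp only [Finset.mem_univ, true_and, and_true]
    exact mem_neighbors_comm

theorem energy_comm {D : ℕ} {s : Fin D → Tri} {A : Fin D → Plane → Mat} (d : Fin D)
    (hA : ∀ y ∈ openTri (s d), (A d y).IsSymm) (σ τ : Plane → Plane) :
    energy (fun d => ⇑(s d)) A d σ τ = energy (fun d => ⇑(s d)) A d τ σ :=
  setIntegral_congr_fun (isOpen_openTri _).measurableSet fun y hy => inner_mulV_comm (hA y hy) _ _

section Representation

variable {D : ℕ} {s : Fin D → Tri} {A : Fin D → Plane → Mat} {ψ : Fin D → Plane → ℝ}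
  {η : Plane → ℝ} {G : Plane → Plane}

/-- Green's formula on a subdomain, tested with a discrete function. -/
theorem green_discrete (hs : IsConforming fun d => ⇑(s d))
    (hA : ∀ d, ContinuousOn (A d) (closedTri (s d)))
    (hψ : ∀ d, MemLp (ψ d) 2 (volume.restrict (openTri (s d))))
    (hη : IsWeakSolution (fun d => ⇑(s d)) A ψ η G)
    (hflux : ∀ d, ∀ e ∈ neighbors (fun d => ⇑(s d)) d,
      ∃ γ, IsNormalTrace (fun d => ⇑(s d)) d e (fun y => mulV (A d y) (G y)) γ)
    (d : Fin D) {n : ℕ} {mesh : Fin n → Fin 3 → Plane}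
    (hcov : ⋃ m, closedTri (mesh m) = closedTri (s d)) {v : Plane → ℝ}
    (hv : MemVh (fun d => ⇑(s d)) mesh d v) :
    ip (fun d => ⇑(s d)) d v (ψ d) = energy (fun d => ⇑(s d)) A d G (gradient v)
      - ∑ e ∈ neighbors (fun d => ⇑(s d)) d, bip (fun d => ⇑(s d)) d e
          (normalTrace (fun d => ⇑(s d)) d e fun y => mulV (A d y) (G y)) v := by
  obtain ⟨hvc, hvL, hv0⟩ := hv
  choose L hL using hvL
  obtain ⟨C, hC⟩ := exists_lipschitzOnWith_of_piecewise_affine (convex_closedTri (s d)) hcov hvc hL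
  obtain ⟨w, C', B, hw, hB, hvw⟩ := exists_lipschitz_extension (isCompact_closedTri (s d)) hC
  have h := green_subdomain hs hA hψ hη hflux d hw hB fun y hy => by
    rw [← hvw ((isClosed_closedTri _).frontier_subset hy.1)]; exact hv0 y hy
  have hm := (isOpen_openTri (s d)).measurableSet
  have e1 : ip (fun d => ⇑(s d)) d v (ψ d) = ip (fun d => ⇑(s d)) d (ψ d) w := by
    refine setIntegral_congr_fun hm fun y hy => ?_
    simp only [hvw (openTri_subset_closedTri _ hy), mul_comm]
  have e2 : energy (fun d => ⇑(s d)) A d G (gradient v)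
      = energy (fun d => ⇑(s d)) A d G (gradient w) := by
    refine setIntegral_congr_fun hm fun y hy => ?_
    have : v =ᶠ[𝓝 y] w := by
      filter_upwards [(isOpen_openTri (s d)).mem_nhds hy] with z hz
        using hvw (openTri_subset_closedTri _ hz)
    simp only [gradient, this.fderiv_eq]
  have e3 : ∀ e (γ : Plane → ℝ), bip (fun d => ⇑(s d)) d e γ v = bip (fun d => ⇑(s d)) d e γ w := by
    intro e γ
    have hmi : MeasurableSet (interface (fun d => ⇑(s d)) d e) :=
      (isClosed_frontier.inter isClosed_frontier).measurableSet
    refine setIntegral_congr_fun hmi fun y hy => ?_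
    simp only [hvw ((isClosed_closedTri _).frontier_subset hy.1)]
  rw [e1, e2, h]
  simp only [e3]

/-- Every contribution is expanded into a few elementary interface integrals indexed by ordered
pairs of neighbors; the claim is then a linear identity modulo exchanging the two indices. -/
theorem error_representation (hs : IsConforming fun d => ⇑(s d))
    (hA : ∀ d, ContinuousOn (A d) (closedTri (s d)))
    (hsymm : ∀ d, ∀ y ∈ openTri (s d), (A d y).IsSymm)
    {F : Fin D → Plane → ℝ} (hψ : ∀ d, MemLp (ψ d) 2 (volume.restrict (openTri (s d))))
    {u : Plane → ℝ} {Gu : Plane → Plane} (hu : IsWeakSolution (fun d => ⇑(s d)) A F u Gu)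
    (hη : IsWeakSolution (fun d => ⇑(s d)) A ψ η G)
    (hflux : ∀ d, ∀ e ∈ neighbors (fun d => ⇑(s d)) d,
      ∃ γ, IsNormalTrace (fun d => ⇑(s d)) d e (fun y => mulV (A d y) (G y)) γ)
    {M : Fin D → ℕ} {mesh : ∀ d, Fin (M d) → Fin 3 → Plane}
    (hmesh : ∀ d, IsConforming (mesh d) ∧ ⋃ m, closedTri (mesh d m) = closedTri (s d))
    (lam : ℝ) {U U' : Fin D → Plane → ℝ} (hU : ∀ d, MemVh (fun d => ⇑(s d)) (mesh d) d (U d))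
    (hU' : ∀ d, MemVh (fun d => ⇑(s d)) (mesh d) d (U' d)) :
    qoi (fun d => ⇑(s d)) ψ (fun d y => u y - U' d y)
      = discretizationError (fun d => ⇑(s d)) A F lam η G U U'
        + iterationError (fun d => ⇑(s d)) A lam η U U'
        + transformationError (fun d => ⇑(s d)) A η G U' := by
  set S : Fin D → Fin 3 → Plane := fun d => ⇑(s d) with hS
  set tr := ifaceTrace S η with htr
  set γ : Fin D → Fin D → Plane → ℝ := fun d e =>
    normalTrace S d e fun y => mulV (A d y) (G y) with hγ
  let μ : Fin D → Fin D → Measure Plane := fun d e =>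
    (Measure.hausdorffMeasure 1).restrict (interface S d e)
  have hμc : ∀ d e, μ d e = μ e d := fun d e => restrict_interface_comm S d e
  have htrc : ∀ d e, tr d e = tr e d := fun d e => ifaceTrace_comm S η d e
  have htri : ∀ d e, Integrable (tr d e) (μ d e) := fun d e => trace_integrable S η d e
  have hμe : ∀ d, ∀ e ∈ neighbors S d, ∃ k, μ d e = edgeMeasure (s d) k ∧
      openEdge (s d) k ⊆ closedTri (s e) := by
    intro d e he
    obtain ⟨k, hk⟩ := exists_interface_eq hs he
    refine ⟨k, restrict_interface hk, fun y hy => ?_⟩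
    have h1 : y ∈ interface S d e := hk ▸ openEdge_subset_closedEdge _ _ hy
    exact (isClosed_closedTri _).frontier_subset h1.2
  have hcont : ∀ {V : Fin D → Plane → ℝ}, (∀ d, MemVh S (mesh d) d (V d)) →
      ∀ d, ∀ e ∈ neighbors S d, MemLp (V d) ⊤ (μ d e) := by
    intro V hV d e he
    obtain ⟨k, hk, -⟩ := hμe d e he
    exact hk ▸ memLp_top_edge (hV d).1 k
  have hfl : ∀ {V : Fin D → Plane → ℝ}, (∀ d, MemVh S (mesh d) d (V d)) →
      ∀ d, ∀ e ∈ neighbors S d, MemLp (flux S A d d (V d)) ⊤ (μ d e) := by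
    intro V hV d e he
    obtain ⟨k, hk, -⟩ := hμe d e he
    obtain ⟨-, hL, -⟩ := hV d
    choose L hL using hL
    have hmT : ∀ m, ∃ b : Tri, ⇑b = mesh d m := fun m => exists_tri ((hmesh d).1.1 m)
    choose T hT using hmT
    rw [hk]
    refine memLp_top_flux (mesh := T) (L := L) (hA d) ?_ ?_ ?_ k
    · have : (fun m => ⇑(T m)) = mesh d := funext hT
      rw [this]; exact (hmesh d).1
    · simp only [hT]; exact (hmesh d).2
    · simpa only [hT] using hL
  have hopp : ∀ (V : Fin D → Plane → ℝ), ∀ d, ∀ e ∈ neighbors S d,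
      flux S A d e (V e) =ᵐ[μ d e] fun y => -flux S A e e (V e) y := by
    intro V d e he
    obtain ⟨k, hk, hsub⟩ := hμe d e he
    rw [hk]
    filter_upwards [ae_edgeMeasure_mem (s d) k] with y hy
    rw [flux, flux, hS]
    simp only
    rw [outwardNormal_eq_neg hs hy (hsub hy) (mem_neighbors_iff.1 he).1, inner_neg_left]
  have hmul : ∀ {f g : Plane → ℝ} {d e : Fin D}, MemLp f ⊤ (μ d e) → Integrable g (μ d e) →
      Integrable (fun y => f y * g y) (μ d e) := fun hf hg =>
    hf.integrable_mul (memLp_one_iff_integrable.2 hg)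
  have hγi : ∀ d, ∀ e ∈ neighbors S d, Integrable (γ d e) (μ d e) := fun d e he =>
    (normalTrace_spec (hflux d e he)).1
  have hsw : ∀ {V : Fin D → Plane → ℝ}, (∀ d, MemVh S (mesh d) d (V d)) →
      ∀ d, ∀ e ∈ neighbors S d, MemLp (V e) ⊤ (μ d e) ∧ MemLp (flux S A e e (V e)) ⊤ (μ d e) := by
    intro V hV d e he
    have he' : d ∈ neighbors S e := mem_neighbors_comm.1 he
    rw [hμc]
    exact ⟨hcont hV e d he', hfl hV e d he'⟩
  -- The elementary integrals: `α` for values and `φ` for fluxes against the trace of `η`, with `U`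
  -- for the new and `P` for the previous iterate, and `g` for the flux of `η` against the new
  -- iterate. The first index is the side from which the function is taken.
  let αU : Fin D → Fin D → ℝ := fun d e => ∫ y, U' d y * tr d e y ∂μ d e
  let αP : Fin D → Fin D → ℝ := fun d e => ∫ y, U d y * tr d e y ∂μ d e
  let φU : Fin D → Fin D → ℝ := fun d e => ∫ y, flux S A d d (U' d) y * tr d e y ∂μ d e
  let φP : Fin D → Fin D → ℝ := fun d e => ∫ y, flux S A d d (U d) y * tr d e y ∂μ d e
  let g : Fin D → Fin D → ℝ := fun d e => ∫ y, γ d e y * U' d y ∂μ d e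
  have hDE : ∀ d, ∀ e ∈ neighbors S d,
      bip S d e (fun y => -(lam * U' d y) + lam * U e y - flux S A e e (U e) y) (tr d e)
        = -(lam * αU d e) + lam * αP e d - φP e d := by
    intro d e he
    have i1 := hmul (hcont hU' d e he) (htri d e)
    have i2 := hmul (hsw hU d e he).1 (htri d e)
    have i3 := hmul (hsw hU d e he).2 (htri d e)
    have h1 : bip S d e (fun y => -(lam * U' d y) + lam * U e y - flux S A e e (U e) y) (tr d e)
        = ∫ y, (lam * (U e y * tr d e y) - lam * (U' d y * tr d e y))
            - flux S A e e (U e) y * tr d e y ∂μ d e :=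
      integral_congr_ae (Eventually.of_forall fun y => by ring)
    have i12 : Integrable
        (fun y => lam * (U e y * tr d e y) - lam * (U' d y * tr d e y)) (μ d e) :=
      (i2.const_mul lam).sub (i1.const_mul lam)
    rw [h1, integral_sub i12 i3,
      integral_sub (i2.const_mul lam) (i1.const_mul lam), integral_const_mul, integral_const_mul]
    simp only [αU, αP, φP, hμc e d, htrc e d]
    ring
  have hIE : ∀ d, ∀ e ∈ neighbors S d,
      bip S d e (fun y => lam * U' d y - lam * U d y) (tr d e)
        + bip S d e (fun y => flux S A d d (U d) y - flux S A d d (U' d) y) (tr d e)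
        = lam * αU d e - lam * αP d e + (φP d e - φU d e) := by
    intro d e he
    have i1 := hmul (hcont hU' d e he) (htri d e)
    have i2 := hmul (hcont hU d e he) (htri d e)
    have i3 := hmul (hfl hU d e he) (htri d e)
    have i4 := hmul (hfl hU' d e he) (htri d e)
    have h1 : bip S d e (fun y => lam * U' d y - lam * U d y) (tr d e)
        = ∫ y, lam * (U' d y * tr d e y) - lam * (U d y * tr d e y) ∂μ d e :=
      integral_congr_ae (Eventually.of_forall fun y => by ring)
    have h2 : bip S d e (fun y => flux S A d d (U d) y - flux S A d d (U' d) y) (tr d e)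
        = ∫ y, flux S A d d (U d) y * tr d e y - flux S A d d (U' d) y * tr d e y ∂μ d e :=
      integral_congr_ae (Eventually.of_forall fun y => by ring)
    rw [h1, h2, integral_sub (i1.const_mul lam) (i2.const_mul lam), integral_const_mul,
      integral_const_mul, integral_sub i3 i4]
  have hCE : ∀ d, ∀ e ∈ neighbors S d,
      bip S d e (fun y => flux S A d d (U' d) y - flux S A d e (U' e) y) (tr d e)
        + bip S d e (γ d e) (fun y => U' d y - U' e y)
        = φU d e + φU e d + (g d e + g e d) := by
    intro d e he
    have i1 := hmul (hfl hU' d e he) (htri d e)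
    have i2 := hmul (hsw hU' d e he).2 (htri d e)
    have he' : d ∈ neighbors S e := mem_neighbors_comm.1 he
    have hγe : Integrable (γ e d) (μ d e) := by rw [hμc]; exact hγi e d he'
    have i3 := hmul (hcont hU' d e he) (hγi d e he)
    have i4 := hmul (hsw hU' d e he).1 hγe
    have h1 : bip S d e (fun y => flux S A d d (U' d) y - flux S A d e (U' e) y) (tr d e)
        = ∫ y, flux S A d d (U' d) y * tr d e y + flux S A e e (U' e) y * tr d e y ∂μ d e := by
      refine integral_congr_ae ?_
      filter_upwards [hopp U' d e he] with y hy
      rw [hy]; ring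
    have h2 : bip S d e (γ d e) (fun y => U' d y - U' e y)
        = ∫ y, U' d y * γ d e y + U' e y * γ e d y ∂μ d e := by
      refine integral_congr_ae ?_
      -- Flux continuity replaces `-γ d e` by `γ e d`, so each value of the new iterate is paired
      -- with the flux of `η` from its own side.
      filter_upwards [normalTrace_add_eq_zero hs hA hψ hη hflux he] with y hy
      have hy' : γ e d y = -γ d e y := by linarith
      rw [hy']; ring
    rw [h1, h2, integral_add i1 i2, integral_add i3 i4]
    simp only [φU, g, hμc e d, htrc e d, mul_comm]
  have hgreen : ∀ d, ip S d (U' d) (ψ d) = energy S A d (gradient (U' d)) G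
      - ∑ e ∈ neighbors S d, g d e := by
    intro d
    rw [green_discrete hs hA hψ hη hflux d (hmesh d).2 (hU' d), energy_comm d (hsymm d)]
    rfl
  have hq : qoi S ψ (fun d y => u y - U' d y)
      = ∑ d, ip S d (ψ d) u - ∑ d, ip S d (U' d) (ψ d) := by
    rw [qoi, ← Finset.sum_sub_distrib]
    refine Finset.sum_congr rfl fun d _ => ?_
    have j1 : Integrable (fun y => ψ d y * u y) (volume.restrict (openTri (s d))) :=
      (hψ d).integrable_mul (memLp_openTri hu.1.1 d)
    obtain ⟨B, hB⟩ := (isCompact_closedTri (s d)).exists_bound_of_continuousOn (hU' d).1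
    have j2 : Integrable (fun y => U' d y * ψ d y) (volume.restrict (openTri (s d))) := by
      have hm := (isOpen_openTri (s d)).measurableSet
      refine Integrable.bdd_mul (c := B) ((hψ d).integrable (by norm_num))
        (((hU' d).1.mono (openTri_subset_closedTri _)).aestronglyMeasurable hm) ?_
      filter_upwards [ae_restrict_mem hm] with y hy using hB y (openTri_subset_closedTri _ hy)
    rw [ip, ip, ip, ← integral_sub j1 j2]
    exact integral_congr_ae (Eventually.of_forall fun y => by ring)
  -- The adjoint equation is tested with `u` and the primal equation with `η`; the two energies
  -- agree by symmetry of `A`.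
  have hprimal : ∑ d, ip S d (ψ d) u = ∑ d, ip S d (F d) η := by
    rw [← hη.2 u Gu hu.1, ← hu.2 η G hη.1]
    exact Finset.sum_congr rfl fun d _ => energy_comm d (hsymm d) _ _
  rw [hq, hprimal, discretizationError, iterationError, transformationError,
    Finset.sum_congr rfl fun d _ => hgreen d,
    Finset.sum_congr rfl fun d _ => congrArg₂ (· + ·) rfl
      (Finset.sum_congr rfl fun e he => hDE d e he),
    Finset.sum_congr rfl fun d _ => Finset.sum_congr rfl fun e he => hIE d e he,
    Finset.sum_congr rfl fun d _ => Finset.sum_congr rfl fun e he => hCE d e he]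
  simp only [Finset.sum_add_distrib, Finset.sum_sub_distrib, Finset.sum_neg_distrib]
  -- Exchanging `d` and `e`: `s1` and `s2` cancel the previous iterate between the first two
  -- contributions, while `s3` and `s4` absorb the factor `1 / 2` of the last one.
  have s1 := sum_neighbors_comm s fun d e => lam * αP d e
  have s2 := sum_neighbors_comm s φP
  have s3 := sum_neighbors_comm s φU
  have s4 := sum_neighbors_comm s g
  linarith

end Representation

end LionsDD

end

open LionsDD in
theorem mainTheorem4
    -- the triangles `Ω_d` (vertices `s d k`) that partition the reference domain `Ω = domain s`
    {D : ℕ} (s : Fin D → Fin 3 → Plane) (hs : IsConforming s)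
    -- the triangles `Ω_d(θ)` of the perturbed domain, obtained by moving the nodes by `θ`
    (θ : Plane → Plane) (r : Fin D → Fin 3 → Plane) (hr : r = fun d k => s d k + θ (s d k))
    (hrc : IsConforming r)
    -- the large set `Ωs` that contains the perturbed domain, and the data `a`, `f`, `ψ` on it
    (Ωs : Set Plane) (hΩs : domain r ⊆ Ωs)
    (a : Plane → Mat) (ha : ContinuousOn a (closure Ωs))
    (hsymm : ∀ x ∈ closure Ωs, (a x).IsSymm)
    (a₀ : ℝ) (ha₀ : 0 < a₀)
    (hcoer : ∀ x ∈ closure Ωs, ∀ w : Plane, a₀ * ‖w‖ ^ 2 ≤ inner ℝ w (mulV (a x) w))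
    (f : Plane → ℝ) (hf : ContinuousOn f (closure Ωs))
    (ψ : Plane → ℝ) (hψ : MemLp ψ 2 (volume.restrict Ωs))
    -- the data of the transformed problem
    (A : Fin D → Plane → Mat) (hA : A = transCoeff s r a)
    (F : Fin D → Plane → ℝ) (hF : F = transData s r f)
    (ψt : Fin D → Plane → ℝ) (hψt : ψt = transData s r ψ)
    -- the solution `u` of the transformed problem and the adjoint solution `η`, with gradients
    (u : Plane → ℝ) (Gu : Plane → Plane) (hu : IsWeakSolution s A F u Gu)
    (η : Plane → ℝ) (Gη : Plane → Plane) (hη : IsWeakSolution s A ψt η Gη)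
    -- the normal flux of `η` has boundary values on the interfaces
    (hflux : ∀ d, ∀ e ∈ neighbors s d,
      ∃ γ, IsNormalTrace s d e (fun y => mulV (A d y) (Gη y)) γ)
    -- the meshes of the subdomains
    {M : Fin D → ℕ} (mesh : ∀ d, Fin (M d) → Fin 3 → Plane)
    (hmesh : ∀ d, IsConforming (mesh d) ∧ ⋃ m, closedTri (mesh d m) = closedTri (s d))
    -- the iterates `U i d` of the discrete Lions iteration with parameter `lam`
    (lam : ℝ) (hlam : 0 ≤ lam) (I : ℕ) (U : ℕ → Fin D → Plane → ℝ)
    (hU : ∀ i ≤ I, ∀ d, MemVh s (mesh d) d (U i d))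
    (hstep : ∀ i, 1 ≤ i → i ≤ I → IsLionsStep s mesh A F lam (U (i - 1)) (U i))
    (i : ℕ) (hi : 1 ≤ i) (hiI : i ≤ I) :
    qoi s ψt (fun d y => u y - U i d y)
      = discretizationError s A F lam η Gη (U (i - 1)) (U i)
        + iterationError s A lam η (U (i - 1)) (U i)
        + transformationError s A η Gη (U i) := by
  clear hr
  obtain ⟨b, rfl⟩ : ∃ b : Fin D → Tri, (fun d => ⇑(b d)) = s := by
    choose b hb using fun d => exists_tri (hs.1 d)
    exact ⟨b, funext hb⟩
  obtain ⟨c, rfl⟩ : ∃ c : Fin D → Tri, (fun d => ⇑(c d)) = r := by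
    choose c hc using fun d => exists_tri (hrc.1 d)
    exact ⟨c, funext hc⟩
  -- The data are controlled on `closure Ωs`, which contains the closed perturbed triangles because
  -- each of them is the closure of its interior.
  have hsub : ∀ d, closedTri (c d) ⊆ closure Ωs := fun d => by
    rw [← closure_openTri]
    exact closure_mono ((openTri_subset_domain c d).trans hΩs)
  have hAc : ∀ d, ContinuousOn (A d) (closedTri (b d)) := hA ▸ continuousOn_transCoeff ha hsub
  have hAs : ∀ d, ∀ y ∈ openTri (b d), (A d y).IsSymm := fun d y hy => by
    rw [hA]
    exact isSymm_transCoeff _ _ a d y (hsymm _ (hsub d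
      (affInv_mem (b d) (c d) (openTri_subset_closedTri _ hy))))
  have hψ2 : ∀ d, MemLp (ψt d) 2 (volume.restrict (openTri (b d))) := fun d => by
    rw [hψt]
    exact (memLp_comp_affInv (b d) (c d) (hψ.mono_measure (Measure.restrict_mono
      ((openTri_subset_domain c d).trans hΩs) le_rfl))).const_mul _
  exact error_representation hs hAc hAs hψ2 hu hη hflux hmesh lam (hU (i - 1) (by omega)) (hU i hiI)
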